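/- Let $d\ge 1$, $0<p,\theta\le\infty$, $r\in\mathbb N$, and let $a\in\mathbb R^d$ satisfy $1/p<a_1<a_2\le\dots\le a_d<r$ (for $d=1$: $1/p<a_1<r$). Write $x_+=\max(x,0)$ and $\mathbb I^d=[0,1]^d$. **The class.** For $e\subset\{1,\dots,d\}$ let $\omega_r^e(f,t)_p=\sup_{|h_i|<t_i,\,i\in e}\|\Delta^{r,e}_hf\|_{L_p}$, where $\Delta_h^{r,e}$ is the composition over $i\in e$ of the $r$-th differences with step $h_i$ in $x_i$ and the norm is taken over those $x\in\mathbb I^d$ with $x_i+rh_i\in[0,1]$ for $i\in e$. Put $$|f|_e=\Big(\int_{\mathbb I^d}\Big\{\omega_r^e(f,t)_p\prod_{i\in e}t_i^{-a_i}\Big\}^\theta\prod_{i\in e}t_i^{-1}\,dt\Big)^{1/\theta}$$ (a supremum over $t\in\mathbb I^d$ if $\theta=\infty$), $\|f\|_{B^a_{p,\theta}}=\sum_{e}|f|_e$, and let $U^a_{p,\theta}$ be the set of continuous functions $f$ on $\mathbb I^d$ with $\|f\|_{B^a_{p,\theta}}\le1$. **Optimal cubature.** With $I(f)=\int_{\mathbb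 I^d}f$, put $i_n(W)=\inf\sup_{f\in W}|I(f)-\sum_{j=1}^n\lambda_jf(x^j)|$, the infimum being over $x^1,\dots,x^n\in\mathbb I^d$ and $\lambda_1,\dots,\lambda_n\in\mathbb R$. **The sampling operators.** Let $M$ be the centered cardinal B-spline of order $r$ with support $[-r/2,r/2]$, and let $(\lambda(j))_{|j|\le\mu}$, $\mu\ge r/2-1$, be an even real sequence such that $Q(f,x)=\sum_{s\in\mathbb Z}\sum_{|j|\le\mu}\lambda(j)f(s-j)M(x-s)$ reproduces all polynomials of degree at most $r-1$. For $k\in\mathbb Z_+$ and $f$ on $[0,1]$ let $\bar f_k$ be the extension of $f$ to $\mathbb R$ which for $x<0$ (for $x>1$) is the Lagrange polynomial interpolating $f$ at the $\min(r,2^k+1)$ leftmost (rightmost) points of $\{j2^{-k}:0\le j\le2^k\}$. Let $$Q_k(f,x)=\sum_{-r/2<s<2^k+r/2}\ \sum_{|j|\le\mu}\lambda(j)\,\bar f_k(2^{-k}(s-j))\,M(2^kx-s),\qquad Q_{-1}=0.$$ For $k\in\mathbb Z_+^d$ let $q_k=\prod_{i=1}^d(Q_{k_i}-Q_{k_i-1})$,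 the $i$-th factor acting in the variable $x_i$, and for finite $\Delta\subset\mathbb Z^d_+$ let $$R_\Delta=\sum_{k\in\Delta}q_k,\quad K(\Delta)=\{(k,s):k\in\Delta,\ s\in\mathbb Z_+^d,\ s_i\le2^{k_i}\},\quad G(\Delta)=\{2^{-k}s:(k,s)\in K(\Delta)\},$$ where $2^{-k}s=(2^{-k_1}s_1,\dots,2^{-k_d}s_d)$. Let $\psi_{k,s}$ be the coefficient of $f(2^{-k}s)$ in $q_k(f)$, i.e. the image under $q_k$ of the function equal to $1$ at $2^{-k}s$ and $0$ elsewhere. **The sparse grids.** Fix $0<\varepsilon<a_2-a_1$ (any $\varepsilon>0$ if $d=1$). For $\xi\ge0$ let $$\Delta'(\xi)=\{k\in\mathbb Z_+^d:(b,k)-(1/p-1)_+(k_1+\dots+k_d)\le\xi\},$$ where $b=a$ if $\theta\le1$ and $b=(a_1,a_2-\varepsilon,\dots,a_d-\varepsilon)$ if $\theta>1$. For given $n$ let $\xi_n\ge0$ be a largest parameter with $|G(\Delta'(\xi_n))|\le n$, in the sense that $\Delta'(\eta)\subset\Delta'(\xi_n)$ for every $\eta\ge0$ with $|G(\Delta'(\eta))|\le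 n$. **Theorem.** There are constants $c,C>0$, independent of $n$, such that the following holds. (i) For all $n\ge1$: $\;c\,n^{-a_1+(1/p-1)_+}\le i_n(U^a_{p,\theta})\le C\,n^{-a_1+(1/p-1)_+}$. (ii) For all $n\ge2^d$ a $\xi_n$ as above exists, and for each such $\xi_n$ the set $\Delta'(\xi_n)$ is finite, every $\psi_{k,s}$ is integrable over $\mathbb I^d$, one has $R_{\Delta'(\xi_n)}(f)=\sum_{(k,s)\in K(\Delta'(\xi_n))}f(2^{-k}s)\psi_{k,s}$ on $\mathbb I^d$ for every function $f$, and the cubature formula generated by $R_{\Delta'(\xi_n)}$ on $G(\Delta'(\xi_n))$, $$I_n^*(f)=\sum_{(k,s)\in K(\Delta'(\xi_n))}\lambda_{k,s}\,f(2^{-k}s),\qquad \lambda_{k,s}=\int_{\mathbb I^d}\psi_{k,s}(x)\,dx,$$ is asymptotically optimal: $$i_n(U^a_{p,\theta})\le\sup_{f\in U^a_{p,\theta}}|I(f)-I_n^*(f)|\le C\,n^{-a_1+(1/p-1)_+}.$$ Hence $\sup_{f\in U^a_{p,\theta}}|I(f)-I_n^*(f)|\asymp i_n(U^a_{p,\theta})\asymp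 n^{-a_1+(1/p-1)_+}$. -/

import Mathlib

open MeasureTheory
open scoped ENNReal

noncomputable section

namespace SparseGrid

/-- The unit cube `[0,1]^d`. -/
def cube (d : ℕ) : Set (Fin d → ℝ) := Set.Icc 0 1

/-- Apply the univariate operator `T i` in the `i`-th variable, the other variables held fixed,
for every `i`: the composition `T 0 ∘ T 1 ∘ ... ∘ T (d-1)` acting on functions of `d` variables. -/
def tensorOp {d : ℕ} (T : Fin d → (ℝ → ℝ) → ℝ → ℝ) (f : (Fin d → ℝ) → ℝ) : (Fin d → ℝ) → ℝ :=
  (List.finRange d).foldr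
    (fun i g x => T i (fun y => g (Function.update x i y)) (x i)) f

/-! ### Mixed moduli of smoothness and the Besov class -/

/-- The univariate `r`-th difference with step `h`. -/
def diffOp (r : ℕ) (h : ℝ) (f : ℝ → ℝ) (x : ℝ) : ℝ :=
  ∑ j ∈ Finset.range (r + 1), (-1 : ℝ) ^ (r - j) * (r.choose j : ℝ) * f (x + j * h)

open Classical in
/-- The mixed `(r, e)`-th difference. -/
def mixedDiff {d : ℕ} (r : ℕ) (e : Finset (Fin d)) (h : Fin d → ℝ) (f : (Fin d → ℝ) → ℝ) :
    (Fin d → ℝ) → ℝ :=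
  tensorOp (fun i => if i ∈ e then diffOp r (h i) else id) f

/-- The points of the cube at which the mixed `(r, e)`-th difference with step `h` only uses
points of the cube. -/
def diffDomain {d : ℕ} (r : ℕ) (e : Finset (Fin d)) (h : Fin d → ℝ) : Set (Fin d → ℝ) :=
  {x | x ∈ cube d ∧ ∀ i ∈ e, x i + r * h i ∈ Set.Icc (0 : ℝ) 1}

/-- The mixed `(r, e)`-th modulus of smoothness in the `L_p` quasi-norm, `0 < p ≤ ∞`. -/
def modulus {d : ℕ} (r : ℕ) (e : Finset (Fin d)) (p : ℝ≥0∞) (f : (Fin d → ℝ) → ℝ)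
    (t : Fin d → ℝ) : ℝ≥0∞ :=
  ⨆ (h : Fin d → ℝ) (_ : ∀ i ∈ e, |h i| < t i),
    eLpNorm (mixedDiff r e h f) p (volume.restrict (diffDomain r e h))

/-- The quasi-semi-norm belonging to `e`, for the weight `Ω(t) = ∏ i, t_i ^ a_i`. -/
def besovSeminorm {d : ℕ} (r : ℕ) (a : Fin d → ℝ) (p θ : ℝ≥0∞) (e : Finset (Fin d))
    (f : (Fin d → ℝ) → ℝ) : ℝ≥0∞ :=
  if θ = ∞ then
    ⨆ t ∈ cube d, modulus r e p f t / ENNReal.ofReal (∏ i ∈ e, t i ^ a i)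
  else
    (∫⁻ t in cube d,
      (modulus r e p f t / ENNReal.ofReal (∏ i ∈ e, t i ^ a i)) ^ θ.toReal *
        ENNReal.ofReal (∏ i ∈ e, (t i)⁻¹)) ^ (1 / θ.toReal)

/-- The quasi-norm of the Besov space of mixed smoothness `a`, possibly infinite. -/
def besovNorm {d : ℕ} (r : ℕ) (a : Fin d → ℝ) (p θ : ℝ≥0∞) (f : (Fin d → ℝ) → ℝ) : ℝ≥0∞ :=
  ∑ e : Finset (Fin d), besovSeminorm r a p θ e f

/-- The unit ball of the Besov space of mixed smoothness `a`. Function values are sampled, so the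
elements are taken as continuous functions on the cube (the values off the cube play no role). -/
def besovBall {d : ℕ} (r : ℕ) (a : Fin d → ℝ) (p θ : ℝ≥0∞) : Set ((Fin d → ℝ) → ℝ) :=
  {f | ContinuousOn f (cube d) ∧ besovNorm r a p θ f ≤ 1}

/-! ### Optimal cubature -/

/-- The integral over the cube. -/
def cubeIntegral {d : ℕ} (f : (Fin d → ℝ) → ℝ) : ℝ := ∫ x in cube d, f x

/-- The worst case error over `W` of a functional `J` as an approximation of the integral. -/
def integrationError {d : ℕ} (W : Set ((Fin d → ℝ) → ℝ)) (J : ((Fin d → ℝ) → ℝ) → ℝ) : ℝ≥0∞ :=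
  ⨆ f ∈ W, ENNReal.ofReal |cubeIntegral f - J f|

/-- The optimal error `i_n(W)` of cubature formulas with `n` nodes in the cube. -/
def optimalCubature {d : ℕ} (n : ℕ) (W : Set ((Fin d → ℝ) → ℝ)) : ℝ≥0∞ :=
  ⨅ (X : Fin n → Fin d → ℝ) (_ : ∀ j, X j ∈ cube d) (L : Fin n → ℝ),
    integrationError W (fun f => ∑ j, L j * f (X j))

/-! ### B-spline quasi-interpolation -/

/-- The centered B-spline of order `r`, with support `[-r/2, r/2]`, for `r ≥ 1`. -/
def bSpline : ℕ → ℝ → ℝ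
  | 0 => 0
  | 1 => Set.indicator (Set.Ico (-(1 / 2)) (1 / 2)) 1
  | r + 2 => fun x => ∫ y in (-(1 / 2) : ℝ)..(1 / 2), bSpline (r + 1) (x - y)

/-- The functional `Λ(f, s; h) = ∑_{|j| ≤ μ} lam(j) f(h (s - j))`. -/
def maskFunctional (μ : ℕ) (lam : ℤ → ℝ) (h : ℝ) (f : ℝ → ℝ) (s : ℤ) : ℝ :=
  ∑ j ∈ Finset.Icc (-(μ : ℤ)) μ, lam j * f (h * ((s : ℝ) - j))

/-- The even sequence `lam` on `{|j| ≤ μ}`, `μ ≥ r/2 - 1`, defines a quasi-interpolation operator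
`Q(f, x) = ∑_s Λ(f, s) M(x - s)`, that is, `Q` reproduces the polynomials of degree at most `r - 1`
(for each `x` only finitely many summands are nonzero). -/
structure IsQuasiInterpolation (r μ : ℕ) (lam : ℤ → ℝ) : Prop where
  le_width : r ≤ 2 * μ + 2
  even : ∀ j : ℤ, |j| ≤ μ → lam (-j) = lam j
  reproduces : ∀ P : Polynomial ℝ, P.degree < r → ∀ x : ℝ,
    ∑ᶠ s : ℤ, maskFunctional μ lam 1 (fun y => P.eval y) s * bSpline r (x - s) = P.eval x

/-- The extension of a function on `[0,1]` to the line by the Lagrange polynomials that interpolate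
it at the `r` leftmost and at the `r` rightmost points of the grid `{j 2^{-k} : 0 ≤ j ≤ 2^k}`; at
the finitely many levels at which the grid has fewer than `r` points, all of them are used. -/
def extendLine (r k : ℕ) (f : ℝ → ℝ) (x : ℝ) : ℝ :=
  if x < 0 then
    (Lagrange.interpolate (Finset.range (min r (2 ^ k + 1))) (fun j => (j : ℝ) / 2 ^ k)
      (fun j => f ((j : ℝ) / 2 ^ k))).eval x
  else if x ≤ 1 then f x
  else
    (Lagrange.interpolate (Finset.range (min r (2 ^ k + 1))) (fun j => ((2 : ℝ) ^ k - j) / 2 ^ k)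
      (fun j => f (((2 : ℝ) ^ k - j) / 2 ^ k))).eval x

/-- `J(k) = {s : -r/2 < s < 2^k + r/2}`. -/
def splineIndex (r k : ℕ) : Finset ℤ :=
  (Finset.Icc (-(r : ℤ)) (2 ^ k + r)).filter (fun s => -(r : ℤ) < 2 * s ∧ 2 * s < 2 ^ (k + 1) + r)

/-- The univariate operator `Q_k` for functions on `[0,1]`. -/
def quasiInterp (r μ : ℕ) (lam : ℤ → ℝ) (k : ℕ) (f : ℝ → ℝ) (x : ℝ) : ℝ :=
  ∑ s ∈ splineIndex r k,
    maskFunctional μ lam (1 / 2 ^ k) (extendLine r k f) s * bSpline r (2 ^ k * x - s)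

/-- The univariate operator `Q_k - Q_{k-1}`, where `Q_{-1} = 0`. -/
def levelOp (r μ : ℕ) (lam : ℤ → ℝ) : ℕ → (ℝ → ℝ) → ℝ → ℝ
  | 0 => quasiInterp r μ lam 0
  | k + 1 => fun f x => quasiInterp r μ lam (k + 1) f x - quasiInterp r μ lam k f x

/-- The mixed operator `q_k = ∏ i, (Q_{k_i} - Q_{k_i - 1})`. -/
def mixedLevelOp {d : ℕ} (r μ : ℕ) (lam : ℤ → ℝ) (k : Fin d → ℕ) (f : (Fin d → ℝ) → ℝ) :
    (Fin d → ℝ) → ℝ :=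
  tensorOp (fun i => levelOp r μ lam (k i)) f

/-- `R_Δ(f) = ∑_{k ∈ Δ} q_k(f)`, for finite `Δ`. -/
def samplingOp {d : ℕ} (r μ : ℕ) (lam : ℤ → ℝ) (Δ : Set (Fin d → ℕ)) (f : (Fin d → ℝ) → ℝ)
    (x : Fin d → ℝ) : ℝ :=
  ∑ᶠ k ∈ Δ, mixedLevelOp r μ lam k f x

/-! ### Sparse grids -/

/-- The point `2^{-k} s`. -/
def gridPoint {d : ℕ} (k s : Fin d → ℕ) : Fin d → ℝ := fun i => (s i : ℝ) / 2 ^ k i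

/-- `K(Δ) = {(k, s) : k ∈ Δ, 0 ≤ s_i ≤ 2^{k_i}}`. -/
def gridIndex {d : ℕ} (Δ : Set (Fin d → ℕ)) : Set ((Fin d → ℕ) × (Fin d → ℕ)) :=
  {ks | ks.1 ∈ Δ ∧ ∀ i, ks.2 i ≤ 2 ^ ks.1 i}

/-- The grid `G(Δ)` (a set of points, without multiplicities). -/
def grid {d : ℕ} (Δ : Set (Fin d → ℕ)) : Set (Fin d → ℝ) :=
  (fun ks => gridPoint ks.1 ks.2) '' gridIndex Δ

/-- The function `ψ_{k,s}`: the coefficient of the sample `f(2^{-k} s)` in `q_k(f)`, that is, the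
image under `q_k` of the function that is `1` at `2^{-k} s` and `0` elsewhere. -/
def sampleFun {d : ℕ} (r μ : ℕ) (lam : ℤ → ℝ) (k s : Fin d → ℕ) : (Fin d → ℝ) → ℝ :=
  mixedLevelOp r μ lam k (Set.indicator {gridPoint k s} 1)

/-- The cubature formula generated by `R_Δ`: the sum over `(k, s) ∈ K(Δ)` of
`λ_{k,s} f(2^{-k} s)`, where `λ_{k,s}` is the integral of `ψ_{k,s}`. -/
def gridCubature {d : ℕ} (r μ : ℕ) (lam : ℤ → ℝ) (Δ : Set (Fin d → ℕ))
    (f : (Fin d → ℝ) → ℝ) : ℝ :=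
  ∑ᶠ ks ∈ gridIndex Δ,
    cubeIntegral (sampleFun r μ lam ks.1 ks.2) * f (gridPoint ks.1 ks.2)

/-- `(1/p - 1/q)_+`. -/
def gap (p q : ℝ≥0∞) : ℝ := max (p⁻¹.toReal - q⁻¹.toReal) 0

/-- The set `A` of triples `(p, θ, q)`; its complement among the triples is the set `B`. -/
def InA (p θ q : ℝ≥0∞) : Prop :=
  (q ≤ p ∧ θ ≤ min q 1) ∨ (p < q ∧ q < ∞ ∧ θ ≤ q) ∨ (p < q ∧ q = ∞ ∧ θ ≤ 1)

open Classical in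
/-- The set `Δ'(ξ)` of levels, with `a(ε) = (a_1, a_2 - ε, ..., a_d - ε)` in place of `a` when
`(p, θ, q)` belongs to `B`. -/
def levelSet {d : ℕ} [NeZero d] (a : Fin d → ℝ) (p θ q : ℝ≥0∞) (ε ξ : ℝ) : Set (Fin d → ℕ) :=
  if InA p θ q then
    {k | ∑ i, a i * (k i : ℝ) - gap p q * ∑ i, (k i : ℝ) ≤ ξ}
  else
    {k | ∑ i, (if i = 0 then a i else a i - ε) * (k i : ℝ) - gap p q * ∑ i, (k i : ℝ) ≤ ξ}

/-- `ξ ≥ 0` is a largest parameter for which the grid `G(Δ(ξ))` has at most `n` points. The number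
of points is a right-continuous step function of `ξ`, so "largest" can only refer to the set `Δ(ξ)`:
this set contains every `Δ(η)` whose grid has at most `n` points. -/
def IsLargestParam {d : ℕ} (Δ : ℝ → Set (Fin d → ℕ)) (n : ℕ) (ξ : ℝ) : Prop :=
  0 ≤ ξ ∧ (grid (Δ ξ)).encard ≤ n ∧
    ∀ η : ℝ, 0 ≤ η → (grid (Δ η)).encard ≤ n → Δ η ⊆ Δ ξ

end SparseGrid

end

noncomputable section

namespace SparseGrid

/-! ### Tensor products of finitely supported functionals -/

/-! The lower bound is a fooling argument in the variable `x 0`. Of `2 n` disjoint translates of a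
bump at scale `1 / (2 n)`, at least `n` vanish at the given nodes. For `p ≥ 1` the sum of these,
with amplitude of order `n ^ (-a 0)`, lies in the unit ball and has integral of order `n ^ (-a 0)`.
For `p < 1` a single bump is better: its short support lowers every `L_p` quasi-norm by `n ^
(-1/p)`, which permits a larger amplitude (`exists_besovNorm_bumpSum_le`,
`exists_fooling_function`).

For the upper bound, the sums of `q_k` over the boxes `k_i ≤ m` telescope to tensor products of
`Q_m`, which converge uniformly. Hence the error of the formula generated by `R_Δ` is at most `∑_{k
∉ Δ} |∫ q_k f|` (`enorm_cubature_error_le`). The core is `levelFun_bounds`: `|∫ q_k f|` is at most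
of order `2 ^ (-(a,k) + (1/p-1)_+ |k|)`, and for `θ ≤ 1` these numbers are even summable against the
inverse weights.

The difficulty there is that samples are not controlled by `L_p` quasi-norms. Each sample at a grid
point of level `k` is therefore replaced by the extrapolation from `r` neighbouring points of a
lattice `2 ^ (-m) (ζ + ℤ)`, `m = k + k₀ + j`, and the extrapolations are telescoped in `j`. Apart
from finitely many coarse levels, every term is a sum of local functionals annihilating polynomials
of degree below `r`: for `j = 0` because `Q` reproduces polynomials, for `j > 0` because two exact
extrapolations are compared. So it is a bounded combination of `r`-th differences of step `2 ^ (-m)`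
(`exists_diff_coef`, `exists_lattice_decomposition`). With `ζ` the fractional part of `2 ^ m z` the
lattices of one `z` are nested, and `z ↦ ζ` preserves Lebesgue measure, being an iterate of the
doubling map. Averaging the `p`-th power over `z` turns values at lattice points into `L_p`
quasi-norms of differences (`enorm_tens_levelFun_le`). The refinement costs slightly more than `2 ^
(|j|/p)`, which the decay `2 ^ (-(a,j))` of the differences regains since every `a i > 1/p`.

The rest is counting. Let `c` be the slopes of the linear form defining `Δ'(ξ)`. Since `c 0 = a 0 -
(1/p-1)_+` is the strict minimum, the grid has `O(2 ^ (ξ / c 0))` points without logarithms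
(`sum_levels_le`), so `2 ^ (-ξ)` is `O(n ^ (-c 0))` at a largest parameter
(`exists_two_rpow_neg_le`). Off `Δ'(ξ)` the sum of `|∫ q_k f|` is `O(2 ^ (-ξ))`: for `θ ≤ 1` by the
weighted summability, for `θ > 1` by a geometric series that `ε` makes convergent
(`tsum_compl_levels_le`). -/

/-- The value at `f` of the tensor product of finitely supported functionals. -/
def tensSum {d : ℕ} (f : (Fin d → ℝ) → ℝ) (φ : Fin d → ℝ →₀ ℝ) : ℝ :=
  ∑ x ∈ Fintype.piFinset (fun i => (φ i).support), (∏ i, φ i (x i)) * f x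

/-- Functionals with different supports can be compared only over a common box of nodes; both
linearity axioms of `tens` rest on this. -/
lemma tensSum_eq_sum {d : ℕ} (f : (Fin d → ℝ) → ℝ) (φ : Fin d → ℝ →₀ ℝ) (A : Fin d → Finset ℝ)
    (hA : ∀ i, (φ i).support ⊆ A i) :
    tensSum f φ = ∑ x ∈ Fintype.piFinset A, (∏ i, φ i (x i)) * f x := by
  refine Finset.sum_subset (Fintype.piFinset_subset _ _ hA) fun x _ hx => ?_
  rw [Fintype.mem_piFinset] at hx
  push Not at hx
  obtain ⟨i, hi⟩ := hx
  rw [Finset.prod_eq_zero (Finset.mem_univ i) (by simpa using hi), zero_mul]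

/-- The tensor product of finitely supported functionals, as a multilinear map. -/
def tens {d : ℕ} (f : (Fin d → ℝ) → ℝ) : MultilinearMap ℝ (fun _ : Fin d => ℝ →₀ ℝ) ℝ :=
  MultilinearMap.mk' (tensSum f)
    (by
      classical
      intro m i x y
      let A : Fin d → Finset ℝ := fun j => (m j).support ∪ (x.support ∪ y.support)
      have key : ∀ w : ℝ →₀ ℝ, w.support ⊆ x.support ∪ y.support →
          ∀ j, (Function.update m i w j).support ⊆ A j := by
        intro w hw j
        by_cases hj : j = i
        · subst hj; simpa [A] using hw.trans Finset.subset_union_right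
        · simp [A, Function.update_of_ne hj]
      rw [tensSum_eq_sum f _ A (key _ Finsupp.support_add),
        tensSum_eq_sum f _ A (key _ Finset.subset_union_left),
        tensSum_eq_sum f _ A (key _ Finset.subset_union_right), ← Finset.sum_add_distrib]
      refine Finset.sum_congr rfl fun v _ => ?_
      rw [← add_mul]
      congr 1
      have : ∀ w : ℝ →₀ ℝ, ∏ j, Function.update m i w j (v j) =
          w (v i) * ∏ j ∈ Finset.univ.erase i, m j (v j) := by
        intro w
        rw [← Finset.mul_prod_erase _ _ (Finset.mem_univ i)]
        simp only [Function.update_self]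
        congr 1
        exact Finset.prod_congr rfl fun j hj => by
          rw [Function.update_of_ne (Finset.ne_of_mem_erase hj)]
      rw [this, this, this, Finsupp.add_apply, add_mul])
    (by
      classical
      intro m i c x
      let A : Fin d → Finset ℝ := fun j => (m j).support ∪ x.support
      have key : ∀ w : ℝ →₀ ℝ, w.support ⊆ x.support →
          ∀ j, (Function.update m i w j).support ⊆ A j := by
        intro w hw j
        by_cases hj : j = i
        · subst hj; simpa [A] using hw.trans Finset.subset_union_right
        · simp [A, Function.update_of_ne hj]
      rw [tensSum_eq_sum f _ A (key _ Finsupp.support_smul),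
        tensSum_eq_sum f _ A (key _ subset_rfl), smul_eq_mul, Finset.mul_sum]
      refine Finset.sum_congr rfl fun v _ => ?_
      rw [← mul_assoc]
      congr 1
      have : ∀ w : ℝ →₀ ℝ, ∏ j, Function.update m i w j (v j) =
          w (v i) * ∏ j ∈ Finset.univ.erase i, m j (v j) := by
        intro w
        rw [← Finset.mul_prod_erase _ _ (Finset.mem_univ i)]
        simp only [Function.update_self]
        congr 1
        exact Finset.prod_congr rfl fun j hj => by
          rw [Function.update_of_ne (Finset.ne_of_mem_erase hj)]
      rw [this, this, Finsupp.smul_apply, smul_eq_mul, mul_assoc])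

lemma tens_apply {d : ℕ} (f : (Fin d → ℝ) → ℝ) (φ : Fin d → ℝ →₀ ℝ) :
    tens f φ = tensSum f φ := rfl

lemma tens_single {d : ℕ} (f : (Fin d → ℝ) → ℝ) (y : Fin d → ℝ) :
    tens f (fun i => Finsupp.single (y i) 1) = f y := by
  rw [tens_apply, tensSum_eq_sum f _ (fun i => {y i}) fun i => Finsupp.support_single_subset]
  simp [Fintype.piFinset_singleton]

/-- The nodes `y i l` may coincide for different `l`, so the coefficients need not be those of the
reduced functional. Expanding by multilinearity makes this irrelevant. -/
lemma tens_rep {d : ℕ} {κ : Type*} (f : (Fin d → ℝ) → ℝ) (I : Fin d → Finset κ)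
    (c y : Fin d → κ → ℝ) :
    tens f (fun i => ∑ l ∈ I i, c i l • Finsupp.single (y i l) 1) =
      ∑ p ∈ Fintype.piFinset I, (∏ i, c i (p i)) * f (fun i => y i (p i)) := by
  classical
  rw [MultilinearMap.map_sum_finset]
  refine Finset.sum_congr rfl fun p _ => ?_
  rw [(tens f).map_smul_univ (fun i => c i (p i)) (fun i => Finsupp.single (y i (p i)) 1),
    tens_single, smul_eq_mul]

/-- Two finitely supported functionals with the same values on all functions agree. -/
lemma functional_ext {φ ψ : ℝ →₀ ℝ}
    (h : ∀ g : ℝ → ℝ, Finsupp.linearCombination ℝ g φ = Finsupp.linearCombination ℝ g ψ) :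
    φ = ψ := by
  classical
  ext x
  have := h (Pi.single x 1)
  have key : ∀ χ : ℝ →₀ ℝ, Finsupp.linearCombination ℝ (Pi.single x (1 : ℝ)) χ = χ x := by
    intro χ
    simp only [Finsupp.linearCombination_apply, Finsupp.sum, Pi.single_apply, smul_eq_mul,
      mul_ite, mul_one, mul_zero, Finset.sum_ite_eq', Finsupp.mem_support_iff, ne_eq, ite_not]
    split_ifs with h0
    · exact h0.symm
    · rfl
  rwa [key, key] at this

lemma linearCombination_rep {κ : Type*} (g : ℝ → ℝ) (I : Finset κ) (c y : κ → ℝ) :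
    Finsupp.linearCombination ℝ g (∑ l ∈ I, c l • Finsupp.single (y l) 1) =
      ∑ l ∈ I, c l * g (y l) := by
  simp [map_sum, Finsupp.linearCombination_single]

/-- Only the action of `T i` at the single point `x i` matters. In the induction over the list,
variables not yet treated carry the point evaluation at the current point; treating variable `i`
exchanges that evaluation for `φ i`. -/
lemma tensorOp_eq_tens {d : ℕ} (T : Fin d → (ℝ → ℝ) → ℝ → ℝ) (f : (Fin d → ℝ) → ℝ)
    (x : Fin d → ℝ) (φ : Fin d → ℝ →₀ ℝ)
    (h : ∀ i g, T i g (x i) = Finsupp.linearCombination ℝ g (φ i)) :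
    tensorOp T f x = tens f φ := by
  classical
  have key : ∀ l : List (Fin d), l.Nodup → ∀ x' : Fin d → ℝ, (∀ i ∈ l, x' i = x i) →
      l.foldr (fun i g x => T i (fun y => g (Function.update x i y)) (x i)) f x' =
        tens f (fun i => if i ∈ l then φ i else Finsupp.single (x' i) 1) := by
    intro l
    induction l with
    | nil => intro _ x' _; simp [tens_single]
    | cons i l ih =>
      intro hl x' hx'
      have hi : i ∉ l := (List.nodup_cons.1 hl).1
      have hl' := (List.nodup_cons.1 hl).2
      rw [List.foldr_cons, hx' i (by simp), h]
      set ψ : Fin d → ℝ →₀ ℝ := fun j => if j ∈ l then φ j else Finsupp.single (x' j) 1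
      have e1 : ∀ y, l.foldr (fun i g x => T i (fun y => g (Function.update x i y)) (x i)) f
          (Function.update x' i y) = tens f (Function.update ψ i (Finsupp.single y 1)) := by
        intro y
        rw [ih hl']
        · congr 1
          funext j
          by_cases hj : j = i
          · subst hj; simp [hi]
          · simp [ψ, Function.update_of_ne hj]
        · intro j hj
          have hji : j ≠ i := fun e => hi (e ▸ hj)
          rw [Function.update_of_ne hji]
          exact hx' j (by simp [hj])
      have e2 : (fun j => if j ∈ i :: l then φ j else Finsupp.single (x' j) 1) =
          Function.update ψ i (φ i) := by
        funext j
        by_cases hj : j = i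
        · subst hj; simp
        · simp [ψ, hj]
      rw [e2]
      simp only [e1]
      conv_rhs => rw [← Finsupp.sum_single (φ i)]
      rw [Finsupp.sum, MultilinearMap.map_update_sum, Finsupp.linearCombination_apply, Finsupp.sum]
      refine Finset.sum_congr rfl fun y _ => ?_
      rw [← MultilinearMap.map_update_smul]
      simp
  have := key (List.finRange d) (List.nodup_finRange d) x (fun _ _ => rfl)
  rw [tensorOp, this]
  simp

/-- Tensor products of functionals with bounded coefficients whose nodes converge converge on
continuous functions. -/
lemma tendsto_tensor_sub {d : ℕ} {κ : Type*} (I : Fin d → Finset κ) (c y : ℕ → Fin d → κ → ℝ)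
    (y₀ : Fin d → κ → ℝ) (B : ℝ) (hc : ∀ n i l, |c n i l| ≤ B)
    (hy : ∀ i, ∀ l ∈ I i, Filter.Tendsto (fun n => y n i l) Filter.atTop (nhds (y₀ i l)))
    (f : (Fin d → ℝ) → ℝ) (hf : Continuous f) :
    Filter.Tendsto (fun n =>
      ∑ p ∈ Fintype.piFinset I, (∏ i, c n i (p i)) * f (fun i => y n i (p i)) -
      ∑ p ∈ Fintype.piFinset I, (∏ i, c n i (p i)) * f (fun i => y₀ i (p i)))
      Filter.atTop (nhds 0) := by
  simp_rw [← Finset.sum_sub_distrib, ← mul_sub]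
  rw [← Finset.sum_const_zero (s := Fintype.piFinset I)]
  refine tendsto_finsetSum _ fun p hp => ?_
  have h1 : Filter.Tendsto (fun n => f (fun i => y n i (p i)) - f (fun i => y₀ i (p i)))
      Filter.atTop (nhds 0) := by
    rw [← sub_self (f (fun i => y₀ i (p i)))]
    refine Filter.Tendsto.sub ?_ tendsto_const_nhds
    refine (hf.tendsto _).comp (tendsto_pi_nhds.2 fun i => hy i _ (Fintype.mem_piFinset.1 hp i))
  refine bdd_le_mul_tendsto_zero (b := -(|B| ^ d)) (B := |B| ^ d) ?_ ?_ h1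
  all_goals
    refine Filter.Eventually.of_forall fun n => ?_
    have : |∏ i, c n i (p i)| ≤ |B| ^ d := by
      rw [Finset.abs_prod]
      calc ∏ i, |c n i (p i)| ≤ ∏ _i : Fin d, |B| :=
            Finset.prod_le_prod (fun _ _ => abs_nonneg _) fun i _ =>
              (hc n i _).trans (le_abs_self B)
        _ = |B| ^ d := by simp
    first | exact (abs_le.1 this).1 | exact (abs_le.1 this).2

/-! ### Elementary properties of the B-splines -/

lemma abs_bSpline_le_one : ∀ (r : ℕ) (x : ℝ), |bSpline r x| ≤ 1
  | 0, x => by simp [bSpline]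
  | 1, x => by
    simp only [bSpline, Set.indicator_apply, Pi.one_apply]
    split_ifs <;> simp
  | r + 2, x => by
    simp only [bSpline]
    have h := intervalIntegral.norm_integral_le_of_norm_le_const
      (a := -(1 / 2 : ℝ)) (b := 1 / 2) (f := fun y => bSpline (r + 1) (x - y)) (C := 1)
      (fun y _ => by simpa using abs_bSpline_le_one (r + 1) (x - y))
    rw [Real.norm_eq_abs] at h
    refine h.trans ?_
    norm_num

lemma bSpline_support : ∀ (r : ℕ) (x : ℝ), bSpline r x ≠ 0 → -((r : ℝ) / 2) ≤ x ∧ x < (r : ℝ) / 2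
  | 0, x => by simp [bSpline]
  | 1, x => by
    intro h
    simp only [bSpline, ne_eq, Set.indicator_apply_eq_zero, Set.mem_Ico, Pi.one_apply, one_ne_zero,
      imp_false, not_not] at h
    push_cast
    exact h
  | r + 2, x => by
    intro h
    by_contra hx
    apply h
    simp only [bSpline]
    rw [intervalIntegral.integral_congr (g := fun _ => (0 : ℝ)) ?_]
    · simp
    intro y hy
    rw [Set.uIcc_of_le (by norm_num)] at hy
    by_contra hne
    obtain ⟨h1, h2⟩ := bSpline_support (r + 1) _ hne
    apply hx
    push_cast at h1 h2 ⊢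
    exact ⟨by linarith [hy.1, hy.2], by linarith [hy.1, hy.2]⟩

lemma measurable_bSpline : ∀ r : ℕ, Measurable (bSpline r)
  | 0 => by simp only [bSpline]; exact measurable_const
  | 1 => by simp only [bSpline]; exact measurable_one.indicator measurableSet_Ico
  | r + 2 => by
    simp only [bSpline]
    simp_rw [intervalIntegral.integral_of_le (show (-(1 / 2) : ℝ) ≤ 1 / 2 by norm_num)]
    have h : Measurable (Function.uncurry fun x y : ℝ => bSpline (r + 1) (x - y)) :=
      (measurable_bSpline (r + 1)).comp (measurable_fst.sub measurable_snd)
    exact (h.stronglyMeasurable.integral_prod_right).measurable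

/-- An interval of length `r` contains at most `r + 1` integers, and each spline value is at most
one. -/
lemma sum_abs_bSpline_le (r : ℕ) (J : Finset ℤ) (y : ℝ) :
    ∑ s ∈ J, |bSpline r (y - s)| ≤ r + 1 := by
  classical
  have h1 : ∑ s ∈ J, |bSpline r (y - s)| ≤ ∑ s ∈ Finset.Icc ⌈y - r / 2⌉ ⌊y + r / 2⌋, (1 : ℝ) := by
    rw [← Finset.sum_filter_add_sum_filter_not J (fun s => bSpline r (y - s) ≠ 0)]
    rw [Finset.sum_eq_zero (s := J.filter (fun s : ℤ => ¬ bSpline r (y - s) ≠ 0))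
      (fun s hs => by simpa using (Finset.mem_filter.1 hs).2), add_zero]
    refine (Finset.sum_le_sum fun s _ => abs_bSpline_le_one r _).trans ?_
    refine Finset.sum_le_sum_of_subset_of_nonneg ?_ fun _ _ _ => zero_le_one
    intro s hs
    obtain ⟨h1, h2⟩ := bSpline_support r _ (Finset.mem_filter.1 hs).2
    rw [Finset.mem_Icc]
    exact ⟨Int.ceil_le.2 (by linarith), Int.le_floor.2 (by linarith)⟩
  refine h1.trans ?_
  rw [Finset.sum_const, nsmul_eq_mul, mul_one, Int.card_Icc]
  have h2 := Int.floor_le (y + r / 2)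
  have h3 := Int.le_ceil (y - r / 2)
  rcases le_or_gt 0 (⌊y + (r : ℝ) / 2⌋ + 1 - ⌈y - (r : ℝ) / 2⌉) with h | h
  · have : ((⌊y + (r : ℝ) / 2⌋ + 1 - ⌈y - (r : ℝ) / 2⌉).toNat : ℝ) =
        ((⌊y + (r : ℝ) / 2⌋ + 1 - ⌈y - (r : ℝ) / 2⌉ : ℤ) : ℝ) := by
      exact_mod_cast Int.toNat_of_nonneg h
    rw [this]; push_cast; linarith
  · rw [Int.toNat_of_nonpos h.le]; push_cast; positivity

/-! ### Lagrange coefficients on integer nodes -/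

lemma degree_comp_linear_lt {r : ℕ} {P : Polynomial ℝ} (hP : P.degree < r) (a b : ℝ) :
    (P.comp (Polynomial.C a * Polynomial.X + Polynomial.C b)).degree < r := by
  by_cases hz : P = 0
  · simp [hz, Polynomial.zero_comp]
  have h3 : P.natDegree < r := (Polynomial.natDegree_lt_iff_degree_lt hz).2 hP
  refine lt_of_le_of_lt Polynomial.degree_le_natDegree ?_
  have : (P.comp (Polynomial.C a * Polynomial.X + Polynomial.C b)).natDegree ≤ P.natDegree := by
    refine Polynomial.natDegree_comp_le.trans ?_
    calc _ ≤ P.natDegree * 1 := Nat.mul_le_mul_left _ Polynomial.natDegree_linear_le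
      _ = _ := mul_one _
  exact_mod_cast lt_of_le_of_lt this h3

/-- The `i`-th Lagrange basis polynomial for the nodes `0, ..., n - 1`, as a function. -/
def lagr (n i : ℕ) (t : ℝ) : ℝ := ∏ j ∈ (Finset.range n).erase i, ((i : ℝ) - j)⁻¹ * (t - j)

lemma lagr_eq_basis (n i : ℕ) (t : ℝ) :
    lagr n i t = (Lagrange.basis (Finset.range n) (fun j => (j : ℝ)) i).eval t := by
  simp [lagr, Lagrange.basis, Lagrange.basisDivisor, Polynomial.eval_prod]

/-- Distinct integer nodes are at distance at least one, so the denominators do no harm. -/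
lemma abs_lagr_le (n i : ℕ) (t B : ℝ) (hB : |t| ≤ B) : |lagr n i t| ≤ (1 + B + n) ^ n := by
  have hB0 : 0 ≤ B := (abs_nonneg t).trans hB
  rw [lagr, Finset.abs_prod]
  have h1 : ∀ j ∈ (Finset.range n).erase i, |((i : ℝ) - j)⁻¹ * (t - j)| ≤ 1 + B + n := by
    intro j hj
    have hji : j ≠ i := Finset.ne_of_mem_erase hj
    have hjn : j < n := Finset.mem_range.1 (Finset.mem_of_mem_erase hj)
    have h2 : |((i : ℝ) - j)⁻¹| ≤ 1 := by
      rw [abs_inv]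
      apply inv_le_one_of_one_le₀
      have : (1 : ℤ) ≤ |(i : ℤ) - j| := Int.one_le_abs (by omega)
      have h3 : ((1 : ℤ) : ℝ) ≤ ((|(i : ℤ) - j| : ℤ) : ℝ) := by exact_mod_cast this
      push_cast at h3
      exact h3
    have h3 : |t - j| ≤ B + n := by
      refine (abs_sub _ _).trans ?_
      have : (j : ℝ) ≤ n := by exact_mod_cast hjn.le
      rw [abs_of_nonneg (Nat.cast_nonneg j : (0 : ℝ) ≤ j)]
      linarith
    rw [abs_mul]
    calc _ ≤ 1 * (B + n) := mul_le_mul h2 h3 (abs_nonneg _) zero_le_one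
      _ ≤ _ := by linarith
  refine (Finset.prod_le_prod (fun _ _ => abs_nonneg _) h1).trans ?_
  rw [Finset.prod_const]
  refine pow_le_pow_right₀ (by linarith [(Nat.cast_nonneg n : (0 : ℝ) ≤ n)]) ?_
  exact (Finset.card_erase_le).trans (by simp)

lemma sum_lagr_mul_eval (n : ℕ) (P : Polynomial ℝ) (hP : P.degree < n) (t : ℝ) :
    ∑ i ∈ Finset.range n, lagr n i t * P.eval (i : ℝ) = P.eval t := by
  have h := Lagrange.eq_interpolate (s := Finset.range n) (v := fun j : ℕ => (j : ℝ)) (f := P)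
    (fun a _ b _ h => Nat.cast_injective (R := ℝ) h) (by simpa using hP)
  conv_rhs => rw [h]
  rw [Lagrange.interpolate_apply, Polynomial.eval_finsetSum]
  refine Finset.sum_congr rfl fun i _ => ?_
  rw [Polynomial.eval_mul, Polynomial.eval_C, lagr_eq_basis, mul_comm]

lemma sum_lagr (n : ℕ) (hn : 0 < n) (t : ℝ) : ∑ i ∈ Finset.range n, lagr n i t = 1 := by
  have := sum_lagr_mul_eval n 1 (by rw [Polynomial.degree_one]; exact_mod_cast hn) t
  simpa using this

lemma basis_left_eval (n k i : ℕ) (t : ℤ) :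
    (Lagrange.basis (Finset.range n) (fun j : ℕ => (j : ℝ) / 2 ^ k) i).eval ((t : ℝ) / 2 ^ k) =
      lagr n i t := by
  simp only [lagr, Lagrange.basis, Lagrange.basisDivisor, Polynomial.eval_prod,
    Polynomial.eval_mul, Polynomial.eval_C, Polynomial.eval_sub, Polynomial.eval_X]
  refine Finset.prod_congr rfl fun j _ => ?_
  rw [← sub_div, ← sub_div, inv_div]
  have : (2 : ℝ) ^ k ≠ 0 := by positivity
  rw [div_mul_div_comm, mul_comm ((2 : ℝ) ^ k), mul_div_mul_right _ _ this, div_eq_mul_inv,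
    mul_comm]

/-- Lagrange bases are invariant under affine maps of the nodes; here the map is the reflection that
counts mesh steps inwards from `1`. -/
lemma basis_right_eval (n k i : ℕ) (t : ℤ) :
    (Lagrange.basis (Finset.range n) (fun j : ℕ => ((2 : ℝ) ^ k - j) / 2 ^ k) i).eval
      ((t : ℝ) / 2 ^ k) = lagr n i ((2 : ℝ) ^ k - t) := by
  simp only [lagr, Lagrange.basis, Lagrange.basisDivisor, Polynomial.eval_prod,
    Polynomial.eval_mul, Polynomial.eval_C, Polynomial.eval_sub, Polynomial.eval_X]
  refine Finset.prod_congr rfl fun j _ => ?_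
  rw [← sub_div, ← sub_div, inv_div]
  have : (2 : ℝ) ^ k ≠ 0 := by positivity
  rw [div_mul_div_comm, mul_comm ((2 : ℝ) ^ k), mul_div_mul_right _ _ this, div_eq_mul_inv,
    mul_comm]
  rw [show (2 : ℝ) ^ k - i - (2 ^ k - j) = -((i : ℝ) - j) by ring,
    show (t : ℝ) - (2 ^ k - j) = -((2 : ℝ) ^ k - t - j) by ring, inv_neg, neg_mul_neg]

/-! ### The kernels of the sampling operators -/

/-- The coefficient of `f (i / 2 ^ k)` in the extension of `f` at the point `t / 2 ^ k`. -/
def extCoef (r k : ℕ) (t : ℤ) (i : ℕ) : ℝ :=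
  if t < 0 then (if i < min r (2 ^ k + 1) then lagr (min r (2 ^ k + 1)) i t else 0)
  else if t ≤ 2 ^ k then (if (i : ℤ) = t then 1 else 0)
  else (if 2 ^ k - i < min r (2 ^ k + 1) then
    lagr (min r (2 ^ k + 1)) (2 ^ k - i) ((2 : ℝ) ^ k - t) else 0)

lemma extendLine_grid (r k : ℕ) (g : ℝ → ℝ) (t : ℤ) :
    extendLine r k g ((t : ℝ) / 2 ^ k) =
      ∑ i ∈ Finset.range (2 ^ k + 1), extCoef r k t i * g ((i : ℝ) / 2 ^ k) := by
  have h2 : (0 : ℝ) < 2 ^ k := by positivity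
  have c1 : (t : ℝ) / 2 ^ k < 0 ↔ t < 0 := by
    rw [div_lt_iff₀ h2, zero_mul]; exact_mod_cast Iff.rfl
  have c2 : (t : ℝ) / 2 ^ k ≤ 1 ↔ t ≤ 2 ^ k := by
    rw [div_le_iff₀ h2, one_mul]; exact_mod_cast Iff.rfl
  set n := min r (2 ^ k + 1) with hn
  have hn2 : n ≤ 2 ^ k + 1 := min_le_right _ _
  unfold extendLine
  rw [← hn]
  simp only [c1, c2]
  split_ifs with h h'
  · simp only [extCoef, h, if_true, ← hn]
    rw [Lagrange.interpolate_apply, Polynomial.eval_finsetSum]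
    rw [← Finset.sum_subset (Finset.range_subset_range.2 hn2)]
    · refine Finset.sum_congr rfl fun i hi => ?_
      rw [if_pos (Finset.mem_range.1 hi), Polynomial.eval_mul, Polynomial.eval_C,
        basis_left_eval, mul_comm]
    · intro i _ hi
      rw [if_neg (by simpa using hi), zero_mul]
  · simp only [extCoef, h, if_false, h', if_true, ite_mul, one_mul, zero_mul]
    rw [Finset.sum_eq_single t.toNat]
    · rw [if_pos (by omega)]
      congr 2
      have : ((t.toNat : ℤ) : ℝ) = t := by rw [Int.toNat_of_nonneg (by omega)]
      exact_mod_cast this.symm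
    · intro i _ hi
      rw [if_neg (by omega)]
    · intro hi
      exfalso
      apply hi
      rw [Finset.mem_range]
      zify
      rw [Int.toNat_of_nonneg (by omega)]
      omega
  -- The right-hand nodes are numbered from `1` inwards, so the sum over the grid is reflected
  -- before comparison.
  · simp only [extCoef, h, if_false, h', ← hn]
    rw [Lagrange.interpolate_apply, Polynomial.eval_finsetSum,
      ← Finset.sum_range_reflect (n := 2 ^ k + 1)]
    rw [← Finset.sum_subset (Finset.range_subset_range.2 hn2)]
    · refine Finset.sum_congr rfl fun i hi => ?_
      have hi' := Finset.mem_range.1 hi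
      have e : 2 ^ k - (2 ^ k + 1 - 1 - i) = i := by omega
      rw [e, if_pos hi', Polynomial.eval_mul, Polynomial.eval_C, basis_right_eval, mul_comm,
        show 2 ^ k + 1 - 1 - i = 2 ^ k - i by omega, Nat.cast_sub (by omega)]
      push_cast
      rfl
    · intro i hi hi'
      rw [if_neg (by simp only [Finset.mem_range, not_lt] at hi hi'; omega), zero_mul]

/-- The coefficient of `f (i / 2 ^ k)` in `Q_k f`. -/
def quasiCoef (r μ : ℕ) (lam : ℤ → ℝ) (k i : ℕ) (x : ℝ) : ℝ :=
  ∑ s ∈ splineIndex r k, (∑ j ∈ Finset.Icc (-(μ : ℤ)) μ, lam j * extCoef r k (s - j) i) *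
    bSpline r (2 ^ k * x - s)

lemma quasiInterp_eq (r μ : ℕ) (lam : ℤ → ℝ) (k : ℕ) (g : ℝ → ℝ) (x : ℝ) :
    quasiInterp r μ lam k g x =
      ∑ i ∈ Finset.range (2 ^ k + 1), quasiCoef r μ lam k i x * g ((i : ℝ) / 2 ^ k) := by
  simp only [quasiInterp, quasiCoef, maskFunctional, Finset.sum_mul]
  rw [Finset.sum_comm (s := Finset.range (2 ^ k + 1))]
  refine Finset.sum_congr rfl fun s _ => ?_
  rw [Finset.sum_comm (s := Finset.range (2 ^ k + 1))]
  refine Finset.sum_congr rfl fun j _ => ?_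
  have : (1 / 2 ^ k : ℝ) * ((s : ℝ) - j) = ((s - j : ℤ) : ℝ) / 2 ^ k := by push_cast; ring
  rw [this, extendLine_grid, Finset.mul_sum, Finset.sum_mul]
  exact Finset.sum_congr rfl fun i _ => by ring

/-- The quasi-interpolant reaches at most `r + μ` mesh widths outside `[0,1]`, so in mesh units the
Lagrange polynomials are evaluated at bounded arguments. The bound is uniform in `k`. -/
lemma abs_extCoef_le (r μ k : ℕ) (t : ℤ) (i : ℕ) (h1 : -((r : ℤ) + μ) ≤ t)
    (h2 : t ≤ 2 ^ k + (r + μ)) : |extCoef r k t i| ≤ (1 + (r + μ) + r : ℝ) ^ r := by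
  have hone : (1 : ℝ) ≤ 1 + (r + μ) + r := by
    have : (0 : ℝ) ≤ (r + μ) + r := by positivity
    linarith
  have h0 : |(0 : ℝ)| ≤ (1 + (r + μ) + r : ℝ) ^ r := by rw [abs_zero]; positivity
  have key : ∀ (i : ℕ) (τ : ℝ), |τ| ≤ r + μ →
      |lagr (min r (2 ^ k + 1)) i τ| ≤ (1 + (r + μ) + r : ℝ) ^ r := by
    intro i τ hτ
    refine (abs_lagr_le _ _ _ _ hτ).trans ?_
    have hm : ((min r (2 ^ k + 1) : ℕ) : ℝ) ≤ r := by exact_mod_cast min_le_left _ _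
    refine (pow_le_pow_left₀ (b := (1 + (r + μ) + r : ℝ)) (by positivity) (by linarith) _).trans ?_
    exact pow_le_pow_right₀ hone (min_le_left _ _)
  have h1' : -((r : ℝ) + μ) ≤ t := by exact_mod_cast h1
  have h2' : (t : ℝ) ≤ 2 ^ k + (r + μ) := by exact_mod_cast h2
  unfold extCoef
  split_ifs with c1 c2 c3 c4 c5
  · refine key _ _ (abs_le.2 ⟨h1', ?_⟩)
    have : (t : ℝ) < 0 := by exact_mod_cast c1
    have : (0 : ℝ) ≤ (r + μ) := by positivity
    linarith
  · exact h0
  · rw [abs_one]; exact one_le_pow₀ hone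
  · exact h0
  · refine key _ _ (abs_le.2 ⟨by linarith, ?_⟩)
    have : (2 : ℝ) ^ k < t := by exact_mod_cast not_le.1 c3
    have : (0 : ℝ) ≤ (r + μ) := by positivity
    linarith
  · exact h0

/-- Outside `[0,1]` only the `r` nodes nearest to the endpoint enter, so the extension stays local
in mesh units. -/
lemma extCoef_support (r μ k : ℕ) (t : ℤ) (i : ℕ) (hi : i ≤ 2 ^ k) (h1 : -((r : ℤ) + μ) ≤ t)
    (h2 : t ≤ 2 ^ k + (r + μ)) (h : extCoef r k t i ≠ 0) : |(i : ℤ) - t| ≤ 2 * r + μ := by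
  have hi' : (i : ℤ) ≤ 2 ^ k := by exact_mod_cast hi
  have hm : min r (2 ^ k + 1) ≤ r := min_le_left _ _
  unfold extCoef at h
  rw [abs_le]
  split_ifs at h with c1 c2 c3 c4 c5
  · constructor <;> omega
  · exact absurd rfl h
  · constructor <;> omega
  · exact absurd rfl h
  · have e : ((2 ^ k - i : ℕ) : ℤ) = 2 ^ k - i := by rw [Nat.cast_sub hi]; push_cast; rfl
    have : ((2 ^ k - i : ℕ) : ℤ) < r := by exact_mod_cast lt_of_lt_of_le c5 hm
    rw [e] at this
    constructor <;> omega
  · exact absurd rfl h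

lemma splineIndex_bounds {r k : ℕ} {s : ℤ} (hs : s ∈ splineIndex r k) :
    -(r : ℤ) ≤ s ∧ s ≤ 2 ^ k + r := by
  simp only [splineIndex, Finset.mem_filter, Finset.mem_Icc] at hs
  exact hs.1

lemma abs_quasiCoef_le (r μ : ℕ) (lam : ℤ → ℝ) : ∃ C : ℝ, 0 ≤ C ∧
    ∀ (k i : ℕ) (x : ℝ), |quasiCoef r μ lam k i x| ≤ C := by
  refine ⟨(∑ j ∈ Finset.Icc (-(μ : ℤ)) μ, |lam j| * (1 + (r + μ) + r : ℝ) ^ r) * (r + 1),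
    by positivity, fun k i x => ?_⟩
  unfold quasiCoef
  refine (Finset.abs_sum_le_sum_abs _ _).trans ?_
  calc _ ≤ ∑ s ∈ splineIndex r k, (∑ j ∈ Finset.Icc (-(μ : ℤ)) μ,
        |lam j| * (1 + (r + μ) + r : ℝ) ^ r) * |bSpline r (2 ^ k * x - s)| := by
        refine Finset.sum_le_sum fun s hs => ?_
        rw [abs_mul]
        refine mul_le_mul_of_nonneg_right ?_ (abs_nonneg _)
        refine (Finset.abs_sum_le_sum_abs _ _).trans (Finset.sum_le_sum fun j hj => ?_)
        rw [abs_mul]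
        refine mul_le_mul_of_nonneg_left ?_ (abs_nonneg _)
        have := splineIndex_bounds hs
        rw [Finset.mem_Icc] at hj
        exact abs_extCoef_le r μ k _ i (by omega) (by omega)
    _ ≤ _ := by
        rw [← Finset.mul_sum]
        exact mul_le_mul_of_nonneg_left (sum_abs_bSpline_le r _ _) (by positivity)

lemma quasiCoef_support (r μ : ℕ) (lam : ℤ → ℝ) (k i : ℕ) (hi : i ≤ 2 ^ k) (x : ℝ)
    (h : quasiCoef r μ lam k i x ≠ 0) : |2 ^ k * x - i| ≤ 3 * r + 2 * μ := by
  obtain ⟨s, hs, h1⟩ := Finset.exists_ne_zero_of_sum_ne_zero h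
  obtain ⟨j, hj, h2⟩ := Finset.exists_ne_zero_of_sum_ne_zero (left_ne_zero_of_mul h1)
  have hb := splineIndex_bounds hs
  rw [Finset.mem_Icc] at hj
  have h3 := extCoef_support r μ k _ i hi (by omega) (by omega) (right_ne_zero_of_mul h2)
  obtain ⟨h4, h5⟩ := bSpline_support r _ (right_ne_zero_of_mul h1)
  rw [abs_le] at h3 ⊢
  have h6 : -(2 * (r : ℝ) + μ) ≤ (i : ℝ) - (s - j) := by exact_mod_cast h3.1
  have h7 : (i : ℝ) - (s - j) ≤ 2 * (r : ℝ) + μ := by exact_mod_cast h3.2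
  have h8 : -(μ : ℝ) ≤ j := by exact_mod_cast hj.1
  have h9 : (j : ℝ) ≤ μ := by exact_mod_cast hj.2
  have h10 : (0 : ℝ) ≤ r := Nat.cast_nonneg r
  constructor <;> linarith

lemma measurable_quasiCoef (r μ : ℕ) (lam : ℤ → ℝ) (k i : ℕ) :
    Measurable (quasiCoef r μ lam k i) := by
  unfold quasiCoef
  refine Finset.measurable_sum _ fun s _ => Measurable.const_mul ?_ _
  exact (measurable_bSpline r).comp (by fun_prop)

/-! ### Polynomial reproduction by `Q_k` and the kernels of `Q_k - Q_{k-1}`. -/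

lemma extendLine_polynomial (r k : ℕ) (P : Polynomial ℝ)
    (hP : P.degree < (min r (2 ^ k + 1) : ℕ)) (x : ℝ) :
    extendLine r k (fun y => P.eval y) x = P.eval x := by
  have h2 : (2 : ℝ) ^ k ≠ 0 := by positivity
  unfold extendLine
  split_ifs with c1 c2
  · rw [← Lagrange.eq_interpolate (s := Finset.range (min r (2 ^ k + 1)))
      (v := fun j : ℕ => (j : ℝ) / 2 ^ k) (f := P) ?_ (by simpa using hP)]
    intro a _ b _ h
    have : (a : ℝ) / 2 ^ k = b / 2 ^ k := h
    rw [div_left_inj' h2] at this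
    exact_mod_cast this
  · rfl
  · rw [← Lagrange.eq_interpolate (s := Finset.range (min r (2 ^ k + 1)))
      (v := fun j : ℕ => ((2 : ℝ) ^ k - j) / 2 ^ k) (f := P) ?_ (by simpa using hP)]
    intro a _ b _ h
    have : ((2 : ℝ) ^ k - a) / 2 ^ k = ((2 : ℝ) ^ k - b) / 2 ^ k := h
    rw [div_left_inj' h2, sub_right_inj] at this
    exact_mod_cast this

/-- The extension of a polynomial of degree below the number of interpolation nodes is the
polynomial itself, and for `0 ≤ x < 1` every spline that is nonzero at `x` has its index in
`splineIndex`. So the sum is the full quasi-interpolant of a dilated polynomial. The half-open form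
of `bSpline_support` is what gives the strict inequalities of `splineIndex` on this range. -/
lemma quasiInterp_polynomial {r μ : ℕ} {lam : ℤ → ℝ} (hQ : IsQuasiInterpolation r μ lam) (k : ℕ)
    (P : Polynomial ℝ) (hP : P.degree < (min r (2 ^ k + 1) : ℕ)) (x : ℝ) (hx0 : 0 ≤ x)
    (hx1 : x < 1) : quasiInterp r μ lam k (fun y => P.eval y) x = P.eval x := by
  have h2 : (0 : ℝ) < 2 ^ k := by positivity
  set P' : Polynomial ℝ :=
    P.comp (Polynomial.C (1 / 2 ^ k) * Polynomial.X + Polynomial.C 0) with hP'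
  have hev : ∀ y, P'.eval y = P.eval (1 / 2 ^ k * y) := by intro y; simp [hP']
  have hdeg : P'.degree < r :=
    degree_comp_linear_lt (hP.trans_le (by exact_mod_cast min_le_left _ _)) _ _
  have h := hQ.reproduces P' hdeg (2 ^ k * x)
  have e : P'.eval (2 ^ k * x) = P.eval x := by
    rw [hev]; congr 1; field_simp
  rw [e] at h
  rw [← h, finsum_eq_sum_of_support_subset (s := splineIndex r k)]
  · unfold quasiInterp
    refine Finset.sum_congr rfl fun s _ => ?_
    congr 1
    unfold maskFunctional
    refine Finset.sum_congr rfl fun j _ => ?_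
    rw [extendLine_polynomial r k P hP, one_mul]
    exact congrArg _ (hev _).symm
  · intro s hs
    obtain ⟨h3, h4⟩ := bSpline_support r _ (right_ne_zero_of_mul (Function.mem_support.1 hs))
    have h5 : 2 ^ k * x < 2 ^ k := by nlinarith
    have h6 : 0 ≤ 2 ^ k * x := by positivity
    have h7 : -(r : ℝ) < 2 * s := by linarith
    have h8 : 2 * (s : ℝ) < 2 ^ (k + 1) + r := by rw [pow_succ]; linarith
    have h7' : -(r : ℤ) < 2 * s := by exact_mod_cast h7
    have h8' : 2 * s < 2 ^ (k + 1) + (r : ℤ) := by exact_mod_cast h8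
    have h9 : (2 : ℤ) ^ (k + 1) = 2 * 2 ^ k := by rw [pow_succ]; ring
    simp only [splineIndex, Finset.coe_filter, Finset.mem_Icc, Set.mem_ofPred_eq]
    refine ⟨⟨?_, ?_⟩, h7', h8'⟩ <;> omega

lemma sum_quasiCoef {r μ : ℕ} {lam : ℤ → ℝ} (hQ : IsQuasiInterpolation r μ lam) (hr : 0 < r)
    (k : ℕ) (x : ℝ) (hx0 : 0 ≤ x) (hx1 : x < 1) :
    ∑ i ∈ Finset.range (2 ^ k + 1), quasiCoef r μ lam k i x = 1 := by
  have := quasiInterp_polynomial hQ k 1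
    (by rw [Polynomial.degree_one]; exact_mod_cast lt_min hr (Nat.succ_pos _)) x hx0 hx1
  rw [quasiInterp_eq] at this
  simpa using this

/-- The coefficient of `f (i / 2 ^ k)` in `(Q_k - Q_{k-1}) f`. -/
def levelCoef (r μ : ℕ) (lam : ℤ → ℝ) : ℕ → ℕ → ℝ → ℝ
  | 0, i => quasiCoef r μ lam 0 i
  | k + 1, i => fun x => quasiCoef r μ lam (k + 1) i x -
      (if 2 ∣ i then quasiCoef r μ lam k (i / 2) x else 0)

/-- The grid of one level consists of the even-numbered points of the next. -/
lemma sum_range_two_dvd (n : ℕ) (F : ℕ → ℝ) (G : ℕ → ℝ) :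
    ∑ i ∈ Finset.range (2 * n + 1), (if 2 ∣ i then F (i / 2) else 0) * G i =
      ∑ i ∈ Finset.range (n + 1), F i * G (2 * i) := by
  induction n with
  | zero => simp
  | succ n ih =>
    rw [show 2 * (n + 1) + 1 = 2 * n + 1 + 1 + 1 by ring, Finset.sum_range_succ,
      Finset.sum_range_succ, ih, Finset.sum_range_succ _ (n + 1)]
    have h1 : ¬ 2 ∣ 2 * n + 1 := by omega
    have h2 : 2 ∣ 2 * n + 1 + 1 := by omega
    rw [if_neg h1, if_pos h2, zero_mul, add_zero, show (2 * n + 1 + 1) / 2 = n + 1 by omega,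
      show 2 * n + 1 + 1 = 2 * (n + 1) by ring]

lemma levelOp_eq (r μ : ℕ) (lam : ℤ → ℝ) (k : ℕ) (g : ℝ → ℝ) (x : ℝ) :
    levelOp r μ lam k g x =
      ∑ i ∈ Finset.range (2 ^ k + 1), levelCoef r μ lam k i x * g ((i : ℝ) / 2 ^ k) := by
  cases k with
  | zero => simp only [levelOp, levelCoef, quasiInterp_eq]
  | succ k =>
    simp only [levelOp, levelCoef, quasiInterp_eq, sub_mul, Finset.sum_sub_distrib]
    congr 1
    rw [show 2 ^ (k + 1) + 1 = 2 * 2 ^ k + 1 by rw [pow_succ]; ring,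
      sum_range_two_dvd (2 ^ k) (fun i => quasiCoef r μ lam k i x)
        (fun i => g ((i : ℝ) / 2 ^ (k + 1)))]
    refine Finset.sum_congr rfl fun i _ => ?_
    congr 2
    push_cast
    rw [pow_succ]
    field_simp

lemma abs_levelCoef_le (r μ : ℕ) (lam : ℤ → ℝ) : ∃ C : ℝ, 0 ≤ C ∧
    ∀ (k i : ℕ) (x : ℝ), |levelCoef r μ lam k i x| ≤ C := by
  obtain ⟨C, hC0, hC⟩ := abs_quasiCoef_le r μ lam
  refine ⟨C + C, by positivity, fun k i x => ?_⟩
  cases k with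
  | zero => exact (hC 0 i x).trans (by linarith)
  | succ k =>
    simp only [levelCoef]
    refine (abs_sub _ _).trans (add_le_add (hC _ _ _) ?_)
    split_ifs
    · exact hC _ _ _
    · simpa using hC0

lemma levelCoef_support (r μ : ℕ) (lam : ℤ → ℝ) (k i : ℕ) (hi : i ≤ 2 ^ k) (x : ℝ)
    (h : levelCoef r μ lam k i x ≠ 0) : |2 ^ k * x - i| ≤ 2 * (3 * r + 2 * μ) := by
  have h0 : (0 : ℝ) ≤ 3 * r + 2 * μ := by positivity
  cases k with
  | zero => exact (quasiCoef_support r μ lam 0 i hi x h).trans (by linarith)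
  | succ k =>
    simp only [levelCoef] at h
    by_cases h1 : quasiCoef r μ lam (k + 1) i x = 0
    · rw [h1, zero_sub, neg_ne_zero] at h
      split_ifs at h with h2
      · obtain ⟨i', rfl⟩ := h2
        rw [Nat.mul_div_cancel_left _ (by norm_num)] at h
        have := quasiCoef_support r μ lam k i' (by rw [pow_succ] at hi; omega) x h
        push_cast
        rw [pow_succ, show (2 : ℝ) ^ k * 2 * x - 2 * i' = 2 * (2 ^ k * x - i') by ring, abs_mul,
          abs_two]
        linarith
      · exact absurd rfl h
    · exact (quasiCoef_support r μ lam (k + 1) i hi x h1).trans (by linarith)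

lemma measurable_levelCoef (r μ : ℕ) (lam : ℤ → ℝ) (k i : ℕ) :
    Measurable (levelCoef r μ lam k i) := by
  cases k with
  | zero => exact measurable_quasiCoef r μ lam 0 i
  | succ k =>
    refine (measurable_quasiCoef r μ lam (k + 1) i).sub ?_
    split_ifs
    · exact measurable_quasiCoef r μ lam k _
    · exact measurable_const

/-- The condition on `k` says that already the coarser grid has `r` points, so that the boundary
extension uses all `r` of them. The finitely many coarser levels enjoy no cancellation and are
treated separately. -/
lemma levelOp_polynomial {r μ : ℕ} {lam : ℤ → ℝ} (hQ : IsQuasiInterpolation r μ lam) (k : ℕ)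
    (hk : r ≤ 2 ^ k + 1) (P : Polynomial ℝ) (hP : P.degree < r) (x : ℝ) (hx0 : 0 ≤ x)
    (hx1 : x < 1) : levelOp r μ lam (k + 1) (fun y => P.eval y) x = 0 := by
  have hk' : r ≤ 2 ^ (k + 1) + 1 := by rw [pow_succ]; omega
  simp only [levelOp]
  rw [quasiInterp_polynomial hQ _ P (by rwa [min_eq_left hk']) x hx0 hx1,
    quasiInterp_polynomial hQ _ P (by rwa [min_eq_left hk]) x hx0 hx1, sub_self]

lemma sum_levelOp (r μ : ℕ) (lam : ℤ → ℝ) (m : ℕ) (g : ℝ → ℝ) (x : ℝ) :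
    ∑ k ∈ Finset.range (m + 1), levelOp r μ lam k g x = quasiInterp r μ lam m g x := by
  induction m with
  | zero => simp [levelOp]
  | succ m ih => rw [Finset.sum_range_succ, ih]; simp [levelOp]

/-! ### Functionals that annihilate polynomials are combinations of differences -/

/-- The `r`-th difference of a sequence. -/
def seqDiff (r : ℕ) (g : ℕ → ℝ) (o : ℕ) : ℝ :=
  ∑ j ∈ Finset.range (r + 1), (-1 : ℝ) ^ (r - j) * (r.choose j : ℝ) * g (o + j)

lemma diffOp_eq_fwdDiff (r : ℕ) (h : ℝ) (f : ℝ → ℝ) (x : ℝ) :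
    diffOp r h f x = (fwdDiff h)^[r] f x := by
  rw [fwdDiff_iter_eq_sum_shift, diffOp]
  refine Finset.sum_congr rfl fun j _ => ?_
  rw [zsmul_eq_mul, nsmul_eq_mul]
  push_cast
  rfl

lemma seqDiff_eq_diffOp (r : ℕ) (h ζ : ℝ) (g : ℝ → ℝ) (o : ℕ) :
    seqDiff r (fun n => g (h * (ζ + n))) o = diffOp r h g (h * (ζ + o)) := by
  unfold seqDiff diffOp
  refine Finset.sum_congr rfl fun j _ => ?_
  exact congrArg _ (congrArg g (by push_cast; ring))

lemma diffOp_polynomial {r : ℕ} {P : Polynomial ℝ} (hP : P.degree < r) (h x : ℝ) :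
    diffOp r h (fun y => P.eval y) x = 0 := by
  have key : ∀ Q : Polynomial ℝ, Q.degree < r → diffOp r 1 (fun y => Q.eval y) 0 = 0 := by
    intro Q hQ
    rw [diffOp_eq_fwdDiff]
    by_cases hz : Q = 0
    · subst hz
      rw [← diffOp_eq_fwdDiff]
      simp [diffOp]
    rw [Polynomial.fwdDiff_iter_eq_zero_of_degree_lt
      ((Polynomial.natDegree_lt_iff_degree_lt hz).2 hQ)]
    rfl
  rw [← key _ (degree_comp_linear_lt hP h x)]
  unfold diffOp
  refine Finset.sum_congr rfl fun j _ => ?_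
  simp only [Polynomial.eval_comp, Polynomial.eval_add, Polynomial.eval_mul, Polynomial.eval_C,
    Polynomial.eval_X]
  ring_nf

lemma seqDiff_polynomial {r : ℕ} {P : Polynomial ℝ} (hP : P.degree < r) (o : ℕ) :
    seqDiff r (fun n => P.eval (n : ℝ)) o = 0 := by
  have := seqDiff_eq_diffOp r 1 0 (fun y => P.eval y) o
  simp only [zero_add, one_mul] at this
  rw [this, diffOp_polynomial hP]

/-- Induction on the number of nodes: subtracting `c L` times the difference whose last node is the
top node `L` removes that node and preserves the annihilation of polynomials. Each removal enlarges
the coefficients by a factor of at most `2 ^ r + 1`. -/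
lemma exists_diff_coef (r A N : ℕ) : ∀ (c : ℕ → ℝ) (K : ℝ), (∀ i, |c i| ≤ K) →
    (∀ P : Polynomial ℝ, P.degree < r →
      ∑ i ∈ Finset.Ico A (A + N), c i * P.eval (i : ℝ) = 0) →
    ∃ γ : ℕ → ℝ, (∀ o, |γ o| ≤ (2 ^ r + 1) ^ N * K) ∧ (∀ o, γ o ≠ 0 → A ≤ o ∧ o + r < A + N) ∧
      ∀ g : ℕ → ℝ, ∑ i ∈ Finset.Ico A (A + N), c i * g i =
        ∑ o ∈ Finset.Ico A (A + N), γ o * seqDiff r g o := by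
  -- With at most `r` nodes, testing against the Lagrange basis polynomials shows that all
  -- coefficients vanish.
  have base : ∀ N ≤ r, ∀ (c : ℕ → ℝ) (K : ℝ), (∀ i, |c i| ≤ K) →
    (∀ P : Polynomial ℝ, P.degree < r →
      ∑ i ∈ Finset.Ico A (A + N), c i * P.eval (i : ℝ) = 0) →
    ∃ γ : ℕ → ℝ, (∀ o, |γ o| ≤ (2 ^ r + 1) ^ N * K) ∧ (∀ o, γ o ≠ 0 → A ≤ o ∧ o + r < A + N) ∧
      ∀ g : ℕ → ℝ, ∑ i ∈ Finset.Ico A (A + N), c i * g i =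
        ∑ o ∈ Finset.Ico A (A + N), γ o * seqDiff r g o := by
    intro N hN c K hK hann
    have hK0 : 0 ≤ K := (abs_nonneg _).trans (hK 0)
    refine ⟨0, fun o => by simp; positivity, fun o h => absurd rfl h, fun g => ?_⟩
    simp only [Pi.zero_apply, zero_mul, Finset.sum_const_zero]
    refine Finset.sum_eq_zero fun i hi => ?_
    have hinj : Set.InjOn (fun j : ℕ => (j : ℝ)) (Finset.Ico A (A + N)) :=
      fun a _ b _ h => Nat.cast_injective (R := ℝ) h
    have := hann (Lagrange.basis (Finset.Ico A (A + N)) (fun j : ℕ => (j : ℝ)) i) ?_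
    · rw [Finset.sum_eq_single i] at this
      · rw [Lagrange.eval_basis_self (v := fun j : ℕ => (j : ℝ)) hinj hi, mul_one] at this
        rw [this, zero_mul]
      · intro j hj hji
        rw [Lagrange.eval_basis_of_ne (v := fun j : ℕ => (j : ℝ)) hji.symm hj, mul_zero]
      · exact fun h => absurd hi h
    · rw [Lagrange.degree_basis hinj hi]
      have hNpos : 0 < N := by rw [Finset.mem_Ico] at hi; omega
      simp only [Nat.card_Ico, add_tsub_cancel_left]
      exact_mod_cast (by omega : N - 1 < r)
  induction N with
  | zero => exact base 0 (Nat.zero_le _)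
  | succ N ih =>
    by_cases hN : N + 1 ≤ r
    · exact base _ hN
    intro c K hK hann
    have hK0 : 0 ≤ K := (abs_nonneg _).trans (hK 0)
    push Not at hN
    set L := A + N with hL
    set o₀ := A + N - r with ho₀
    have ho₀L : o₀ + r = L := by omega
    -- The coefficients of the `r`-th difference on the nodes `o₀, ..., L`; the one at `L` is `1`.
    let δ : ℕ → ℝ := fun i => if o₀ ≤ i ∧ i ≤ L then
      (-1 : ℝ) ^ (r - (i - o₀)) * (r.choose (i - o₀) : ℝ) else 0
    have hδ : ∀ g : ℕ → ℝ, ∑ i ∈ Finset.Ico A (A + (N + 1)), δ i * g i = seqDiff r g o₀ := by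
      intro g
      have hsub : Finset.Ico o₀ (L + 1) ⊆ Finset.Ico A (A + (N + 1)) :=
        Finset.Ico_subset_Ico (by omega) (by omega)
      rw [← Finset.sum_subset hsub, Finset.sum_Ico_eq_sum_range, seqDiff,
        show L + 1 - o₀ = r + 1 by omega]
      · refine Finset.sum_congr rfl fun j hj => ?_
        rw [Finset.mem_range] at hj
        simp only [δ]
        rw [if_pos (by omega), show o₀ + j - o₀ = j by omega]
      · intro i _ hi
        rw [Finset.mem_Ico] at hi
        simp only [δ]
        rw [if_neg (by omega), zero_mul]
    have hδb : ∀ i, |δ i| ≤ 2 ^ r := by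
      intro i
      simp only [δ]
      split_ifs with h
      · rw [abs_mul, abs_pow, abs_neg, abs_one, one_pow, one_mul, Nat.abs_cast]
        exact_mod_cast Nat.choose_le_two_pow _ _
      · rw [abs_zero]; positivity
    have hδL : δ L = 1 := by
      simp only [δ]
      rw [if_pos (by omega), show L - o₀ = r by omega]
      simp
    obtain ⟨γ, h1, h2, h3⟩ := ih (fun i => c i - c L * δ i) ((2 ^ r + 1) * K)
      (fun i => by
        refine (abs_sub _ _).trans ?_
        rw [abs_mul]
        have := mul_le_mul (hK L) (hδb i) (abs_nonneg _) hK0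
        linarith [hK i])
      (fun P hP => by
        have e1 := hann P hP
        have e2 := hδ (fun n => P.eval (n : ℝ))
        rw [seqDiff_polynomial hP] at e2
        have e3 : ∑ i ∈ Finset.Ico A (A + (N + 1)), (c i - c L * δ i) * P.eval (i : ℝ) = 0 := by
          simp only [sub_mul, Finset.sum_sub_distrib, mul_assoc, ← Finset.mul_sum]
          rw [e1, e2]; simp
        rw [← add_assoc, Finset.sum_Ico_succ_top (by omega), ← hL, hδL] at e3
        simpa using e3)
    -- A difference starting at `o₀` would use the removed node `L`, so the slot `o₀` is free for `c
    -- L`.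
    have hγo : γ o₀ = 0 := by
      by_contra h
      have := (h2 o₀ h).2
      omega
    refine ⟨fun o => if o = o₀ then c L else γ o, fun o => ?_, fun o ho => ?_, fun g => ?_⟩
    · have hpow : (2 ^ r + 1 : ℝ) ^ N * ((2 ^ r + 1) * K) = (2 ^ r + 1) ^ (N + 1) * K := by ring
      dsimp only
      split_ifs with h
      · refine (hK L).trans ?_
        have : (1 : ℝ) ≤ (2 ^ r + 1) ^ (N + 1) :=
          one_le_pow₀ (by linarith [pow_pos (two_pos : (0 : ℝ) < 2) r])
        nlinarith
      · exact (h1 o).trans hpow.le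
    · dsimp only at ho
      split_ifs at ho with h
      · omega
      · have := h2 o ho; omega
    · have e1 := h3 g
      have e2 := hδ g
      have e3 : ∑ i ∈ Finset.Ico A (A + (N + 1)), c i * g i =
          ∑ i ∈ Finset.Ico A (A + (N + 1)), (c i - c L * δ i) * g i + c L * seqDiff r g o₀ := by
        rw [← e2, Finset.mul_sum, ← Finset.sum_add_distrib]
        exact Finset.sum_congr rfl fun i _ => by ring
      rw [e3, ← add_assoc, Finset.sum_Ico_succ_top (by omega), ← hL, hδL, e1]
      have e4 : ∑ o ∈ Finset.Ico A (L + 1), (if o = o₀ then c L else γ o) * seqDiff r g o =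
          ∑ o ∈ Finset.Ico A (L + 1), (γ o * seqDiff r g o +
            if o = o₀ then c L * seqDiff r g o₀ else 0) := by
        refine Finset.sum_congr rfl fun o _ => ?_
        split_ifs with h
        · rw [h, hγo]; ring
        · ring
      rw [e4, Finset.sum_add_distrib, Finset.sum_ite_eq', if_pos (by rw [Finset.mem_Ico]; omega),
        Finset.sum_Ico_succ_top (by omega)]
      have hγL : γ L * seqDiff r g L = 0 := by
        by_cases h : γ L = 0
        · rw [h, zero_mul]
        · have := (h2 L h).2; omega
      rw [hγL]
      simp

/-- A sum of bounded terms over a window has a bounded number of nonzero terms. -/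
lemma sum_abs_le_of_window (n q D : ℕ) (hq : 1 ≤ q) (o : ℤ) (F : ℕ → ℝ) (B : ℝ) (hB : 0 ≤ B)
    (hF : ∀ l ∈ Finset.range n, |F l| ≤ B)
    (hw : ∀ l ∈ Finset.range n, F l ≠ 0 → |o - (q : ℤ) * l| ≤ D) :
    ∑ l ∈ Finset.range n, |F l| ≤ (2 * D + 1) * B := by
  classical
  rw [← Finset.sum_filter_add_sum_filter_not _ (fun l => F l ≠ 0)]
  rw [Finset.sum_eq_zero (s := (Finset.range n).filter (fun l => ¬ F l ≠ 0))
    (fun l hl => by simpa using (Finset.mem_filter.1 hl).2), add_zero]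
  calc _ ≤ ∑ l ∈ (Finset.range n).filter (fun l => F l ≠ 0), B :=
        Finset.sum_le_sum fun l hl => hF l (Finset.mem_filter.1 hl).1
    _ = ((Finset.range n).filter (fun l => F l ≠ 0)).card * B := by
        rw [Finset.sum_const, nsmul_eq_mul]
    _ ≤ _ := by
        refine mul_le_mul_of_nonneg_right ?_ hB
        have : ((Finset.range n).filter (fun l => F l ≠ 0)).card ≤
            (Finset.Icc (o - D) (o + D)).card := by
          refine Finset.card_le_card_of_injOn (fun l => (q : ℤ) * l) ?_ ?_
          · intro l hl
            have hl' := Finset.mem_filter.1 hl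
            have := abs_le.1 (hw l hl'.1 hl'.2)
            rw [Finset.mem_coe, Finset.mem_Icc]
            constructor <;> linarith
          · intro a _ b _ h
            have : (q : ℤ) * a = q * b := h
            have h2 := mul_left_cancel₀ (by exact_mod_cast (by omega : q ≠ 0)) this
            exact_mod_cast h2
        rw [Int.card_Icc] at this
        have h2 : ((o + D + 1 - (o - D)).toNat : ℕ) = 2 * D + 1 := by omega
        rw [h2] at this
        exact_mod_cast this

/-- The points of `{0, ..., M - 1 - r}` that lie in one of the windows `|o - q l| ≤ D`. -/
def windowSet (r M n q D : ℕ) : Finset ℕ :=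
  (Finset.range M).filter fun o => o + r < M ∧ ∃ l ∈ Finset.range n, |(o : ℤ) - (q : ℤ) * l| ≤ D

lemma card_windowSet_le (r M n q D : ℕ) : (windowSet r M n q D).card ≤ n * (2 * D + 1) := by
  classical
  have h : (windowSet r M n q D).map ⟨(fun o : ℕ => (o : ℤ)), Nat.cast_injective⟩ ⊆
      (Finset.range n).biUnion fun l => Finset.Icc ((q : ℤ) * l - D) (q * l + D) := by
    intro o ho
    rw [Finset.mem_map] at ho
    obtain ⟨o, ho, rfl⟩ := ho
    obtain ⟨_, _, l, hl, h⟩ := Finset.mem_filter.1 ho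
    rw [Finset.mem_biUnion]
    refine ⟨l, hl, ?_⟩
    have := abs_le.1 h
    rw [Finset.mem_Icc, Function.Embedding.coeFn_mk]
    constructor <;> linarith
  have h2 := Finset.card_le_card h
  rw [Finset.card_map] at h2
  refine h2.trans (Finset.card_biUnion_le.trans ?_)
  refine (Finset.sum_le_card_nsmul _ _ (2 * D + 1) fun l _ => ?_).trans (by simp)
  rw [Int.card_Icc]
  omega

/-- Each `c l` lives on at most `2 D + 1` nodes around `q l`, so `exists_diff_coef` costs a factor
independent of `M` and `n`. Since `q ≥ 1`, a given `o` meets at most `2 D + 1` windows, which keeps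
the summed coefficients bounded. -/
lemma exists_window_diff (r M n q D : ℕ) (hq : 1 ≤ q) (c : ℕ → ℕ → ℝ) (K : ℝ) (hK0 : 0 ≤ K)
    (hK : ∀ l i, |c l i| ≤ K)
    (hw : ∀ l ∈ Finset.range n, ∀ i, c l i ≠ 0 → |(i : ℤ) - (q : ℤ) * l| ≤ D)
    (hann : ∀ l ∈ Finset.range n, ∀ P : Polynomial ℝ, P.degree < r →
      ∑ i ∈ Finset.range M, c l i * P.eval (i : ℝ) = 0) :
    ∃ Γ : ℕ → ℝ, (∀ o, |Γ o| ≤ (2 * D + 1) * ((2 ^ r + 1) ^ (2 * D + 1) * K)) ∧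
      ∀ g : ℕ → ℝ, ∑ l ∈ Finset.range n, ∑ i ∈ Finset.range M, c l i * g i =
        ∑ o ∈ windowSet r M n q D, Γ o * seqDiff r g o := by
  classical
  have hone : (1 : ℝ) ≤ 2 ^ r + 1 := by linarith [pow_pos (two_pos : (0 : ℝ) < 2) r]
  have key : ∀ l : ℕ, ∃ γ : ℕ → ℝ, l ∈ Finset.range n →
      (∀ o, |γ o| ≤ (2 ^ r + 1) ^ (2 * D + 1) * K) ∧
      (∀ o, γ o ≠ 0 → o + r < M ∧ |(o : ℤ) - (q : ℤ) * l| ≤ D) ∧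
      ∀ g : ℕ → ℝ, ∑ i ∈ Finset.range M, c l i * g i =
        ∑ o ∈ Finset.range M, γ o * seqDiff r g o := by
    intro l
    by_cases hl : l ∈ Finset.range n
    swap
    -- A dummy value: nothing is claimed for `l` outside the range.
    · exact ⟨0, fun h => absurd h hl⟩
    -- The window is clipped to `[0, M)`: truncated subtraction cuts it at `0`, the minimum in `E`
    -- at `M`.
    set A := q * l - D
    set E := min M (q * l + D + 1)
    have hql : (q : ℤ) * l = ((q * l : ℕ) : ℤ) := by push_cast; rfl
    have hin : ∀ i, i ∈ Finset.range M → i ∉ Finset.Ico A (A + (E - A)) → c l i = 0 := by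
      intro i hi hi'
      by_contra h
      apply hi'
      have := abs_le.1 (hw l hl i h)
      rw [hql] at this
      rw [Finset.mem_range] at hi
      rw [Finset.mem_Ico]
      omega
    have hsub : Finset.Ico A (A + (E - A)) ⊆ Finset.range M := by
      intro i hi
      rw [Finset.mem_Ico] at hi
      rw [Finset.mem_range]
      omega
    have hsum : ∀ g : ℕ → ℝ, ∑ i ∈ Finset.range M, c l i * g i =
        ∑ i ∈ Finset.Ico A (A + (E - A)), c l i * g i := by
      intro g
      symm
      exact Finset.sum_subset hsub fun i hi hi' => by rw [hin i hi hi', zero_mul]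
    obtain ⟨γ, h1, h2, h3⟩ := exists_diff_coef r A (E - A) (c l) K (hK l)
      (fun P hP => by rw [← hsum]; exact hann l hl P hP)
    refine ⟨γ, fun _ => ⟨fun o => (h1 o).trans ?_, fun o ho => ?_, fun g => ?_⟩⟩
    · exact mul_le_mul_of_nonneg_right (pow_le_pow_right₀ hone (by omega)) hK0
    · have := h2 o ho
      rw [hql, abs_le]
      omega
    · rw [hsum, h3]
      refine Finset.sum_subset hsub fun o _ ho => ?_
      by_cases h : γ o = 0
      · rw [h, zero_mul]
      · have := h2 o h
        exact absurd (Finset.mem_Ico.2 ⟨this.1, by omega⟩) ho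
  choose γ hγ using key
  refine ⟨fun o => ∑ l ∈ Finset.range n, γ l o, fun o => ?_, fun g => ?_⟩
  · refine (Finset.abs_sum_le_sum_abs _ _).trans ?_
    refine sum_abs_le_of_window n q D hq o (fun l => γ l o) _ (by positivity)
      (fun l hl => (hγ l hl).1 o) fun l hl h => ((hγ l hl).2.1 o h).2
  · rw [Finset.sum_congr rfl fun l hl => (hγ l hl).2.2 g, Finset.sum_comm]
    simp only [Finset.sum_mul]
    symm
    refine Finset.sum_subset (Finset.filter_subset _ _) fun o ho ho' => ?_
    refine Finset.sum_eq_zero fun l hl => ?_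
    by_cases h : γ l o = 0
    · rw [h, zero_mul]
    · have := (hγ l hl).2.1 o h
      exact absurd (Finset.mem_filter.2 ⟨ho, this.1, l, hl, this.2⟩) ho'

/-! ### The functionals `g ↦ ∫ (Q_k - Q_{k-1}) g` and their extrapolations from shifted lattices -/

/-- The weight of `g (s / 2 ^ k)` in `∫ (Q_k - Q_{k-1}) g`. -/
def levelWeight (r μ : ℕ) (lam : ℤ → ℝ) (k s : ℕ) : ℝ := ∫ x in (0 : ℝ)..1, levelCoef r μ lam k s x

/-- The functional `g ↦ ∫ (Q_k - Q_{k-1}) g`. -/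
def levelFun (r μ : ℕ) (lam : ℤ → ℝ) (k : ℕ) : ℝ →₀ ℝ :=
  ∑ s ∈ Finset.range (2 ^ k + 1), levelWeight r μ lam k s • Finsupp.single ((s : ℝ) / 2 ^ k) 1

/-- The part of `levelWeight` belonging to the cell `[l / 2 ^ k, (l + 1) / 2 ^ k]`. -/
def cellWeight (r μ : ℕ) (lam : ℤ → ℝ) (k l s : ℕ) : ℝ :=
  ∫ x in ((l : ℝ) / 2 ^ k)..(((l + 1 : ℕ) : ℝ) / 2 ^ k), levelCoef r μ lam k s x

lemma intervalIntegrable_levelCoef (r μ : ℕ) (lam : ℤ → ℝ) (k s : ℕ) (u v : ℝ) :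
    IntervalIntegrable (levelCoef r μ lam k s) volume u v := by
  obtain ⟨C, _, hC⟩ := abs_levelCoef_le r μ lam
  refine (intervalIntegrable_const (c := C)).mono_fun
    (measurable_levelCoef r μ lam k s).aestronglyMeasurable ?_
  exact Filter.Eventually.of_forall fun x => by
    simpa using (hC k s x).trans (le_abs_self C)

lemma sum_cellWeight (r μ : ℕ) (lam : ℤ → ℝ) (k s : ℕ) :
    ∑ l ∈ Finset.range (2 ^ k), cellWeight r μ lam k l s = levelWeight r μ lam k s := by
  have := intervalIntegral.sum_integral_adjacent_intervals (μ := volume)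
    (f := levelCoef r μ lam k s) (a := fun l : ℕ => (l : ℝ) / 2 ^ k) (n := 2 ^ k)
    (fun l _ => intervalIntegrable_levelCoef r μ lam k s _ _)
  simp only [cellWeight]
  rw [this, levelWeight]
  have h2 : (2 : ℝ) ^ k ≠ 0 := by positivity
  simp [h2]

lemma abs_cellWeight_le (r μ : ℕ) (lam : ℤ → ℝ) : ∃ C : ℝ, 0 ≤ C ∧
    ∀ k l s : ℕ, |cellWeight r μ lam k l s| ≤ C / 2 ^ k := by
  obtain ⟨C, hC0, hC⟩ := abs_levelCoef_le r μ lam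
  refine ⟨C, hC0, fun k l s => ?_⟩
  have := intervalIntegral.norm_integral_le_of_norm_le_const (a := (l : ℝ) / 2 ^ k)
    (b := ((l + 1 : ℕ) : ℝ) / 2 ^ k) (f := levelCoef r μ lam k s) (C := C)
    (fun x _ => by simpa using hC k s x)
  rw [Real.norm_eq_abs] at this
  refine this.trans (le_of_eq ?_)
  have : ((l + 1 : ℕ) : ℝ) / 2 ^ k - (l : ℝ) / 2 ^ k = 1 / 2 ^ k := by push_cast; ring
  rw [this, abs_of_nonneg (by positivity)]
  ring

lemma cellWeight_support (r μ : ℕ) (lam : ℤ → ℝ) (k l s : ℕ) (hs : s ≤ 2 ^ k)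
    (h : cellWeight r μ lam k l s ≠ 0) : |(s : ℤ) - l| ≤ 2 * (3 * r + 2 * μ) + 1 := by
  by_contra hcon
  apply h
  unfold cellWeight
  rw [intervalIntegral.integral_congr (g := fun _ => (0 : ℝ)) ?_]
  · simp
  intro x hx
  have h2 : (0 : ℝ) < 2 ^ k := by positivity
  rw [Set.uIcc_of_le (by gcongr; simp)] at hx
  have h3 : (l : ℝ) ≤ 2 ^ k * x := by
    have := (div_le_iff₀ h2).1 hx.1; linarith
  have h4 : 2 ^ k * x ≤ l + 1 := by
    have := (le_div_iff₀ h2).1 hx.2; push_cast at this; linarith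
  by_contra hne
  have h5 := abs_le.1 (levelCoef_support r μ lam k s hs x hne)
  apply hcon
  rw [abs_le]
  have h6 : -(2 * (3 * (r : ℝ) + 2 * μ) + 1) ≤ (s : ℝ) - l := by linarith
  have h7 : (s : ℝ) - l ≤ 2 * (3 * (r : ℝ) + 2 * μ) + 1 := by linarith
  constructor
  · exact_mod_cast h6
  · exact_mod_cast h7

lemma abs_levelWeight_le (r μ : ℕ) (lam : ℤ → ℝ) : ∃ C : ℝ, 0 ≤ C ∧
    ∀ k s : ℕ, s ≤ 2 ^ k → |levelWeight r μ lam k s| ≤ C / 2 ^ k := by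
  obtain ⟨C, hC0, hC⟩ := abs_cellWeight_le r μ lam
  refine ⟨(2 * (2 * (3 * r + 2 * μ) + 1 : ℕ) + 1) * C, by positivity, fun k s hs => ?_⟩
  rw [← sum_cellWeight, mul_div_assoc]
  refine (Finset.abs_sum_le_sum_abs _ _).trans ?_
  refine sum_abs_le_of_window (2 ^ k) 1 _ le_rfl s (fun l => cellWeight r μ lam k l s) _
    (by positivity) (fun l _ => hC k l s) fun l _ h => ?_
  have := cellWeight_support r μ lam k l s hs h
  push_cast
  rw [one_mul]
  exact this

/-- This is the purpose of the cells: each cell functional is both local and annihilates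
polynomials, because `Q_k - Q_{k-1}` annihilates them pointwise. -/
lemma sum_cellWeight_polynomial {r μ : ℕ} {lam : ℤ → ℝ} (hQ : IsQuasiInterpolation r μ lam)
    (k l : ℕ) (hk : r ≤ 2 ^ k + 1) (hl : l < 2 ^ (k + 1)) (P : Polynomial ℝ) (hP : P.degree < r) :
    ∑ s ∈ Finset.range (2 ^ (k + 1) + 1),
      cellWeight r μ lam (k + 1) l s * P.eval ((s : ℝ) / 2 ^ (k + 1)) = 0 := by
  have h2 : (0 : ℝ) < 2 ^ (k + 1) := by positivity
  have hle : (l : ℝ) / 2 ^ (k + 1) ≤ ((l + 1 : ℕ) : ℝ) / 2 ^ (k + 1) := by gcongr; simp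
  simp only [cellWeight, ← intervalIntegral.integral_mul_const]
  rw [← intervalIntegral.integral_finsetSum
    fun s _ => (intervalIntegrable_levelCoef r μ lam (k + 1) s _ _).mul_const _]
  simp only [← levelOp_eq r μ lam (k + 1) (fun y => P.eval y)]
  -- Reproduction is available for `x < 1` only, so the right endpoint of the cell is dropped.
  rw [intervalIntegral.integral_of_le hle, ← MeasureTheory.integral_Ico_eq_integral_Ioc]
  refine MeasureTheory.setIntegral_eq_zero_of_forall_eq_zero fun x hx => ?_
  refine levelOp_polynomial hQ k hk P hP x (le_trans (by positivity) hx.1) (lt_of_lt_of_le hx.2 ?_)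
  rw [div_le_one h2]
  exact_mod_cast hl

/-! #### Extrapolation from the lattice points next to a grid point -/

/-- First index of the `r` lattice points next to the grid point `s / 2 ^ k`, on the inner side;
the lattice is `Q` times finer than the grid. -/
def latticeBase (r k Q s : ℕ) : ℕ := if 2 * s ≤ 2 ^ k then Q * s else Q * s - r

/-- The position of `latticeBase` relative to the grid point. -/
def latticeOff (r k s : ℕ) : ℝ := if 2 * s ≤ 2 ^ k then 0 else -(r : ℝ)

/-- Coefficients of the extrapolation from the lattice to the grid point. -/
def latticeCoef (r k Q : ℕ) (ζ : ℝ) (s n : ℕ) : ℝ :=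
  if latticeBase r k Q s ≤ n ∧ n < latticeBase r k Q s + r then
    lagr r (n - latticeBase r k Q s) (-ζ - latticeOff r k s) else 0

/-- Grid points in the left half are extrapolated from lattice points to their right, the others
from the left. With `Q ≥ 2 r` there is room for `r` points, so with a shift in `[0,1)` all nodes
stay in the unit interval. -/
lemma latticeBase_add_le {r k Q s : ℕ} (hQ : 2 * r ≤ Q) (hs : s ≤ 2 ^ k) :
    latticeBase r k Q s + r ≤ Q * 2 ^ k := by
  have hp : 1 ≤ 2 ^ k := Nat.one_le_two_pow
  unfold latticeBase
  split_ifs with h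
  · calc Q * s + r ≤ Q * s + Q := by omega
      _ = Q * (s + 1) := by ring
      _ ≤ Q * 2 ^ k := Nat.mul_le_mul_left _ (by omega)
  · have h1 : Q * 1 ≤ Q * s := Nat.mul_le_mul_left _ (by omega)
    have h2 : Q * s ≤ Q * 2 ^ k := Nat.mul_le_mul_left _ hs
    omega

lemma latticeBase_cast {r k Q s : ℕ} (hQ : 2 * r ≤ Q) :
    (latticeBase r k Q s : ℝ) = Q * s + latticeOff r k s := by
  have hp : 1 ≤ 2 ^ k := Nat.one_le_two_pow
  unfold latticeBase latticeOff
  split_ifs with h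
  · push_cast; ring
  · have h1 : Q * 1 ≤ Q * s := Nat.mul_le_mul_left _ (by omega)
    rw [Nat.cast_sub (by omega)]
    push_cast; ring

lemma abs_latticeOff_le (r k s : ℕ) : |latticeOff r k s| ≤ r := by
  unfold latticeOff
  split_ifs <;> simp

lemma sum_latticeCoef_mul {r k Q s : ℕ} (hQ : 2 * r ≤ Q) (hs : s ≤ 2 ^ k) (ζ : ℝ) (F : ℕ → ℝ) :
    ∑ n ∈ Finset.range (Q * 2 ^ k), latticeCoef r k Q ζ s n * F n =
      ∑ i ∈ Finset.range r, lagr r i (-ζ - latticeOff r k s) * F (latticeBase r k Q s + i) := by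
  have hb := latticeBase_add_le hQ hs
  have hsub : Finset.Ico (latticeBase r k Q s) (latticeBase r k Q s + r) ⊆
      Finset.range (Q * 2 ^ k) := by
    intro i hi; rw [Finset.mem_Ico] at hi; rw [Finset.mem_range]; omega
  rw [← Finset.sum_subset hsub, Finset.sum_Ico_eq_sum_range, add_tsub_cancel_left]
  · refine Finset.sum_congr rfl fun i hi => ?_
    rw [Finset.mem_range] at hi
    rw [latticeCoef, if_pos (by omega), add_tsub_cancel_left]
  · intro n _ hn
    rw [Finset.mem_Ico] at hn
    rw [latticeCoef, if_neg hn, zero_mul]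

/-- In the coordinate `n` of the lattice point `(ζ + n) / (Q 2 ^ k)`, the grid point `s / 2 ^ k`
sits at `Q s - ζ`. -/
lemma sum_latticeCoef_polynomial {r k Q s : ℕ} (hQ : 2 * r ≤ Q) (hs : s ≤ 2 ^ k) (ζ : ℝ)
    (P : Polynomial ℝ) (hP : P.degree < r) :
    ∑ n ∈ Finset.range (Q * 2 ^ k), latticeCoef r k Q ζ s n * P.eval (n : ℝ) =
      P.eval (Q * s - ζ) := by
  rw [sum_latticeCoef_mul hQ hs ζ fun n => P.eval (n : ℝ)]
  have h := sum_lagr_mul_eval r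
    (P.comp (Polynomial.C 1 * Polynomial.X + Polynomial.C (latticeBase r k Q s : ℝ)))
    (degree_comp_linear_lt hP _ _) (-ζ - latticeOff r k s)
  simp only [Polynomial.eval_comp, Polynomial.eval_add, Polynomial.eval_mul, Polynomial.eval_C,
      Polynomial.eval_X, one_mul] at h
  rw [show (Q : ℝ) * s - ζ = -ζ - latticeOff r k s + latticeBase r k Q s by
    rw [latticeBase_cast hQ]; ring, ← h]
  refine Finset.sum_congr rfl fun i _ => ?_
  push_cast
  rw [add_comm]

lemma abs_lagr_lattice_le (r k s i : ℕ) {ζ : ℝ} (h0 : 0 ≤ ζ) (h1 : ζ < 1) :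
    |lagr r i (-ζ - latticeOff r k s)| ≤ (1 + (r + 1) + r : ℝ) ^ r := by
  refine abs_lagr_le _ _ _ _ ?_
  refine (abs_sub _ _).trans ?_
  rw [abs_neg, abs_of_nonneg h0]
  linarith [abs_latticeOff_le r k s]

lemma abs_latticeCoef_le (r k Q s n : ℕ) {ζ : ℝ} (h0 : 0 ≤ ζ) (h1 : ζ < 1) :
    |latticeCoef r k Q ζ s n| ≤ (1 + (r + 1) + r : ℝ) ^ r := by
  unfold latticeCoef
  split_ifs
  · exact abs_lagr_lattice_le r k s _ h0 h1
  · rw [abs_zero]; positivity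

lemma latticeCoef_support {r k Q s n : ℕ} {ζ : ℝ} (h : latticeCoef r k Q ζ s n ≠ 0) :
    |(n : ℤ) - (Q : ℤ) * s| ≤ r := by
  unfold latticeCoef at h
  split_ifs at h with h1
  · have e : (Q : ℤ) * s = ((Q * s : ℕ) : ℤ) := by push_cast; rfl
    rw [e, abs_le]
    unfold latticeBase at h1
    split_ifs at h1 <;> omega
  · exact absurd rfl h

/-- The functional `levelFun`, each grid point replaced by the extrapolation from the lattice
`2 ^ (-m) (ζ + ℤ)`, where `2 ^ m = Q 2 ^ k`. -/
def latticeFun (r μ : ℕ) (lam : ℤ → ℝ) (k Q : ℕ) (ζ : ℝ) : ℝ →₀ ℝ :=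
  ∑ p ∈ Finset.range (2 ^ k + 1) ×ˢ Finset.range r,
    (levelWeight r μ lam k p.1 * lagr r p.2 (-ζ - latticeOff r k p.1)) •
      Finsupp.single (1 / (Q * 2 ^ k) * (ζ + ((latticeBase r k Q p.1 + p.2 : ℕ) : ℝ))) 1

lemma latticeFun_apply {r μ : ℕ} {lam : ℤ → ℝ} {k Q : ℕ} (hQ : 2 * r ≤ Q) (ζ : ℝ) (g : ℝ → ℝ) :
    Finsupp.linearCombination ℝ g (latticeFun r μ lam k Q ζ) =
      ∑ s ∈ Finset.range (2 ^ k + 1), levelWeight r μ lam k s *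
        ∑ n ∈ Finset.range (Q * 2 ^ k), latticeCoef r k Q ζ s n *
          g (1 / (Q * 2 ^ k) * (ζ + (n : ℝ))) := by
  rw [latticeFun, linearCombination_rep, Finset.sum_product]
  refine Finset.sum_congr rfl fun s hs => ?_
  rw [sum_latticeCoef_mul hQ (by rw [Finset.mem_range] at hs; omega) ζ
    (fun n => g (1 / (Q * 2 ^ k) * (ζ + (n : ℝ)))), Finset.mul_sum]
  exact Finset.sum_congr rfl fun i _ => by ring

/-- The fractional part of `2 ^ m z`. -/
def shift (m : ℕ) (z : ℝ) : ℝ := Int.fract ((2 : ℝ) ^ m * z)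

lemma shift_nonneg (m : ℕ) (z : ℝ) : 0 ≤ shift m z := Int.fract_nonneg _
lemma shift_lt_one (m : ℕ) (z : ℝ) : shift m z < 1 := Int.fract_lt_one _

/-- Nesting of the lattices: the points of mesh `2 ^ (-m)` are those of mesh `2 ^ (-m-1)` whose
index has parity `b`. This puts two consecutive extrapolations on one lattice. -/
lemma shift_succ (m : ℕ) (z : ℝ) : ∃ b : ℕ, b < 2 ∧ 2 * shift m z = shift (m + 1) z + b := by
  have h : shift (m + 1) z = Int.fract (2 * shift m z) := by
    unfold shift
    rw [pow_succ, show (2 : ℝ) ^ m * 2 * z = 2 * Int.fract (2 ^ m * z) +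
      ((2 * ⌊(2 : ℝ) ^ m * z⌋ : ℤ) : ℝ) by
        have := Int.floor_add_fract ((2 : ℝ) ^ m * z); push_cast; linarith]
    exact Int.fract_add_intCast _ _
  have h0 := shift_nonneg m z
  have h1 := shift_lt_one m z
  rcases lt_or_ge (2 * shift m z) 1 with h2 | h2
  · refine ⟨0, by norm_num, ?_⟩
    rw [h, Int.fract_eq_self.2 ⟨by linarith, h2⟩]; simp
  · refine ⟨1, by norm_num, ?_⟩
    have h3 : Int.fract (2 * shift m z) = 2 * shift m z - 1 :=
      Int.fract_eq_iff.2 ⟨by linarith, by linarith, 1, by simp⟩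
    rw [h, h3]
    simp

lemma sum_range_parity (M b : ℕ) (hb : b < 2) (F G : ℕ → ℝ) :
    ∑ n ∈ Finset.range (2 * M), (if n % 2 = b then F (n / 2) else 0) * G n =
      ∑ i ∈ Finset.range M, F i * G (2 * i + b) := by
  induction M with
  | zero => simp
  | succ M ih =>
    rw [show 2 * (M + 1) = 2 * M + 1 + 1 by ring, Finset.sum_range_succ, Finset.sum_range_succ, ih,
      Finset.sum_range_succ, add_assoc]
    congr 1
    have e1 : (2 * M) % 2 = 0 := by omega
    have e2 : (2 * M + 1) % 2 = 1 := by omega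
    have e3 : (2 * M) / 2 = M := by omega
    have e4 : (2 * M + 1) / 2 = M := by omega
    rw [e1, e2, e3, e4]
    interval_cases b <;> simp

/-! ### Decomposition of the level functionals into differences on shifted lattices -/

/-- The functional `g ↦ Δ_h^r g (x)`. -/
def diffFun (r : ℕ) (h x : ℝ) : ℝ →₀ ℝ :=
  ∑ i ∈ Finset.range (r + 1), ((-1 : ℝ) ^ (r - i) * (r.choose i : ℝ)) • Finsupp.single (x + i * h) 1

lemma diffFun_apply (r : ℕ) (h x : ℝ) (g : ℝ → ℝ) :
    Finsupp.linearCombination ℝ g (diffFun r h x) = diffOp r h g x := by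
  rw [diffFun, linearCombination_rep]; rfl

/-- Extrapolation of `levelFun` from the lattice of mesh `2 ^ (-(k + k₀ + J))`. -/
def latticeSeq (r μ : ℕ) (lam : ℤ → ℝ) (k₀ k J : ℕ) (z : ℝ) : ℝ →₀ ℝ :=
  latticeFun r μ lam k (2 ^ (k₀ + J)) (shift (k + k₀ + J) z)

/-- The successive differences of `latticeSeq`. -/
def latticePiece (r μ : ℕ) (lam : ℤ → ℝ) (k₀ k : ℕ) : ℕ → ℝ → ℝ →₀ ℝ
  | 0 => latticeSeq r μ lam k₀ k 0
  | j + 1 => fun z => latticeSeq r μ lam k₀ k (j + 1) z - latticeSeq r μ lam k₀ k j z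

lemma sum_latticePiece (r μ : ℕ) (lam : ℤ → ℝ) (k₀ k J : ℕ) (z : ℝ) :
    ∑ j ∈ Finset.range (J + 1), latticePiece r μ lam k₀ k j z = latticeSeq r μ lam k₀ k J z := by
  induction J with
  | zero => simp [latticePiece]
  | succ J ih => rw [Finset.sum_range_succ, ih]; simp [latticePiece]

lemma two_mul_le_two_pow {r k₀ J : ℕ} (h : 2 * r ≤ 2 ^ k₀) : 2 * r ≤ 2 ^ (k₀ + J) :=
  h.trans (Nat.pow_le_pow_right (by norm_num) (by omega))

lemma two_pow_lattice (k₀ k J : ℕ) : ((2 ^ (k₀ + J) : ℕ) : ℝ) * 2 ^ k = 2 ^ (k + k₀ + J) := by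
  push_cast; rw [← pow_add]; congr 1; omega

lemma two_pow_lattice_nat (k₀ k J : ℕ) : 2 ^ (k₀ + J) * 2 ^ k = 2 ^ (k + k₀ + J) := by
  rw [← pow_add]; congr 1; omega

lemma latticeSeq_apply {r μ : ℕ} {lam : ℤ → ℝ} {k₀ : ℕ} (h : 2 * r ≤ 2 ^ k₀) (k J : ℕ) (z : ℝ)
    (g : ℝ → ℝ) :
    Finsupp.linearCombination ℝ g (latticeSeq r μ lam k₀ k J z) =
      ∑ s ∈ Finset.range (2 ^ k + 1), levelWeight r μ lam k s *
        ∑ n ∈ Finset.range (2 ^ (k + k₀ + J)),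
          latticeCoef r k (2 ^ (k₀ + J)) (shift (k + k₀ + J) z) s n *
          g (1 / 2 ^ (k + k₀ + J) * (shift (k + k₀ + J) z + (n : ℝ))) := by
  rw [latticeSeq, latticeFun_apply (two_mul_le_two_pow h), two_pow_lattice, two_pow_lattice_nat]

lemma sum_lattice_polynomial {r k₀ : ℕ} (h : 2 * r ≤ 2 ^ k₀) {k s : ℕ} (hs : s ≤ 2 ^ k) (J : ℕ)
    (ζ : ℝ) (P : Polynomial ℝ) (hP : P.degree < r) :
    ∑ n ∈ Finset.range (2 ^ (k + k₀ + J)), latticeCoef r k (2 ^ (k₀ + J)) ζ s n * P.eval (n : ℝ) =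
      P.eval (2 ^ (k₀ + J) * s - ζ) := by
  have := sum_latticeCoef_polynomial (two_mul_le_two_pow (J := J) h) hs ζ P hP
  rw [two_pow_lattice_nat] at this
  rw [this]
  push_cast
  rfl

/-- Two extrapolations to the same grid point are both exact on polynomials of degree below `r`, so
their difference annihilates these; by nesting it lives on the finer lattice. There is one window
per grid point `s`. -/
lemma latticePiece_succ_eq (r μ : ℕ) (lam : ℤ → ℝ) (k₀ : ℕ) (h : 2 * r ≤ 2 ^ k₀) :
    ∃ C : ℝ, 0 ≤ C ∧ ∀ (k j : ℕ) (z : ℝ), ∃ Γ : ℕ → ℝ, (∀ o, |Γ o| ≤ C / 2 ^ k) ∧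
      latticePiece r μ lam k₀ k (j + 1) z =
        ∑ o ∈ windowSet r (2 ^ (k + k₀ + (j + 1))) (2 ^ k + 1) (2 ^ (k₀ + (j + 1))) (2 * r + 1),
          Γ o • diffFun r (1 / 2 ^ (k + k₀ + (j + 1)))
            (1 / 2 ^ (k + k₀ + (j + 1)) * (shift (k + k₀ + (j + 1)) z + o)) := by
  obtain ⟨C, hC0, hC⟩ := abs_levelWeight_le r μ lam
  set B : ℝ := (1 + (r + 1) + r : ℝ) ^ r with hB
  have hB0 : 0 ≤ B := by positivity
  set D := 2 * r + 1 with hD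
  refine ⟨(2 * D + 1 : ℝ) * ((2 ^ r + 1) ^ (2 * D + 1) * (C * (B + B))), by positivity,
    fun k j z => ?_⟩
  set m := k + k₀ + j with hm
  have hm1 : k + k₀ + (j + 1) = m + 1 := by omega
  rw [hm1]
  obtain ⟨b, hb, hbs⟩ := shift_succ m z
  set ζ := shift (m + 1) z with hζ
  set ζ' := shift m z with hζ'
  -- The coarse coefficients are placed at the fine indices `2 n + b`.
  let c : ℕ → ℕ → ℝ := fun s n => if s ∈ Finset.range (2 ^ k + 1) then levelWeight r μ lam k s *
    (latticeCoef r k (2 ^ (k₀ + (j + 1))) ζ s n -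
      (if n % 2 = b then latticeCoef r k (2 ^ (k₀ + j)) ζ' s (n / 2) else 0)) else 0
  have hpow : 2 ^ (m + 1) = 2 * 2 ^ m := by rw [pow_succ]; ring
  have hsum : ∀ s ∈ Finset.range (2 ^ k + 1), ∀ G : ℕ → ℝ,
      ∑ n ∈ Finset.range (2 ^ (m + 1)), c s n * G n = levelWeight r μ lam k s *
        (∑ n ∈ Finset.range (2 ^ (m + 1)), latticeCoef r k (2 ^ (k₀ + (j + 1))) ζ s n * G n -
        ∑ n ∈ Finset.range (2 ^ m), latticeCoef r k (2 ^ (k₀ + j)) ζ' s n * G (2 * n + b)) := by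
    intro s hs G
    simp only [c, if_pos hs, mul_assoc, sub_mul]
    rw [← Finset.mul_sum, Finset.sum_sub_distrib]
    congr 2
    rw [hpow]
    exact sum_range_parity (2 ^ m) b hb (fun n => latticeCoef r k (2 ^ (k₀ + j)) ζ' s n) G
  have hex := exists_window_diff r (2 ^ (m + 1)) (2 ^ k + 1) (2 ^ (k₀ + (j + 1))) D
    Nat.one_le_two_pow c (C / 2 ^ k * (B + B)) (by positivity) ?_ ?_ ?_
  · obtain ⟨Γ, h1, h2⟩ := hex
    refine ⟨Γ, fun o => (h1 o).trans (le_of_eq (by ring)), functional_ext fun g => ?_⟩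
    have e := h2 (fun n => g (1 / 2 ^ (m + 1) * (ζ + n)))
    simp only [seqDiff_eq_diffOp] at e
    simp only [map_sum, map_smul, diffFun_apply, smul_eq_mul]
    rw [← e]
    simp only [latticePiece, map_sub]
    rw [latticeSeq_apply h, latticeSeq_apply h, ← Finset.sum_sub_distrib, hm1]
    refine Finset.sum_congr rfl fun s hs => ?_
    rw [hsum s hs, mul_sub]
    congr 2
    refine Finset.sum_congr rfl fun n _ => ?_
    congr 2
    rw [← hm, ← hζ', pow_succ]
    push_cast
    have : ζ' = (ζ + b) / 2 := by linarith
    rw [this]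
    field_simp
    ring
  · intro s n
    simp only [c]
    split_ifs with hs hn
    · rw [abs_mul]
      refine mul_le_mul (hC k s (by rw [Finset.mem_range] at hs; omega)) ?_ (abs_nonneg _)
        (by positivity)
      refine (abs_sub _ _).trans (add_le_add ?_ ?_)
      · exact abs_latticeCoef_le r k _ s n (shift_nonneg _ _) (shift_lt_one _ _)
      · exact abs_latticeCoef_le r k _ s _ (shift_nonneg _ _) (shift_lt_one _ _)
    · rw [abs_mul, sub_zero]
      refine mul_le_mul (hC k s (by rw [Finset.mem_range] at hs; omega)) ?_ (abs_nonneg _)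
        (by positivity)
      exact (abs_latticeCoef_le r k _ s n (shift_nonneg _ _) (shift_lt_one _ _)).trans
        (by linarith)
    · rw [abs_zero]; positivity
  · intro s hs n hne
    simp only [c, if_pos hs] at hne
    have hne := right_ne_zero_of_mul hne
    by_cases h3 : latticeCoef r k (2 ^ (k₀ + (j + 1))) ζ s n = 0
    · rw [h3, zero_sub, neg_ne_zero] at hne
      split_ifs at hne with h4
      -- A coarse index within `r` of its centre becomes `2 (n / 2) + b`, within `2 r + 1` of twice
      -- that centre; hence the choice of `D`.
      · have h5 := abs_le.1 (latticeCoef_support hne)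
        have e : ((2 ^ (k₀ + (j + 1)) : ℕ) : ℤ) * s = 2 * (((2 ^ (k₀ + j) : ℕ) : ℤ) * s) := by
          push_cast; rw [← add_assoc, pow_succ]; ring
        rw [e, abs_le, hD]
        generalize ((2 ^ (k₀ + j) : ℕ) : ℤ) * s = y at *
        push_cast
        omega
      · exact absurd rfl hne
    · refine (latticeCoef_support h3).trans ?_
      rw [hD]; push_cast; omega
  · intro s hs P hP
    have hs' : s ≤ 2 ^ k := by rw [Finset.mem_range] at hs; omega
    rw [hsum s hs]
    have e1 := sum_lattice_polynomial h hs' (j + 1) ζ P hP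
    rw [hm1] at e1
    have e2 := sum_lattice_polynomial h hs' j ζ' _ (degree_comp_linear_lt hP 2 (b : ℝ))
    simp only [Polynomial.eval_comp, Polynomial.eval_add, Polynomial.eval_mul, Polynomial.eval_C,
      Polynomial.eval_X] at e2
    push_cast
    rw [e1, e2]
    have : (2 : ℝ) * (2 ^ (k₀ + j) * s - ζ') + b = 2 ^ (k₀ + (j + 1)) * s - ζ := by
      rw [← add_assoc, pow_succ]; linarith
    rw [this, sub_self, mul_zero]

/-- Here a single grid point gives no cancellation, but a cell does: extrapolation is exact on
polynomials and the cell functional annihilates them. The windows belong to cells; their width `2 ^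
k₀ N + r` allows for grid points at most `N` steps from the cell and lattice points at most `r` from
those. -/
lemma latticePiece_zero_eq {r μ : ℕ} {lam : ℤ → ℝ} (hQ : IsQuasiInterpolation r μ lam)
    (k₀ : ℕ) (h : 2 * r ≤ 2 ^ k₀) : ∃ (C : ℝ) (D : ℕ), 0 ≤ C ∧ ∀ (k : ℕ) (z : ℝ), r ≤ 2 ^ k + 1 →
      ∃ Γ : ℕ → ℝ, (∀ o, |Γ o| ≤ C / 2 ^ (k + 1)) ∧
      latticePiece r μ lam k₀ (k + 1) 0 z =
        ∑ o ∈ windowSet r (2 ^ (k + 1 + k₀)) (2 ^ (k + 1)) (2 ^ k₀) D,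
          Γ o • diffFun r (1 / 2 ^ (k + 1 + k₀))
            (1 / 2 ^ (k + 1 + k₀) * (shift (k + 1 + k₀) z + o)) := by
  obtain ⟨C, hC0, hC⟩ := abs_cellWeight_le r μ lam
  set B : ℝ := (1 + (r + 1) + r : ℝ) ^ r with hB
  have hB0 : 0 ≤ B := by positivity
  set N := 2 * (3 * r + 2 * μ) + 1 with hN
  set D := 2 ^ k₀ * N + r with hD
  refine ⟨(2 * D + 1 : ℝ) * ((2 ^ r + 1) ^ (2 * D + 1) * ((2 * N + 1) * (C * B))), D,
    by positivity, fun k z hk => ?_⟩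
  set κ := k + 1 with hκ
  set ζ := shift (κ + k₀) z with hζ
  have hcell : ∀ l, ∀ s ∈ Finset.range (2 ^ κ + 1), cellWeight r μ lam κ l s ≠ 0 →
      |(l : ℤ) - s| ≤ N := by
    intro l s hs hne
    rw [Finset.mem_range] at hs
    have := cellWeight_support r μ lam κ l s (by omega) hne
    rw [abs_sub_comm, hN]; push_cast; exact this
  let c : ℕ → ℕ → ℝ := fun l n => ∑ s ∈ Finset.range (2 ^ κ + 1), cellWeight r μ lam κ l s *
    latticeCoef r κ (2 ^ k₀) ζ s n
  have hex := exists_window_diff r (2 ^ (κ + k₀)) (2 ^ κ) (2 ^ k₀) D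
    Nat.one_le_two_pow c ((2 * N + 1) * (C / 2 ^ κ * B)) (by positivity) ?_ ?_ ?_
  · obtain ⟨Γ, h1, h2⟩ := hex
    refine ⟨Γ, fun o => (h1 o).trans (le_of_eq (by ring)), functional_ext fun g => ?_⟩
    have e := h2 (fun n => g (1 / 2 ^ (κ + k₀) * (ζ + n)))
    simp only [seqDiff_eq_diffOp] at e
    simp only [map_sum, map_smul, diffFun_apply, smul_eq_mul]
    rw [← e]
    simp only [latticePiece]
    rw [latticeSeq_apply h]
    simp only [add_zero, ← sum_cellWeight]
    calc _ = ∑ s ∈ Finset.range (2 ^ κ + 1), ∑ l ∈ Finset.range (2 ^ κ),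
          ∑ n ∈ Finset.range (2 ^ (κ + k₀)), cellWeight r μ lam κ l s *
            (latticeCoef r κ (2 ^ k₀) ζ s n * g (1 / 2 ^ (κ + k₀) * (ζ + n))) := by
          refine Finset.sum_congr rfl fun s _ => ?_
          rw [Finset.sum_mul]
          exact Finset.sum_congr rfl fun l _ => by rw [Finset.mul_sum]
      _ = _ := by
          rw [Finset.sum_comm]
          refine Finset.sum_congr rfl fun l _ => ?_
          rw [Finset.sum_comm]
          refine Finset.sum_congr rfl fun n _ => ?_
          simp only [c]
          rw [Finset.sum_mul]
          exact Finset.sum_congr rfl fun s _ => by ring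
  · intro l n
    refine (Finset.abs_sum_le_sum_abs _ _).trans ?_
    have := sum_abs_le_of_window (2 ^ κ + 1) 1 N le_rfl l
      (fun s => cellWeight r μ lam κ l s * latticeCoef r κ (2 ^ k₀) ζ s n) (C / 2 ^ κ * B)
      (by positivity) (fun s _ => ?_) (fun s hs hne => ?_)
    · exact this
    · rw [abs_mul]
      exact mul_le_mul (hC κ l s) (abs_latticeCoef_le r κ _ s n (shift_nonneg _ _)
        (shift_lt_one _ _)) (abs_nonneg _) (by positivity)
    · simpa using hcell l s hs (left_ne_zero_of_mul hne)
  · intro l _ n hne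
    obtain ⟨s, hs, h3⟩ := Finset.exists_ne_zero_of_sum_ne_zero hne
    have h4 := abs_le.1 (hcell l s hs (left_ne_zero_of_mul h3))
    have h5 := abs_le.1 (latticeCoef_support (right_ne_zero_of_mul h3))
    have hp : (0 : ℤ) ≤ ((2 ^ k₀ : ℕ) : ℤ) := by positivity
    rw [abs_le, hD]
    push_cast at h5 hp ⊢
    constructor <;> nlinarith
  · intro l hl P hP
    rw [Finset.mem_range] at hl
    simp only [c, Finset.sum_mul]
    rw [Finset.sum_comm]
    simp only [mul_assoc, ← Finset.mul_sum]
    rw [← sum_cellWeight_polynomial hQ k l hk hl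
      (P.comp (Polynomial.C (2 ^ (κ + k₀)) * Polynomial.X + Polynomial.C (-ζ)))
      (degree_comp_linear_lt hP _ _)]
    refine Finset.sum_congr rfl fun s hs => ?_
    have e1 := sum_lattice_polynomial h (k := κ) (s := s)
      (Nat.lt_succ_iff.1 (Finset.mem_range.1 hs)) 0 ζ P hP
    simp only [add_zero] at e1
    rw [e1]
    simp only [Polynomial.eval_comp, Polynomial.eval_add, Polynomial.eval_mul, Polynomial.eval_C,
      Polynomial.eval_X]
    congr 2
    rw [pow_add, ← hκ]
    field_simp
    ring

/-- At the levels `k ≤ k₁` point evaluations are kept. Several grid points may share a lattice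
point, which costs at most `2 ^ k + 1`, a constant in this range. -/
lemma latticePiece_zero_small (r μ : ℕ) (lam : ℤ → ℝ) (k₀ k₁ : ℕ) (h : 2 * r ≤ 2 ^ k₀) :
    ∃ C : ℝ, 0 ≤ C ∧ ∀ (k : ℕ) (z : ℝ), k ≤ k₁ → ∃ Γ : ℕ → ℝ, (∀ o, |Γ o| ≤ C / 2 ^ k) ∧
      latticePiece r μ lam k₀ k 0 z = ∑ o ∈ Finset.range (2 ^ (k + k₀)),
          Γ o • Finsupp.single (1 / 2 ^ (k + k₀) * (shift (k + k₀) z + o)) 1 := by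
  obtain ⟨C, hC0, hC⟩ := abs_levelWeight_le r μ lam
  set B : ℝ := (1 + (r + 1) + r : ℝ) ^ r with hB
  have hB0 : 0 ≤ B := by positivity
  refine ⟨(2 ^ k₁ + 1) * (C * B), by positivity, fun k z hk => ?_⟩
  refine ⟨fun n => ∑ s ∈ Finset.range (2 ^ k + 1), levelWeight r μ lam k s *
    latticeCoef r k (2 ^ k₀) (shift (k + k₀) z) s n, fun n => ?_, functional_ext fun g => ?_⟩
  · refine (Finset.abs_sum_le_sum_abs _ _).trans ?_
    calc _ ≤ ∑ s ∈ Finset.range (2 ^ k + 1), C / 2 ^ k * B := by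
          refine Finset.sum_le_sum fun s hs => ?_
          rw [abs_mul]
          exact mul_le_mul (hC k s (by rw [Finset.mem_range] at hs; omega))
            (abs_latticeCoef_le r k _ s n (shift_nonneg _ _) (shift_lt_one _ _)) (abs_nonneg _)
            (by positivity)
      _ = (2 ^ k + 1) * (C * B / 2 ^ k) := by
          rw [Finset.sum_const, Finset.card_range, nsmul_eq_mul]; push_cast; ring
      _ ≤ (2 ^ k₁ + 1) * (C * B / 2 ^ k) := by
          refine mul_le_mul_of_nonneg_right ?_ (by positivity)
          have : (2 : ℝ) ^ k ≤ 2 ^ k₁ := pow_le_pow_right₀ (by norm_num) hk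
          linarith
      _ = _ := by ring
  · simp only [latticePiece]
    rw [latticeSeq_apply h, linearCombination_rep]
    simp only [add_zero, Finset.sum_mul, Finset.mul_sum]
    rw [Finset.sum_comm]
    exact Finset.sum_congr rfl fun l _ => Finset.sum_congr rfl fun s _ => by ring

/-- As the mesh tends to zero, the `r` lattice points merge into the grid point, while their
coefficients stay bounded and sum to one. The limit functional can thus be written with the same
`J`-dependent weights at fixed nodes, which is the form that `tendsto_tensor_sub` compares. -/
lemma tendsto_tens_latticeSeq {r : ℕ} (hr : 0 < r) (μ : ℕ) (lam : ℤ → ℝ) {k₀ : ℕ}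
    (h : 2 * r ≤ 2 ^ k₀) {d : ℕ} (k : Fin d → ℕ) (z : Fin d → ℝ) (f : (Fin d → ℝ) → ℝ)
    (hf : Continuous f) :
    Filter.Tendsto (fun J => tens f (fun i => latticeSeq r μ lam k₀ (k i) J (z i))) Filter.atTop
      (nhds (tens f fun i => levelFun r μ lam (k i))) := by
  obtain ⟨C, hC0, hC⟩ := abs_levelWeight_le r μ lam
  set B : ℝ := (1 + (r + 1) + r : ℝ) ^ r with hB
  have hB0 : 0 ≤ B := by positivity
  let I : Fin d → Finset (ℕ × ℕ) := fun i => Finset.range (2 ^ (k i) + 1) ×ˢ Finset.range r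
  let w : ℕ → Fin d → ℕ × ℕ → ℝ := fun J i p => if p.1 ∈ Finset.range (2 ^ (k i) + 1) then
    levelWeight r μ lam (k i) p.1 *
    lagr r p.2 (-(shift (k i + k₀ + J) (z i)) - latticeOff r (k i) p.1) else 0
  let y : ℕ → Fin d → ℕ × ℕ → ℝ := fun J i p => 1 / (((2 ^ (k₀ + J) : ℕ) : ℝ) * 2 ^ (k i)) *
    (shift (k i + k₀ + J) (z i) + ((latticeBase r (k i) (2 ^ (k₀ + J)) p.1 + p.2 : ℕ) : ℝ))
  let y₀ : Fin d → ℕ × ℕ → ℝ := fun i p => (p.1 : ℝ) / 2 ^ (k i)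
  have h1 : ∀ J, tens f (fun i => latticeSeq r μ lam k₀ (k i) J (z i)) =
      ∑ p ∈ Fintype.piFinset I, (∏ i, w J i (p i)) * f (fun i => y J i (p i)) := by
    intro J
    rw [← tens_rep]
    congr 1
    funext i
    refine Finset.sum_congr rfl fun p hp => ?_
    simp only [w, if_pos (Finset.mem_product.1 hp).1]
    rfl
  have h2 : ∀ J, tens f (fun i => levelFun r μ lam (k i)) =
      ∑ p ∈ Fintype.piFinset I, (∏ i, w J i (p i)) * f (fun i => y₀ i (p i)) := by
    intro J
    rw [← tens_rep]
    congr 1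
    funext i
    rw [levelFun, Finset.sum_product]
    refine Finset.sum_congr rfl fun s hs => ?_
    simp only [w, y₀, if_pos hs]
    rw [← Finset.sum_smul, ← Finset.mul_sum, sum_lagr r hr, mul_one]
  have h3 := tendsto_tensor_sub I w y y₀ (C * B) ?_ ?_ f hf
  · have h4 : (fun J => tens f (fun i => latticeSeq r μ lam k₀ (k i) J (z i))) = fun J =>
        (∑ p ∈ Fintype.piFinset I, (∏ i, w J i (p i)) * f (fun i => y J i (p i)) -
        ∑ p ∈ Fintype.piFinset I, (∏ i, w J i (p i)) * f (fun i => y₀ i (p i))) +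
          tens f (fun i => levelFun r μ lam (k i)) := by
      funext J
      rw [h1 J, h2 J]; ring
    rw [h4]
    simpa using h3.add_const (tens f fun i => levelFun r μ lam (k i))
  · intro J i p
    simp only [w]
    split_ifs with hp
    · rw [abs_mul]
      refine mul_le_mul ((hC _ _ (by rw [Finset.mem_range] at hp; omega)).trans ?_)
        (abs_lagr_lattice_le r _ _ _ (shift_nonneg _ _) (shift_lt_one _ _)) (abs_nonneg _) hC0
      exact div_le_self hC0 (one_le_pow₀ (by norm_num))
    · rw [abs_zero]; positivity
  · intro i p hp
    rw [tendsto_iff_norm_sub_tendsto_zero]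
    have hp2 : p.2 < r := Finset.mem_range.1 (Finset.mem_product.1 hp).2
    have hlim : Filter.Tendsto (fun J : ℕ => (2 * r + 1 : ℝ) * (1 / 2) ^ J) Filter.atTop
        (nhds 0) := by
      simpa using (tendsto_pow_atTop_nhds_zero_of_lt_one (r := (1 / 2 : ℝ)) (by norm_num)
        (by norm_num)).const_mul (2 * r + 1 : ℝ)
    refine squeeze_zero (fun _ => norm_nonneg _) (fun J => ?_) hlim
    have hbase := latticeBase_cast (k := k i) (s := p.1) (two_mul_le_two_pow (J := J) h)
    have e : y J i p - y₀ i p = 1 / 2 ^ (k i + k₀ + J) *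
        (shift (k i + k₀ + J) (z i) + latticeOff r (k i) p.1 + p.2) := by
      simp only [y, y₀]
      rw [← two_pow_lattice]
      push_cast at hbase ⊢
      rw [hbase]
      field_simp
      ring
    rw [e, norm_mul, Real.norm_eq_abs, Real.norm_eq_abs, mul_comm, abs_of_nonneg (by positivity :
      (0 : ℝ) ≤ 1 / 2 ^ (k i + k₀ + J))]
    refine mul_le_mul ?_ ?_ (by positivity) (by positivity)
    · have a1 := abs_le.1 (abs_latticeOff_le r (k i) p.1)
      have a2 := shift_nonneg (k i + k₀ + J) (z i)
      have a3 := shift_lt_one (k i + k₀ + J) (z i)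
      have a4 : (p.2 : ℝ) ≤ r := by exact_mod_cast hp2.le
      have a5 : (0 : ℝ) ≤ p.2 := Nat.cast_nonneg _
      rw [abs_le]; constructor <;> linarith
    · rw [one_div_pow]
      exact one_div_le_one_div_of_le (by positivity)
        (pow_le_pow_right₀ (by norm_num) (by omega))

open Classical in
/-- The functional `levelFun` is a limit of sums of functionals, each a combination of differences
(or point evaluations, at the coarsest levels) at points of shifted dyadic lattices. -/
theorem exists_lattice_decomposition {r μ : ℕ} {lam : ℤ → ℝ} (hQ : IsQuasiInterpolation r μ lam)
    (hr : 0 < r) : ∃ (k₀ k₁ : ℕ) (C : ℝ) (S : ℕ → ℕ → Finset ℕ) (T : ℕ → ℕ → ℝ → ℝ →₀ ℝ)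
      (Γ : ℕ → ℕ → ℝ → ℕ → ℝ), 1 ≤ k₀ ∧ 0 < C ∧
      (∀ k j, ((S k j).card : ℝ) ≤ C * 2 ^ k) ∧
      (∀ k j, ∀ o ∈ S k j, o + (if k₁ ≤ k ∨ 0 < j then r else 0) < 2 ^ (k + k₀ + j)) ∧
      (∀ k j z o, |Γ k j z o| ≤ C / 2 ^ k) ∧
      (∀ k j z, T k j z = ∑ o ∈ S k j, Γ k j z o • (if k₁ ≤ k ∨ 0 < j then
        diffFun r (1 / 2 ^ (k + k₀ + j)) (1 / 2 ^ (k + k₀ + j) * (shift (k + k₀ + j) z + o))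
        else Finsupp.single (1 / 2 ^ (k + k₀ + j) * (shift (k + k₀ + j) z + o)) 1)) ∧
      ∀ {d : ℕ} (k : Fin d → ℕ) (z : Fin d → ℝ) (f : (Fin d → ℝ) → ℝ), Continuous f →
        Filter.Tendsto
          (fun J => tens f (fun i => ∑ j ∈ Finset.range (J + 1), T (k i) j (z i))) Filter.atTop
          (nhds (tens f fun i => levelFun r μ lam (k i))) := by
  -- The initial refinement `2 ^ k₀` leaves room for `r` lattice points on the inner side of every
  -- grid point, and `k₁ = r + 1` ensures that for `k ≥ k₁` the grid of level `k - 1` has at least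
  -- `r` points.
  have hk₀ : 2 * r ≤ 2 ^ (2 * r) := Nat.lt_two_pow_self.le
  set k₀ := 2 * r with hk₀'
  set k₁ := r + 1 with hk₁
  obtain ⟨C₁, hC₁0, hC₁⟩ := latticePiece_succ_eq r μ lam k₀ hk₀
  obtain ⟨C₂, D, hC₂0, hC₂⟩ := latticePiece_zero_eq hQ k₀ hk₀
  obtain ⟨C₃, hC₃0, hC₃⟩ := latticePiece_zero_small r μ lam k₀ k₁ hk₀
  let S : ℕ → ℕ → Finset ℕ := fun k j =>
    if j = 0 then (if k₁ ≤ k then windowSet r (2 ^ (k + k₀)) (2 ^ k) (2 ^ k₀) D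
      else Finset.range (2 ^ (k + k₀)))
    else windowSet r (2 ^ (k + k₀ + j)) (2 ^ k + 1) (2 ^ (k₀ + j)) (2 * r + 1)
  set C : ℝ := C₁ + C₂ + C₃ + 2 * (2 * D + 1) + 2 ^ k₀ + 2 * (2 * (2 * r + 1) + 1) + 1 with hC
  have hCpos : 0 < C := by positivity
  have key : ∀ k j z, ∃ γ : ℕ → ℝ, (∀ o, |γ o| ≤ C / 2 ^ k) ∧
      latticePiece r μ lam k₀ k j z = ∑ o ∈ S k j, γ o • (if k₁ ≤ k ∨ 0 < j then
        diffFun r (1 / 2 ^ (k + k₀ + j)) (1 / 2 ^ (k + k₀ + j) * (shift (k + k₀ + j) z + o))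
        else Finsupp.single (1 / 2 ^ (k + k₀ + j) * (shift (k + k₀ + j) z + o)) 1) := by
    intro k j z
    have hle : ∀ C' : ℝ, C' ≤ C → C' / 2 ^ k ≤ C / 2 ^ k := fun C' h' => by gcongr
    have p1 : (0 : ℝ) ≤ 2 * (2 * D + 1) := by positivity
    have p2 : (0 : ℝ) ≤ 2 ^ k₀ := by positivity
    have p3 : (0 : ℝ) ≤ 2 * (2 * (2 * r + 1) + 1) := by positivity
    cases j with
    | zero =>
      by_cases hk : k₁ ≤ k
      · obtain ⟨k', rfl⟩ : ∃ k', k = k' + 1 := ⟨k - 1, by omega⟩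
        have hk' : r ≤ 2 ^ k' + 1 := by
          have : k' < 2 ^ k' := Nat.lt_two_pow_self
          omega
        obtain ⟨γ, g1, g2⟩ := hC₂ k' z hk'
        refine ⟨γ, fun o => (g1 o).trans (hle _ (by linarith)), ?_⟩
        rw [g2]
        simp [S, hk]
      · obtain ⟨γ, g1, g2⟩ := hC₃ k z (by omega)
        refine ⟨γ, fun o => (g1 o).trans (hle _ (by linarith)), ?_⟩
        rw [g2]
        simp [S, hk]
    | succ j =>
      obtain ⟨γ, g1, g2⟩ := hC₁ k j z
      refine ⟨γ, fun o => (g1 o).trans (hle _ (by linarith)), ?_⟩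
      rw [g2]
      simp [S]
  choose Γ hΓ1 hΓ2 using key
  refine ⟨k₀, k₁, C, S, latticePiece r μ lam k₀, Γ, by omega, hCpos, ?_, ?_, hΓ1, hΓ2, ?_⟩
  · intro k j
    have p1 : (0 : ℝ) ≤ 2 * (2 * D + 1) := by positivity
    have p2 : (0 : ℝ) ≤ 2 ^ k₀ := by positivity
    have p3 : (0 : ℝ) ≤ 2 * (2 * (2 * r + 1) + 1) := by positivity
    have p4 : (1 : ℝ) ≤ 2 ^ k := one_le_pow₀ (by norm_num)
    simp only [S]
    split_ifs with h1 h2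
    · have := card_windowSet_le r (2 ^ (k + k₀)) (2 ^ k) (2 ^ k₀) D
      calc _ ≤ ((2 ^ k * (2 * D + 1) : ℕ) : ℝ) := by exact_mod_cast this
        _ = (2 * D + 1) * 2 ^ k := by push_cast; ring
        _ ≤ _ := mul_le_mul_of_nonneg_right (by linarith) (by positivity)
    · rw [Finset.card_range]
      push_cast
      rw [pow_add, mul_comm]
      exact mul_le_mul_of_nonneg_right (by linarith) (by positivity)
    · have := card_windowSet_le r (2 ^ (k + k₀ + j)) (2 ^ k + 1) (2 ^ (k₀ + j)) (2 * r + 1)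
      calc _ ≤ (((2 ^ k + 1) * (2 * (2 * r + 1) + 1) : ℕ) : ℝ) := by exact_mod_cast this
        _ = (2 ^ k + 1) * (2 * (2 * r + 1) + 1) := by push_cast; ring
        _ ≤ (2 * 2 ^ k) * (2 * (2 * r + 1) + 1) :=
            mul_le_mul_of_nonneg_right (by linarith) (by positivity)
        _ = 2 * (2 * (2 * r + 1) + 1) * 2 ^ k := by ring
        _ ≤ _ := mul_le_mul_of_nonneg_right (by linarith) (by positivity)
  · intro k j o ho
    simp only [S] at ho
    split_ifs at ho with h1 h2
    · subst h1
      rw [if_pos (Or.inl h2)]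
      exact (Finset.mem_filter.1 ho).2.1
    · subst h1
      rw [if_neg (by omega)]
      simpa using ho
    · rw [if_pos (Or.inr (by omega))]
      exact (Finset.mem_filter.1 ho).2.1
  · intro d k z f hf
    simp only [sum_latticePiece]
    exact tendsto_tens_latticeSeq hr μ lam hk₀ k z f hf

/-! ### Sums over multi-indices -/

lemma two_rpow_add (s t : ℝ) : (2 : ℝ≥0∞) ^ (s + t) = 2 ^ s * 2 ^ t :=
  ENNReal.rpow_add s t (by norm_num) (by norm_num)

lemma two_rpow_ne_top (t : ℝ) : (2 : ℝ≥0∞) ^ t ≠ ∞ :=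
  ENNReal.rpow_ne_top_of_ne_zero (by norm_num) (by norm_num)

lemma two_rpow_ne_zero (t : ℝ) : (2 : ℝ≥0∞) ^ t ≠ 0 := by
  simp [ENNReal.rpow_eq_zero_iff]

lemma two_rpow_le_two_rpow {s t : ℝ} (h : s ≤ t) : (2 : ℝ≥0∞) ^ s ≤ 2 ^ t :=
  ENNReal.rpow_le_rpow_of_exponent_le (by norm_num) h

lemma two_rpow_sum {ι : Type*} (s : Finset ι) (t : ι → ℝ) :
    (2 : ℝ≥0∞) ^ (∑ i ∈ s, t i) = ∏ i ∈ s, (2 : ℝ≥0∞) ^ t i := by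
  classical
  induction s using Finset.induction_on with
  | empty => simp
  | insert a s ha ih => rw [Finset.sum_insert ha, Finset.prod_insert ha, two_rpow_add, ih]

lemma tsum_prod_pi : ∀ {d : ℕ} (F : Fin d → ℕ → ℝ≥0∞),
    ∑' k : Fin d → ℕ, ∏ i, F i (k i) = ∏ i, ∑' n, F i n
  | 0, F => by simp [tsum_fintype]
  | d + 1, F => by
    rw [← (Fin.consEquiv fun _ => ℕ).tsum_eq, ENNReal.tsum_prod', Fin.prod_univ_succ]
    simp only [Fin.consEquiv, Equiv.coe_fn_mk, Fin.prod_univ_succ, Fin.cons_zero, Fin.cons_succ]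
    simp only [ENNReal.tsum_mul_left]
    rw [ENNReal.tsum_mul_right, tsum_prod_pi fun i => F i.succ]

lemma tsum_two_rpow_ne_top {δ : ℝ} (hδ : 0 < δ) : ∑' n : ℕ, (2 : ℝ≥0∞) ^ (-δ * n) ≠ ∞ := by
  have h : ∀ n : ℕ, (2 : ℝ≥0∞) ^ (-δ * n) = ((2 : ℝ≥0∞) ^ (-δ)) ^ n := by
    intro n
    rw [ENNReal.rpow_mul, ENNReal.rpow_natCast]
  simp only [h]
  rw [ENNReal.tsum_geometric]
  apply ENNReal.inv_ne_top.2
  rw [ne_eq, tsub_eq_zero_iff_le, not_le]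
  exact ENNReal.rpow_lt_one_of_one_lt_of_neg (by norm_num) (by linarith)

/-- The sum of the entries of a multi-index, as a real number. -/
def msum {d : ℕ} (k : Fin d → ℕ) : ℝ := ∑ i, (k i : ℝ)

lemma tsum_weight_ne_top {d : ℕ} {w : Fin d → ℝ} (hw : ∀ i, 0 < w i) :
    ∑' k : Fin d → ℕ, (2 : ℝ≥0∞) ^ (-∑ i, w i * k i) ≠ ∞ := by
  have h : ∀ k : Fin d → ℕ, (2 : ℝ≥0∞) ^ (-∑ i, w i * k i) =
      ∏ i, (2 : ℝ≥0∞) ^ (-w i * (k i : ℝ)) := by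
    intro k
    rw [← two_rpow_sum, ← Finset.sum_neg_distrib]
    congr 1
    exact Finset.sum_congr rfl fun i _ => by ring
  simp only [h]
  rw [tsum_prod_pi fun i (n : ℕ) => (2 : ℝ≥0∞) ^ (-w i * (n : ℝ))]
  exact ENNReal.prod_ne_top fun i _ => tsum_two_rpow_ne_top (hw i)

lemma tsum_msum_ne_top {d : ℕ} {δ : ℝ} (hδ : 0 < δ) :
    ∑' k : Fin d → ℕ, (2 : ℝ≥0∞) ^ (-(δ * msum k)) ≠ ∞ := by
  have := tsum_weight_ne_top (d := d) (w := fun _ => δ) fun _ => hδ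
  simpa only [msum, Finset.mul_sum] using this

/-- At the cost of a small exponential weight, powers may be moved into a sum. -/
lemma exists_tsum_rpow_le (d : ℕ) {q δ : ℝ} (hq : 0 < q) (hδ : 0 < δ) : ∃ C : ℝ≥0∞, C ≠ ∞ ∧
    ∀ x : (Fin d → ℕ) → ℝ≥0∞,
      (∑' j, x j) ^ q ≤ C * ∑' j, (2 : ℝ≥0∞) ^ (δ * msum j) * x j ^ q := by
  have hδ' : 0 < δ / q := div_pos hδ hq
  set S := ∑' k : Fin d → ℕ, (2 : ℝ≥0∞) ^ (-(δ / q * msum k)) with hS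
  refine ⟨S ^ q, ENNReal.rpow_ne_top_of_nonneg hq.le (tsum_msum_ne_top hδ'), fun x => ?_⟩
  set M := ∑' j, (2 : ℝ≥0∞) ^ (δ * msum j) * x j ^ q with hM
  -- Every term is dominated by the whole sum `M`, so the small weight leaves a convergent geometric
  -- sum. This serves `q < 1` and `q > 1` alike.
  have h1 : ∀ j, x j ≤ (2 : ℝ≥0∞) ^ (-(δ / q * msum j)) * M ^ (1 / q) := by
    intro j
    have h2 : (2 : ℝ≥0∞) ^ (δ * msum j) * x j ^ q ≤ M := ENNReal.le_tsum j
    have h3 := ENNReal.rpow_le_rpow h2 (one_div_pos.2 hq).le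
    rw [ENNReal.mul_rpow_of_nonneg _ _ (one_div_pos.2 hq).le, ← ENNReal.rpow_mul,
      ← ENNReal.rpow_mul, mul_one_div_cancel hq.ne', ENNReal.rpow_one] at h3
    calc x j = (2 : ℝ≥0∞) ^ (-(δ / q * msum j)) *
          ((2 : ℝ≥0∞) ^ (δ * msum j * (1 / q)) * x j) := by
          rw [← mul_assoc, ← two_rpow_add,
            show -(δ / q * msum j) + δ * msum j * (1 / q) = 0 by ring,
            ENNReal.rpow_zero, one_mul]
      _ ≤ _ := by gcongr
  calc (∑' j, x j) ^ q ≤ (S * M ^ (1 / q)) ^ q := by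
        refine ENNReal.rpow_le_rpow ?_ hq.le
        rw [hS, ← ENNReal.tsum_mul_right]
        exact ENNReal.tsum_le_tsum h1
    _ = S ^ q * M := by
        rw [ENNReal.mul_rpow_of_nonneg _ _ hq.le, ← ENNReal.rpow_mul, one_div_mul_cancel hq.ne',
          ENNReal.rpow_one]

/-- Convexity for `q ≥ 1`, subadditivity of the power for `q ≤ 1`. This dichotomy is the origin of
the exponent `(1/p - 1)_+`. -/
lemma rpow_sum_le_card {ι : Type*} (s : Finset ι) (x : ι → ℝ≥0∞) {q : ℝ} (hq : 0 < q) :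
    (∑ i ∈ s, x i) ^ q ≤ (s.card : ℝ≥0∞) ^ (max (q - 1) 0) * ∑ i ∈ s, x i ^ q := by
  rcases le_total 1 q with h | h
  · rw [max_eq_left (by linarith)]
    exact ENNReal.rpow_sum_le_const_mul_sum_rpow s x h
  · rw [max_eq_right (by linarith), ENNReal.rpow_zero, one_mul]
    classical
    induction s using Finset.induction_on with
    | empty => simp [hq]
    | insert a s ha ih =>
      rw [Finset.sum_insert ha, Finset.sum_insert ha]
      exact (ENNReal.rpow_add_le_add_rpow _ _ hq.le h).trans (by gcongr)

/-! ### Averaging over the shift of the lattice -/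

lemma measurable_shift (m : ℕ) : Measurable (shift m) :=
  measurable_fract.comp (measurable_const_mul _)

/-- The two inverse branches of the doubling map, each halving lengths. -/
lemma fract_two_mul_preimage (A : Set ℝ) :
    (fun z : ℝ => Int.fract (2 * z)) ⁻¹' A ∩ Set.Ico 0 1 =
      ((fun z : ℝ => 2 * z) ⁻¹' (A ∩ Set.Ico 0 1)) ∪
      ((fun z : ℝ => z + -(1 / 2)) ⁻¹' ((fun z : ℝ => 2 * z) ⁻¹' (A ∩ Set.Ico 0 1))) := by
  ext z
  simp only [Set.mem_inter_iff, Set.mem_preimage, Set.mem_Ico, Set.mem_union]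
  constructor
  · rintro ⟨h1, h2, h3⟩
    rcases lt_or_ge (2 * z) 1 with h | h
    · left
      rw [Int.fract_eq_self.2 ⟨by linarith, h⟩] at h1
      exact ⟨h1, by linarith, h⟩
    · right
      have : Int.fract (2 * z) = 2 * (z + -(1 / 2)) :=
        Int.fract_eq_iff.2 ⟨by linarith, by linarith, 1, by push_cast; ring⟩
      rw [this] at h1
      exact ⟨h1, by linarith, by linarith⟩
  · rintro (⟨h1, h2, h3⟩ | ⟨h1, h2, h3⟩)
    · rw [Int.fract_eq_self.2 ⟨h2, h3⟩]
      exact ⟨h1, by linarith, by linarith⟩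
    · have : Int.fract (2 * z) = 2 * (z + -(1 / 2)) :=
        Int.fract_eq_iff.2 ⟨by linarith, by linarith, 1, by push_cast; ring⟩
      rw [this]
      exact ⟨h1, by linarith, by linarith⟩

lemma measurePreserving_fract_two_mul :
    MeasurePreserving (fun z : ℝ => Int.fract (2 * z)) (volume.restrict (Set.Ico 0 1))
      (volume.restrict (Set.Ico 0 1)) := by
  have hm : Measurable (fun z : ℝ => Int.fract (2 * z)) :=
    measurable_fract.comp (measurable_const_mul _)
  refine ⟨hm, Measure.ext fun A hA => ?_⟩
  have hA' : MeasurableSet (A ∩ Set.Ico (0 : ℝ) 1) := hA.inter measurableSet_Ico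
  rw [Measure.map_apply hm hA, Measure.restrict_apply (hm hA), Measure.restrict_apply hA,
    fract_two_mul_preimage, measure_union, measure_preimage_add_right,
    Real.volume_preimage_mul_left (by norm_num), ← add_mul, ← ENNReal.ofReal_add (by positivity)
      (by positivity)]
  · norm_num
  · rw [Set.disjoint_left]
    rintro z ⟨_, h2, h3⟩ ⟨_, h4, h5⟩
    simp only at h2 h3 h4 h5
    linarith
  · exact (measurable_add_const _) ((measurable_const_mul _) hA')

/-- On `[0,1)` the map `shift m` is the `m`-th iterate of the doubling map. -/
lemma measurePreserving_shift (m : ℕ) :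
    MeasurePreserving (shift m) (volume.restrict (Set.Ico 0 1))
      (volume.restrict (Set.Ico 0 1)) := by
  induction m with
  | zero =>
    have h : (id : ℝ → ℝ) =ᵐ[volume.restrict (Set.Ico 0 1)] shift 0 := by
      filter_upwards [ae_restrict_mem measurableSet_Ico] with z hz
      simp only [shift, pow_zero, one_mul, id]
      exact (Int.fract_eq_self.2 hz).symm
    refine ⟨measurable_shift 0, ?_⟩
    rw [← Measure.map_congr h, Measure.map_id]
  | succ m ih =>
    have h : shift (m + 1) = (fun z : ℝ => Int.fract (2 * z)) ∘ shift m := by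
      funext z
      simp only [shift, Function.comp]
      rw [pow_succ, show (2 : ℝ) ^ m * 2 * z = 2 * Int.fract (2 ^ m * z) +
        ((2 * ⌊(2 : ℝ) ^ m * z⌋ : ℤ) : ℝ) by
          have := Int.floor_add_fract ((2 : ℝ) ^ m * z); push_cast; linarith]
      exact Int.fract_add_intCast _ _
    rw [h]
    exact measurePreserving_fract_two_mul.comp ih

/-- The half-open unit cube. -/
def unitBox (d : ℕ) : Set (Fin d → ℝ) := Set.univ.pi fun _ => Set.Ico 0 1

lemma measurableSet_unitBox (d : ℕ) : MeasurableSet (unitBox d) :=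
  MeasurableSet.univ_pi fun _ => measurableSet_Ico

lemma volume_restrict_unitBox (d : ℕ) : (volume : Measure (Fin d → ℝ)).restrict (unitBox d) =
    Measure.pi fun _ => (volume : Measure ℝ).restrict (Set.Ico 0 1) := by
  rw [unitBox, volume_pi, Measure.restrict_pi_pi]

lemma volume_unitBox (d : ℕ) : (volume : Measure (Fin d → ℝ)) (unitBox d) = 1 := by
  rw [unitBox, Real.volume_pi_Ico]
  simp

/-- The shifts of different levels depend on each other through `z`, but each one alone is uniformly
distributed. After the `p`-th power has been moved inside the sum over levels, that is all the
averaging uses. -/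
lemma lintegral_shift {d : ℕ} (m : Fin d → ℕ) (F : (Fin d → ℝ) → ℝ≥0∞) (hF : Measurable F) :
    ∫⁻ z in unitBox d, F (fun i => shift (m i) (z i)) = ∫⁻ ζ in unitBox d, F ζ := by
  rw [volume_restrict_unitBox]
  exact (measurePreserving_pi _ _ fun i => measurePreserving_shift (m i)).lintegral_comp hF

/-- The cell with corner `2 ^ (-m) o` of the dyadic lattice of mesh `2 ^ (-m)`. -/
def cell {d : ℕ} (m o : Fin d → ℕ) : Set (Fin d → ℝ) :=
  {y | ∀ i, (o i : ℝ) ≤ 2 ^ m i * y i ∧ 2 ^ m i * y i < o i + 1}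

lemma measurableSet_cell {d : ℕ} (m o : Fin d → ℕ) : MeasurableSet (cell m o) := by
  unfold cell
  simp only [Set.ofPred_forall]
  refine MeasurableSet.iInter fun i => ?_
  have : Measurable fun y : Fin d → ℝ => (2 : ℝ) ^ m i * y i := by fun_prop
  exact (measurableSet_le measurable_const this).inter (measurableSet_lt this measurable_const)

lemma cell_disjoint {d : ℕ} (m : Fin d → ℕ) {o o' : Fin d → ℕ} (h : o ≠ o') :
    Disjoint (cell m o) (cell m o') := by
  rw [Set.disjoint_left]
  intro y hy hy'
  apply h
  funext i
  have h1 : (o i : ℝ) < o' i + 1 := (hy i).1.trans_lt (hy' i).2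
  have h2 : (o' i : ℝ) < o i + 1 := (hy' i).1.trans_lt (hy i).2
  have h1' : o i < o' i + 1 := by exact_mod_cast h1
  have h2' : o' i < o i + 1 := by exact_mod_cast h2
  omega

/-- As `ζ` runs through the unit box, the lattice point with index `o` sweeps out its cell; the
factor is the Jacobian. -/
lemma lintegral_cell {d : ℕ} (m o : Fin d → ℕ) (G : (Fin d → ℝ) → ℝ≥0∞) (hG : Measurable G) :
    ∫⁻ ζ in unitBox d, G (fun i => 1 / 2 ^ m i * (ζ i + o i)) =
      2 ^ msum m * ∫⁻ y in cell m o, G y := by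
  classical
  set D : Fin d → ℝ := fun i => 1 / 2 ^ m i with hD
  have hdet : (Matrix.diagonal D).det = ∏ i, D i := Matrix.det_diagonal
  have hpos : 0 < ∏ i, D i := Finset.prod_pos fun i _ => by simp only [hD]; positivity
  have hvol := Real.smul_map_diagonal_volume_pi (D := D) (by rw [hdet]; exact hpos.ne')
  have hlin : ∀ ζ, Matrix.toLin' (Matrix.diagonal D) ζ = fun i => D i * ζ i := by
    intro ζ
    rw [Matrix.toLin'_apply]
    funext i
    rw [Matrix.mulVec_diagonal]
  have hmeas : Measurable (Matrix.toLin' (Matrix.diagonal D)) := by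
    have : (⇑(Matrix.toLin' (Matrix.diagonal D)) : (Fin d → ℝ) → _) = fun ζ i => D i * ζ i :=
      funext hlin
    rw [this]
    fun_prop
  have hH : Measurable ((cell m o).indicator G) := hG.indicator (measurableSet_cell m o)
  have key : ∫⁻ y in cell m o, G y = ENNReal.ofReal (∏ i, D i) *
      ∫⁻ ζ in unitBox d, G (fun i => 1 / 2 ^ m i * (ζ i + o i)) := by
    rw [← lintegral_indicator (measurableSet_cell m o)]
    conv_lhs => rw [← hvol]
    rw [lintegral_smul_measure, lintegral_map hH hmeas, hdet, abs_of_pos hpos, smul_eq_mul]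
    congr 1
    rw [← lintegral_add_right_eq_self _ (fun i => (o i : ℝ)),
      ← lintegral_indicator (measurableSet_unitBox d)]
    refine lintegral_congr fun ζ => ?_
    rw [hlin]
    have hiff : (fun i => D i * (ζ + fun i => (o i : ℝ)) i) ∈ cell m o ↔ ζ ∈ unitBox d := by
      simp only [cell, unitBox, Set.mem_pi, Set.mem_univ, forall_true_left, Set.mem_Ico, hD,
        Pi.add_apply]
      refine forall_congr' fun i => ?_
      have : (2 : ℝ) ^ m i * (1 / 2 ^ m i * (ζ i + o i)) = ζ i + o i := by field_simp
      rw [this]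
      constructor
      · rintro ⟨a, b⟩; exact ⟨by linarith, by linarith⟩
      · rintro ⟨a, b⟩; exact ⟨by linarith, by linarith⟩
    by_cases hζ : ζ ∈ unitBox d
    · rw [Set.indicator_of_mem (hiff.2 hζ), Set.indicator_of_mem hζ]
      rfl
    · rw [Set.indicator_of_notMem (fun h => hζ (hiff.1 h)), Set.indicator_of_notMem hζ]
  rw [key, ← mul_assoc]
  have : (2 : ℝ≥0∞) ^ msum m * ENNReal.ofReal (∏ i, D i) = 1 := by
    rw [msum, two_rpow_sum, ENNReal.ofReal_prod_of_nonneg fun i _ => by simp only [hD]; positivity,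
      ← Finset.prod_mul_distrib]
    refine Finset.prod_eq_one fun i _ => ?_
    simp only [hD]
    rw [ENNReal.rpow_natCast, ENNReal.ofReal_div_of_pos (by positivity), ENNReal.ofReal_one,
      ENNReal.ofReal_pow (by norm_num), ENNReal.ofReal_ofNat, one_div,
      ENNReal.mul_inv_cancel (by simp) (by simp)]
  rw [this, one_mul]

/-! ### The estimate of `∫ q_k(f)` by mixed differences -/

/-- The `L_p` quasi-norm of the mixed difference with step `2 ^ (-m)`. -/
def diffNorm {d : ℕ} (r : ℕ) (p : ℝ≥0∞) (f : (Fin d → ℝ) → ℝ) (e : Finset (Fin d))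
    (m : Fin d → ℕ) : ℝ≥0∞ :=
  eLpNorm (mixedDiff r e (fun i => 1 / 2 ^ m i) f) p
    (volume.restrict (diffDomain r e fun i => 1 / 2 ^ m i))

/-- The directions in which differences are taken. -/
def diffDirs {d : ℕ} (k₁ : ℕ) (k j : Fin d → ℕ) : Finset (Fin d) :=
  Finset.univ.filter fun i => k₁ ≤ k i ∨ 0 < j i

open Classical in
lemma mixedDiff_eq_tens {d : ℕ} (r : ℕ) (e : Finset (Fin d)) (h x : Fin d → ℝ)
    (f : (Fin d → ℝ) → ℝ) :
    mixedDiff r e h f x =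
      tens f (fun i => if i ∈ e then diffFun r (h i) (x i) else Finsupp.single (x i) 1) := by
  refine tensorOp_eq_tens _ f x _ fun i g => ?_
  split_ifs with hi
  · rw [diffFun_apply]
  · simp [Finsupp.linearCombination_single]

lemma mixedDiff_eq_sum {d : ℕ} (r : ℕ) (e : Finset (Fin d)) (h x : Fin d → ℝ)
    (f : (Fin d → ℝ) → ℝ) : mixedDiff r e h f x =
      ∑ q ∈ Fintype.piFinset (fun i => if i ∈ e then Finset.range (r + 1) else {0}),
        (∏ i, if i ∈ e then (-1 : ℝ) ^ (r - q i) * (r.choose (q i) : ℝ) else 1) *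
          f (fun i => x i + q i * h i) := by
  classical
  rw [mixedDiff_eq_tens, ← tens_rep f (fun i => if i ∈ e then Finset.range (r + 1) else {0})
    (fun i q => if i ∈ e then (-1 : ℝ) ^ (r - q) * (r.choose q : ℝ) else 1)
    (fun i q => x i + q * h i)]
  congr 1
  funext i
  split_ifs with hi
  · rfl
  · simp

lemma continuous_mixedDiff {d : ℕ} (r : ℕ) (e : Finset (Fin d)) (h : Fin d → ℝ)
    {f : (Fin d → ℝ) → ℝ} (hf : Continuous f) : Continuous (mixedDiff r e h f) := by
  have : mixedDiff r e h f = fun x => _ := funext fun x => mixedDiff_eq_sum r e h x f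
  rw [this]
  fun_prop

lemma mixedDiff_congr_on_cube {d : ℕ} (r : ℕ) (e : Finset (Fin d)) (h x : Fin d → ℝ)
    {f f' : (Fin d → ℝ) → ℝ} (hff : ∀ y ∈ cube d, f y = f' y) (hx : x ∈ diffDomain r e h) :
    mixedDiff r e h f x = mixedDiff r e h f' x := by
  rw [mixedDiff_eq_sum, mixedDiff_eq_sum]
  refine Finset.sum_congr rfl fun q hq => ?_
  rw [Fintype.mem_piFinset] at hq
  congr 1
  apply hff
  obtain ⟨⟨hx0, hx1⟩, hx2⟩ := hx
  have key : ∀ i, 0 ≤ x i + q i * h i ∧ x i + q i * h i ≤ 1 := by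
    intro i
    have a0 : 0 ≤ x i := hx0 i
    have a1 : x i ≤ 1 := hx1 i
    have hqi := hq i
    split_ifs at hqi with hi
    · rw [Finset.mem_range] at hqi
      obtain ⟨b0, b1⟩ := hx2 i hi
      have c0 : (0 : ℝ) ≤ q i := Nat.cast_nonneg _
      have c1 : (q i : ℝ) ≤ r := by exact_mod_cast Nat.lt_succ_iff.1 hqi
      rcases le_total 0 (h i) with hh | hh
      · have := mul_le_mul_of_nonneg_right c1 hh
        have := mul_nonneg c0 hh
        constructor <;> linarith
      · have := mul_le_mul_of_nonpos_right c1 hh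
        have := mul_nonpos_of_nonneg_of_nonpos c0 hh
        constructor <;> linarith
    · rw [Finset.mem_singleton] at hqi
      rw [hqi]
      simp [a0, a1]
  exact ⟨fun i => (key i).1, fun i => (key i).2⟩

lemma measurableSet_cube (d : ℕ) : MeasurableSet (cube d) := measurableSet_Icc

lemma measurableSet_diffDomain {d : ℕ} (r : ℕ) (e : Finset (Fin d)) (h : Fin d → ℝ) :
    MeasurableSet (diffDomain r e h) := by
  have : diffDomain r e h = cube d ∩ ⋂ i ∈ e, (fun x : Fin d → ℝ => x i + r * h i) ⁻¹'
      Set.Icc (0 : ℝ) 1 := by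
    ext x; simp [diffDomain]
  rw [this]
  refine (measurableSet_cube d).inter (Finset.measurableSet_biInter _ fun i _ => ?_)
  have : Measurable fun x : Fin d → ℝ => x i + r * h i := by fun_prop
  exact this measurableSet_Icc

lemma volume_cube (d : ℕ) : (volume : Measure (Fin d → ℝ)) (cube d) = 1 := by
  rw [cube, Real.volume_Icc_pi]
  simp

lemma diffNorm_congr {d : ℕ} (r : ℕ) (p : ℝ≥0∞) {f f' : (Fin d → ℝ) → ℝ}
    (hff : ∀ y ∈ cube d, f y = f' y) (e : Finset (Fin d)) (m : Fin d → ℕ) :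
    diffNorm r p f e m = diffNorm r p f' e m := by
  refine eLpNorm_congr_ae ?_
  filter_upwards [ae_restrict_mem (measurableSet_diffDomain r e _)] with x hx
  exact mixedDiff_congr_on_cube r e _ x hff hx

/-- The cells are disjoint, and the margin of `r` indices in the directions of `e` keeps every
difference started in a cell inside the cube. -/
lemma sum_lintegral_cell_le {d : ℕ} (r : ℕ) (e : Finset (Fin d)) (m : Fin d → ℕ)
    (S : Fin d → Finset ℕ) (hS : ∀ i, ∀ o ∈ S i, o + (if i ∈ e then r else 0) < 2 ^ m i)
    (G : (Fin d → ℝ) → ℝ≥0∞) :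
    ∑ o ∈ Fintype.piFinset S, ∫⁻ y in cell m o, G y ≤
      ∫⁻ y in diffDomain r e (fun i => 1 / 2 ^ m i), G y := by
  rw [← lintegral_biUnion_finset (fun a _ b _ hab => cell_disjoint m hab)
    fun b _ => measurableSet_cell m b]
  refine lintegral_mono_set ?_
  intro y hy
  simp only [Set.mem_iUnion] at hy
  obtain ⟨o, ho, hy⟩ := hy
  rw [Fintype.mem_piFinset] at ho
  have key : ∀ i, 0 ≤ y i ∧ y i + (if i ∈ e then r else 0 : ℕ) * (1 / 2 ^ m i) ≤ 1 := by
    intro i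
    obtain ⟨h1, h2⟩ := hy i
    have hp : (0 : ℝ) < 2 ^ m i := by positivity
    have h3 : (o i : ℝ) + (if i ∈ e then r else 0 : ℕ) + 1 ≤ 2 ^ m i := by
      exact_mod_cast hS i _ (ho i)
    constructor
    · by_contra hneg
      push Not at hneg
      have := mul_neg_of_pos_of_neg hp hneg
      have : (0 : ℝ) ≤ o i := Nat.cast_nonneg _
      linarith
    · have : 2 ^ m i * (y i + (if i ∈ e then r else 0 : ℕ) * (1 / 2 ^ m i)) ≤ 2 ^ m i * 1 := by
        have e1 : 2 ^ m i * (y i + (if i ∈ e then r else 0 : ℕ) * (1 / 2 ^ m i)) =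
          2 ^ m i * y i + (if i ∈ e then r else 0 : ℕ) := by field_simp
        rw [e1]; linarith
      exact le_of_mul_le_mul_left this hp
  refine ⟨⟨fun i => (key i).1, fun i => ?_⟩, fun i hi => ?_⟩
  · refine le_trans ?_ (key i).2
    have : (0 : ℝ) ≤ (if i ∈ e then r else 0 : ℕ) * (1 / 2 ^ m i) := by positivity
    linarith
  · have := key i
    rw [if_pos hi] at this
    exact ⟨add_nonneg this.1 (by positivity), this.2⟩

lemma enorm_tens_le_tsum {d : ℕ} {f : (Fin d → ℝ) → ℝ} {φ : Fin d → ℝ →₀ ℝ}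
    {T : Fin d → ℕ → ℝ →₀ ℝ}
    (h : Filter.Tendsto (fun J => tens f (fun i => ∑ j ∈ Finset.range (J + 1), T i j))
      Filter.atTop (nhds (tens f φ))) :
    ‖tens f φ‖ₑ ≤ ∑' j : Fin d → ℕ, ‖tens f (fun i => T i (j i))‖ₑ := by
  classical
  refine le_of_tendsto ((continuous_enorm.tendsto _).comp h)
    (Filter.Eventually.of_forall fun J => ?_)
  simp only [Function.comp]
  rw [MultilinearMap.map_sum_finset]
  exact (enorm_sum_le _ _).trans (ENNReal.sum_le_tsum _)

/-- Composition with the coordinatewise clamp onto `[0,1]`. Global continuity supplies measurability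
and the limit `J → ∞`; the values off the cube never enter the estimates. -/
lemma exists_continuous_extension {d : ℕ} {f : (Fin d → ℝ) → ℝ} (hf : ContinuousOn f (cube d)) :
    ∃ f' : (Fin d → ℝ) → ℝ, Continuous f' ∧ ∀ y ∈ cube d, f y = f' y := by
  refine ⟨fun x => f (fun i => max 0 (min 1 (x i))), ?_, fun y hy => ?_⟩
  · refine hf.comp_continuous (by fun_prop) fun x => ⟨fun i => le_max_left _ _, fun i => ?_⟩
    exact max_le zero_le_one (min_le_left _ _)
  · congr 1
    funext i
    have h0 : 0 ≤ y i := hy.1 i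
    have h1 : y i ≤ 1 := hy.2 i
    rw [min_eq_right h1, max_eq_right h0]

/-- The lattice decomposition expresses the left side through mixed differences at lattice points,
for every shift `z`. The left side does not depend on `z`, so its `p`-th power may be averaged. The
price is `β > 1/p` per refinement step and `(1/p - 1)_+` per level. -/
theorem enorm_tens_levelFun_le {r μ : ℕ} {lam : ℤ → ℝ} (hQ : IsQuasiInterpolation r μ lam)
    (hr : 0 < r) (d : ℕ) : ∃ k₀ k₁ : ℕ, 1 ≤ k₀ ∧ ∀ p : ℝ≥0∞, p ≠ 0 → p ≠ ∞ → ∀ β : ℝ,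
      p⁻¹.toReal < β → ∃ K : ℝ≥0∞, K ≠ ∞ ∧ ∀ f : (Fin d → ℝ) → ℝ, ContinuousOn f (cube d) →
        ∀ k : Fin d → ℕ, ‖tens f (fun i => levelFun r μ lam (k i))‖ₑ ≤
          K * 2 ^ (max (p⁻¹.toReal - 1) 0 * msum k) * ∑' j : Fin d → ℕ,
            (2 : ℝ≥0∞) ^ (β * msum j) *
              diffNorm r p f (diffDirs k₁ k j) (fun i => k i + k₀ + j i) := by
  classical
  obtain ⟨k₀, k₁, C, S, T, Γ, hk₀, hC, hcard, hS, hΓ, hT, hlim⟩ :=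
    exists_lattice_decomposition hQ hr
  refine ⟨k₀, k₁, hk₀, fun p hp0 hp β hβ => ?_⟩
  set P := p.toReal with hP
  have hPpos : 0 < P := ENNReal.toReal_pos hp0 hp
  rw [ENNReal.toReal_inv] at hβ ⊢
  -- The excess of `β` over `1/p` is spent in two halves: when the power `P` enters the sum over
  -- `j`, and when the power `P⁻¹` does.
  set η := (β - P⁻¹) / 2 with hη
  have hηpos : 0 < η := by rw [hη]; linarith
  obtain ⟨K₁, hK₁, hK₁'⟩ := exists_tsum_rpow_le d hPpos (mul_pos hPpos hηpos)
  obtain ⟨K₂, hK₂, hK₂'⟩ := exists_tsum_rpow_le d (inv_pos.2 hPpos) hηpos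
  set M := max (P - 1) 0 with hM
  have hM0 : 0 ≤ M := le_max_right _ _
  set Cd : ℝ≥0∞ := ENNReal.ofReal C ^ d with hCd
  have hCdtop : Cd ≠ ∞ := ENNReal.pow_ne_top ENNReal.ofReal_ne_top
  set K₃ : ℝ≥0∞ := K₁ * (Cd ^ P * Cd ^ M * 2 ^ (d * k₀ : ℝ)) with hK₃
  have hK₃top : K₃ ≠ ∞ := by
    refine ENNReal.mul_ne_top hK₁ (ENNReal.mul_ne_top (ENNReal.mul_ne_top ?_ ?_)
      (two_rpow_ne_top _))
    · exact ENNReal.rpow_ne_top_of_nonneg hPpos.le hCdtop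
    · exact ENNReal.rpow_ne_top_of_nonneg hM0 hCdtop
  refine ⟨K₃ ^ P⁻¹ * K₂, ENNReal.mul_ne_top
    (ENNReal.rpow_ne_top_of_nonneg (inv_pos.2 hPpos).le hK₃top) hK₂, ?_⟩
  suffices H : ∀ f : (Fin d → ℝ) → ℝ, Continuous f → ∀ k : Fin d → ℕ,
      ‖tens f (fun i => levelFun r μ lam (k i))‖ₑ ≤
          K₃ ^ P⁻¹ * K₂ * 2 ^ (max (P⁻¹ - 1) 0 * msum k) * ∑' j : Fin d → ℕ,
            (2 : ℝ≥0∞) ^ (β * msum j) *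
              diffNorm r p f (diffDirs k₁ k j) (fun i => k i + k₀ + j i) by
    intro f hf k
    obtain ⟨f', hf', hff⟩ := exists_continuous_extension hf
    have e1 : tens f (fun i => levelFun r μ lam (k i)) =
        tens f' (fun i => levelFun r μ lam (k i)) := by
      simp only [levelFun]
      rw [tens_rep, tens_rep]
      refine Finset.sum_congr rfl fun s hs => ?_
      rw [Fintype.mem_piFinset] at hs
      congr 1
      refine hff _ ⟨fun i => by simp only [Pi.zero_apply]; positivity, fun i => ?_⟩
      have h2 : (0 : ℝ) < 2 ^ k i := by positivity
      have h3 := Finset.mem_range.1 (hs i)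
      simp only [Pi.one_apply]
      rw [div_le_one h2]
      exact_mod_cast Nat.lt_succ_iff.1 h3
    rw [e1]
    simp only [diffNorm_congr r p hff]
    exact H f' hf' k
  intro f hf k
  set X := ‖tens f (fun i => levelFun r μ lam (k i))‖ₑ with hX
  let m : (Fin d → ℕ) → Fin d → ℕ := fun j i => k i + k₀ + j i
  let G : (Fin d → ℕ) → (Fin d → ℝ) → ℝ≥0∞ := fun j y =>
    ‖mixedDiff r (diffDirs k₁ k j) (fun i => 1 / 2 ^ m j i) f y‖ₑ ^ P
  have hG : ∀ j, Measurable (G j) := fun j =>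
    ((continuous_mixedDiff r _ _ hf).measurable.enorm).pow_const P
  let pt : (Fin d → ℕ) → (Fin d → ℕ) → (Fin d → ℝ) → Fin d → ℝ := fun j o ζ i =>
    1 / 2 ^ m j i * (ζ i + o i)
  let Sj : (Fin d → ℕ) → Finset (Fin d → ℕ) := fun j => Fintype.piFinset fun i => S (k i) (j i)
  let A : ℝ≥0∞ := Cd * 2 ^ (-msum k)
  -- pointwise bound of a single tensor product of pieces
  have hpiece : ∀ (j : Fin d → ℕ) (z : Fin d → ℝ), ‖tens f (fun i => T (k i) (j i) (z i))‖ₑ ≤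
      A * ∑ o ∈ Sj j, ‖mixedDiff r (diffDirs k₁ k j) (fun i => 1 / 2 ^ m j i) f
        (pt j o fun i => shift (m j i) (z i))‖ₑ := by
    intro j z
    have e1 : (fun i => T (k i) (j i) (z i)) = fun i => ∑ o ∈ S (k i) (j i),
        Γ (k i) (j i) (z i) o • (if i ∈ diffDirs k₁ k j then
          diffFun r (1 / 2 ^ m j i) (1 / 2 ^ m j i * (shift (m j i) (z i) + o))
          else Finsupp.single (1 / 2 ^ m j i * (shift (m j i) (z i) + o)) 1) := by
      funext i
      rw [hT]
      simp only [diffDirs, Finset.mem_filter, Finset.mem_univ, true_and, m]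
    rw [e1, MultilinearMap.map_sum_finset]
    refine (enorm_sum_le _ _).trans ?_
    rw [Finset.mul_sum]
    refine Finset.sum_le_sum fun o _ => ?_
    rw [(tens f).map_smul_univ (fun i => Γ (k i) (j i) (z i) (o i))]
    have e2 := mixedDiff_eq_tens r (diffDirs k₁ k j) (fun i => 1 / 2 ^ m j i)
      (pt j o fun i => shift (m j i) (z i)) f
    simp only [pt] at e2 ⊢
    rw [← e2, smul_eq_mul, enorm_mul]
    gcongr
    have e3 : ‖∏ i, Γ (k i) (j i) (z i) (o i)‖ₑ = ∏ i, ‖Γ (k i) (j i) (z i) (o i)‖ₑ := by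
      simp only [enorm_eq_nnnorm, nnnorm_prod]
      push_cast; rfl
    rw [e3]
    have e4 : A = ∏ i, (ENNReal.ofReal C * (2 : ℝ≥0∞) ^ (-(k i : ℝ))) := by
      rw [Finset.prod_mul_distrib, ← two_rpow_sum, Finset.sum_neg_distrib]
      simp [A, hCd, msum]
    rw [e4]
    refine Finset.prod_le_prod' fun i _ => ?_
    rw [← ofReal_norm, Real.norm_eq_abs]
    refine (ENNReal.ofReal_le_ofReal (hΓ _ _ _ _)).trans (le_of_eq ?_)
    rw [ENNReal.ofReal_div_of_pos (by positivity), ENNReal.ofReal_pow (by norm_num),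
      ENNReal.ofReal_ofNat, ENNReal.rpow_neg, ENNReal.rpow_natCast, div_eq_mul_inv]
  have hcardS : ∀ j, ((Sj j).card : ℝ≥0∞) ≤ Cd * 2 ^ msum k := by
    intro j
    simp only [Sj, Fintype.card_piFinset]
    push_cast
    have e4 : Cd * 2 ^ msum k = ∏ i, (ENNReal.ofReal C * (2 : ℝ≥0∞) ^ (k i : ℝ)) := by
      rw [Finset.prod_mul_distrib, ← two_rpow_sum]
      simp [hCd, msum]
    rw [e4]
    refine Finset.prod_le_prod' fun i _ => ?_
    rw [ENNReal.rpow_natCast, ← ENNReal.ofReal_natCast]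
    refine (ENNReal.ofReal_le_ofReal (hcard _ _)).trans (le_of_eq ?_)
    rw [ENNReal.ofReal_mul hC.le, ENNReal.ofReal_pow (by norm_num), ENNReal.ofReal_ofNat]
  have hpow : ∀ (j : Fin d → ℕ) (z : Fin d → ℝ), ‖tens f (fun i => T (k i) (j i) (z i))‖ₑ ^ P ≤
      A ^ P * (Cd * 2 ^ msum k) ^ M * ∑ o ∈ Sj j, G j (pt j o fun i => shift (m j i) (z i)) := by
    intro j z
    refine (ENNReal.rpow_le_rpow (hpiece j z) hPpos.le).trans ?_
    rw [ENNReal.mul_rpow_of_nonneg _ _ hPpos.le, mul_assoc]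
    gcongr
    refine (rpow_sum_le_card _ _ hPpos).trans ?_
    gcongr
    exact hcardS j
  have hz : ∀ z : Fin d → ℝ, X ^ P ≤ K₁ * ∑' j, (2 : ℝ≥0∞) ^ (P * η * msum j) *
      (A ^ P * (Cd * 2 ^ msum k) ^ M *
        ∑ o ∈ Sj j, G j (pt j o fun i => shift (m j i) (z i))) := by
    intro z
    refine (ENNReal.rpow_le_rpow (enorm_tens_le_tsum (hlim k z f hf)) hPpos.le).trans ?_
    refine (hK₁' _).trans ?_
    gcongr with j
    exact hpow j z
  have hmpt : ∀ j o, Measurable fun ζ : Fin d → ℝ => G j (pt j o ζ) := fun j o =>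
    (hG j).comp (by simp only [pt]; fun_prop)
  have hmsh : ∀ j, Measurable fun z : Fin d → ℝ => fun i => shift (m j i) (z i) := fun j =>
    measurable_pi_lambda _ fun i => (measurable_shift _).comp (measurable_pi_apply i)
  -- `X` is constant in `z` and the unit box has volume one. Integration turns each sum over lattice
  -- points into `2 ^ msum (m j)` times a power of `diffNorm`.
  have hint : X ^ P ≤ K₁ * ∑' j, (2 : ℝ≥0∞) ^ (P * η * msum j) *
      (A ^ P * (Cd * 2 ^ msum k) ^ M * (2 ^ msum (m j) *
        diffNorm r p f (diffDirs k₁ k j) (m j) ^ P)) := by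
    calc X ^ P = ∫⁻ _ in unitBox d, X ^ P := by
          rw [setLIntegral_const, volume_unitBox, mul_one]
      _ ≤ ∫⁻ z in unitBox d, K₁ * ∑' j, (2 : ℝ≥0∞) ^ (P * η * msum j) *
          (A ^ P * (Cd * 2 ^ msum k) ^ M *
            ∑ o ∈ Sj j, G j (pt j o fun i => shift (m j i) (z i))) := lintegral_mono hz
      _ = K₁ * ∑' j, (2 : ℝ≥0∞) ^ (P * η * msum j) * (A ^ P * (Cd * 2 ^ msum k) ^ M *
            ∑ o ∈ Sj j, ∫⁻ z in unitBox d, G j (pt j o fun i => shift (m j i) (z i))) := by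
          have hms : ∀ j, Measurable fun z : Fin d → ℝ =>
              ∑ o ∈ Sj j, G j (pt j o fun i => shift (m j i) (z i)) := fun j =>
            Finset.measurable_sum _ fun o _ => (hmpt j o).comp (hmsh j)
          rw [lintegral_const_mul _ (Measurable.tsum fun j =>
            ((hms j).const_mul _).const_mul _), lintegral_tsum fun j =>
            (((hms j).const_mul _).const_mul _).aemeasurable]
          congr 1
          refine tsum_congr fun j => ?_
          rw [lintegral_const_mul _ ((hms j).const_mul _), lintegral_const_mul _ (hms j),
            lintegral_finsetSum (Sj j)
              (f := fun o (z : Fin d → ℝ) => G j (pt j o fun i => shift (m j i) (z i)))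
              fun o _ => (hmpt j o).comp (hmsh j)]
      _ ≤ _ := by
          gcongr with j
          calc ∑ o ∈ Sj j, ∫⁻ z in unitBox d, G j (pt j o fun i => shift (m j i) (z i))
              = ∑ o ∈ Sj j, 2 ^ msum (m j) * ∫⁻ y in cell (m j) o, G j y := by
                refine Finset.sum_congr rfl fun o _ => ?_
                rw [lintegral_shift (m j) (fun ζ => G j (pt j o ζ)) (hmpt j o),
                  ← lintegral_cell (m j) o (G j) (hG j)]
            _ ≤ 2 ^ msum (m j) *
                ∫⁻ y in diffDomain r (diffDirs k₁ k j) (fun i => 1 / 2 ^ m j i), G j y := by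
                rw [← Finset.mul_sum]
                gcongr
                refine sum_lintegral_cell_le r _ (m j) _ (fun i o ho => ?_) (G j)
                have := hS (k i) (j i) o ho
                simpa only [diffDirs, Finset.mem_filter, Finset.mem_univ, true_and, m] using this
            _ = _ := by
                rw [diffNorm, eLpNorm_eq_lintegral_rpow_enorm_toReal hp0 hp, ← ENNReal.rpow_mul,
                  one_div_mul_cancel hPpos.ne', ENNReal.rpow_one]
  -- collect the powers of two
  have hgap : P * max (P⁻¹ - 1) 0 = 1 - P + M := by
    rw [hM, mul_max_of_nonneg _ _ hPpos.le, mul_sub, mul_inv_cancel₀ hPpos.ne']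
    rcases le_total P 1 with h | h
    · rw [max_eq_left (by linarith), max_eq_right (by linarith)]; ring
    · rw [max_eq_right (by linarith), max_eq_left (by linarith)]; ring
  -- The exponent of `msum k` is `-P` from the coefficients, `M` from the number of lattice points
  -- and `1` from the cell volumes; that of `msum j` is `P η` from the first exchange and `1` from
  -- the volumes.
  have hcollect : ∀ j : Fin d → ℕ, ∀ Y : ℝ≥0∞, (2 : ℝ≥0∞) ^ (P * η * msum j) *
      (A ^ P * (Cd * 2 ^ msum k) ^ M * (2 ^ msum (m j) * Y)) =
      (Cd ^ P * Cd ^ M * 2 ^ (d * k₀ : ℝ)) * 2 ^ (P * max (P⁻¹ - 1) 0 * msum k) *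
        ((2 : ℝ≥0∞) ^ ((P * η + 1) * msum j) * Y) := by
    intro j Y
    have e1 : msum (m j) = msum k + d * k₀ + msum j := by
      simp only [msum, m]
      push_cast
      rw [Finset.sum_add_distrib, Finset.sum_add_distrib]
      simp
    simp only [A]
    rw [ENNReal.mul_rpow_of_nonneg _ _ hPpos.le, ENNReal.mul_rpow_of_nonneg _ _ hM0, e1,
      ← ENNReal.rpow_mul, ← ENNReal.rpow_mul, two_rpow_add, two_rpow_add, hgap,
      show (1 - P + M) * msum k = msum k + -msum k * P + msum k * M by ring, two_rpow_add,
      two_rpow_add, add_mul, one_mul, two_rpow_add]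
    ring
  simp only [hcollect] at hint
  rw [ENNReal.tsum_mul_left] at hint
  have hfin := ENNReal.rpow_le_rpow hint (inv_pos.2 hPpos).le
  rw [← ENNReal.rpow_mul, mul_inv_cancel₀ hPpos.ne', ENNReal.rpow_one] at hfin
  refine hfin.trans ?_
  rw [← mul_assoc, ← mul_assoc, ← hK₃, ENNReal.mul_rpow_of_nonneg _ _ (inv_pos.2 hPpos).le,
    ENNReal.mul_rpow_of_nonneg _ _ (inv_pos.2 hPpos).le, ← ENNReal.rpow_mul,
    show P * max (P⁻¹ - 1) 0 * msum k * P⁻¹ = max (P⁻¹ - 1) 0 * msum k by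
      field_simp]
  calc _ ≤ K₃ ^ P⁻¹ * 2 ^ (max (P⁻¹ - 1) 0 * msum k) * (K₂ * ∑' j : Fin d → ℕ,
        (2 : ℝ≥0∞) ^ (η * msum j) * ((2 : ℝ≥0∞) ^ ((P * η + 1) * msum j) *
          diffNorm r p f (diffDirs k₁ k j) (m j) ^ P) ^ P⁻¹) := by
        gcongr
        exact hK₂' _
    _ = K₃ ^ P⁻¹ * K₂ * 2 ^ (max (P⁻¹ - 1) 0 * msum k) * ∑' j : Fin d → ℕ,
        (2 : ℝ≥0∞) ^ (η * msum j) * ((2 : ℝ≥0∞) ^ ((P * η + 1) * msum j) *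
          diffNorm r p f (diffDirs k₁ k j) (m j) ^ P) ^ P⁻¹ := by ring
    _ = _ := by
        congr 1
        refine tsum_congr fun j => ?_
        rw [ENNReal.mul_rpow_of_nonneg _ _ (inv_pos.2 hPpos).le, ← ENNReal.rpow_mul,
          ← ENNReal.rpow_mul, mul_inv_cancel₀ hPpos.ne', ENNReal.rpow_one, ← mul_assoc,
          ← two_rpow_add]
        congr 2
        have : β = η + (P * η + 1) * P⁻¹ := by
          rw [add_mul, mul_comm P η, mul_assoc, mul_inv_cancel₀ hPpos.ne', hη]; ring
        rw [this]; ring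

/-! ### Discretization of the Besov quasi-norm -/

lemma diffNorm_le_modulus {d : ℕ} (r : ℕ) (p : ℝ≥0∞) (f : (Fin d → ℝ) → ℝ) (e : Finset (Fin d))
    (m : Fin d → ℕ) (t : Fin d → ℝ) (ht : ∀ i ∈ e, 1 / 2 ^ m i < t i) :
    diffNorm r p f e m ≤ modulus r e p f t := by
  refine le_iSup₂_of_le (fun i => 1 / 2 ^ m i) (fun i hi => ?_) le_rfl
  rw [abs_of_nonneg (by positivity)]
  exact ht i hi

/-- The box `∏ (2 ^ (-n_i - 1), 2 ^ (-n_i)]`. -/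
def dyadicBox {d : ℕ} (n : Fin d → ℕ) : Set (Fin d → ℝ) :=
  Set.univ.pi fun i => Set.Ioc ((1 / 2 : ℝ) ^ (n i + 1)) ((1 / 2) ^ n i)

lemma dyadicBox_disjoint {d : ℕ} :
    Pairwise (Function.onFun Disjoint (dyadicBox : (Fin d → ℕ) → Set (Fin d → ℝ))) := by
  have key : ∀ (a b : ℕ) (x : ℝ), x ∈ Set.Ioc ((1 / 2 : ℝ) ^ (a + 1)) ((1 / 2) ^ a) →
      x ∈ Set.Ioc ((1 / 2 : ℝ) ^ (b + 1)) ((1 / 2) ^ b) → b ≤ a := by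
    intro a b x ha hb
    by_contra h
    push Not at h
    have h1 : (1 / 2 : ℝ) ^ b ≤ (1 / 2) ^ (a + 1) :=
      pow_le_pow_of_le_one (by norm_num) (by norm_num) h
    linarith [ha.1, hb.2]
  intro n n' hnn
  rw [Function.onFun, Set.disjoint_left]
  intro t ht ht'
  apply hnn
  funext i
  exact le_antisymm (key _ _ _ (ht' i trivial) (ht i trivial))
    (key _ _ _ (ht i trivial) (ht' i trivial))

lemma measurableSet_dyadicBox {d : ℕ} (n : Fin d → ℕ) : MeasurableSet (dyadicBox n) :=
  MeasurableSet.univ_pi fun _ => measurableSet_Ioc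

lemma dyadicBox_subset_cube {d : ℕ} (n : Fin d → ℕ) : dyadicBox n ⊆ cube d := by
  intro t ht
  refine ⟨fun i => ?_, fun i => ?_⟩
  · exact le_trans (by simp only [Pi.zero_apply]; positivity) (ht i trivial).1.le
  · exact (ht i trivial).2.trans (pow_le_one₀ (by norm_num) (by norm_num))

lemma volume_dyadicBox {d : ℕ} (n : Fin d → ℕ) :
    volume (dyadicBox n) = (2 : ℝ≥0∞) ^ (-∑ i, ((n i : ℝ) + 1)) := by
  rw [dyadicBox, Real.volume_pi_Ioc, ← Finset.sum_neg_distrib, two_rpow_sum]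
  refine Finset.prod_congr rfl fun i _ => ?_
  rw [show ((1 : ℝ) / 2) ^ n i - (1 / 2) ^ (n i + 1) = (2 ^ (n i + 1))⁻¹ by
    rw [pow_succ, one_div, inv_pow, pow_succ]; field_simp; norm_num,
    ENNReal.ofReal_inv_of_pos (by positivity), ENNReal.ofReal_pow (by norm_num),
    ENNReal.ofReal_ofNat, ENNReal.rpow_neg, ← Nat.cast_succ, ENNReal.rpow_natCast]

lemma ofReal_half_pow_rpow (n : ℕ) (s : ℝ) :
    ENNReal.ofReal (((1 / 2 : ℝ) ^ n) ^ s) = (2 : ℝ≥0∞) ^ (-(s * n)) := by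
  rw [← ENNReal.ofReal_rpow_of_pos (by positivity), ENNReal.ofReal_pow (by norm_num), one_div,
    ENNReal.ofReal_inv_of_pos (by norm_num), ENNReal.ofReal_ofNat, ← ENNReal.rpow_natCast,
    ← ENNReal.rpow_neg_one, ← ENNReal.rpow_mul, ← ENNReal.rpow_mul]
  congr 1; ring

/-- The weighted norm of the mixed difference with step `2 ^ (-n - 1)`. -/
def weightedDiff {d : ℕ} (r : ℕ) (a : Fin d → ℝ) (p : ℝ≥0∞) (f : (Fin d → ℝ) → ℝ)
    (e : Finset (Fin d)) (n : Fin d → ℕ) : ℝ≥0∞ :=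
  diffNorm r p f e (fun i => n i + 1) * 2 ^ (∑ i ∈ e, a i * n i)

/-- The modulus admits steps strictly smaller than `t i`. Every point of the box satisfies `t i > 2
^ (-n i - 1)`, which is the reason for the step used in `weightedDiff`. -/
lemma weightedDiff_le_of_mem_box {d : ℕ} (r : ℕ) {a : Fin d → ℝ} (ha : ∀ i, 0 < a i) (p : ℝ≥0∞)
    (f : (Fin d → ℝ) → ℝ) (e : Finset (Fin d)) (n : Fin d → ℕ) (t : Fin d → ℝ)
    (ht : t ∈ dyadicBox n) :
    weightedDiff r a p f e n ≤ modulus r e p f t / ENNReal.ofReal (∏ i ∈ e, t i ^ a i) := by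
  have h1 : diffNorm r p f e (fun i => n i + 1) ≤ modulus r e p f t := by
    refine diffNorm_le_modulus r p f e _ t fun i _ => ?_
    have := (ht i trivial).1
    rwa [one_div_pow] at this
  have h2 : ENNReal.ofReal (∏ i ∈ e, t i ^ a i) ≤ 2 ^ (-∑ i ∈ e, a i * n i) := by
    have hpos : ∀ i, 0 < t i := fun i => lt_trans (by positivity) (ht i trivial).1
    rw [ENNReal.ofReal_prod_of_nonneg fun i _ => Real.rpow_nonneg (hpos i).le _,
      ← Finset.sum_neg_distrib, two_rpow_sum]
    refine Finset.prod_le_prod' fun i _ => ?_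
    rw [← ofReal_half_pow_rpow]
    exact ENNReal.ofReal_le_ofReal
      (Real.rpow_le_rpow (hpos i).le (ht i trivial).2 (ha i).le)
  rw [div_eq_mul_inv]
  refine mul_le_mul' h1 ?_
  rw [← neg_neg (∑ i ∈ e, a i * (n i : ℝ)), ENNReal.rpow_neg]
  exact ENNReal.inv_le_inv.2 h2

lemma half_pow_mem_dyadicBox {d : ℕ} (n : Fin d → ℕ) :
    (fun i => (1 / 2 : ℝ) ^ n i) ∈ dyadicBox n := fun i _ =>
  ⟨pow_lt_pow_right_of_lt_one₀ (by norm_num) (by norm_num) (Nat.lt_succ_self _), le_rfl⟩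

lemma weightedDiff_le_one_of_top {d : ℕ} (r : ℕ) {a : Fin d → ℝ} (ha : ∀ i, 0 < a i) (p : ℝ≥0∞)
    (f : (Fin d → ℝ) → ℝ) (e : Finset (Fin d)) (hf : besovSeminorm r a p ∞ e f ≤ 1)
    (n : Fin d → ℕ) : weightedDiff r a p f e n ≤ 1 := by
  refine (weightedDiff_le_of_mem_box r ha p f e n _ (half_pow_mem_dyadicBox n)).trans ?_
  refine le_trans ?_ hf
  rw [besovSeminorm, if_pos rfl]
  exact le_iSup₂_of_le _ (dyadicBox_subset_cube n (half_pow_mem_dyadicBox n)) le_rfl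

/-- Integration over the disjoint dyadic boxes. In the directions of `e` the measure `dt / t` gives
each box comparable mass; in the others there is only Lebesgue measure, whence the factor `2 ^ (-n
i)` for `i ∉ e`. -/
lemma tsum_weightedDiff_le {d : ℕ} (r : ℕ) {a : Fin d → ℝ} (ha : ∀ i, 0 < a i) (p : ℝ≥0∞)
    {θ : ℝ≥0∞} (hθ0 : θ ≠ 0) (hθ : θ ≠ ∞) (f : (Fin d → ℝ) → ℝ) (e : Finset (Fin d))
    (hf : besovSeminorm r a p θ e f ≤ 1) :
    ∑' n : Fin d → ℕ, weightedDiff r a p f e n ^ θ.toReal * 2 ^ (-∑ i ∈ eᶜ, (n i : ℝ)) ≤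
      2 ^ (d : ℝ) := by
  have hΘ : 0 < θ.toReal := ENNReal.toReal_pos hθ0 hθ
  rw [besovSeminorm, if_neg hθ] at hf
  have hint : ∫⁻ t in cube d, (modulus r e p f t / ENNReal.ofReal (∏ i ∈ e, t i ^ a i)) ^ θ.toReal *
      ENNReal.ofReal (∏ i ∈ e, (t i)⁻¹) ≤ 1 := by
    by_contra h
    push Not at h
    exact absurd hf (not_le.2 (ENNReal.one_lt_rpow h (one_div_pos.2 hΘ)))
  have hbox : ∀ n : Fin d → ℕ, (2 : ℝ≥0∞) ^ (-(d : ℝ)) *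
      (weightedDiff r a p f e n ^ θ.toReal * 2 ^ (-∑ i ∈ eᶜ, (n i : ℝ))) ≤
      ∫⁻ t in dyadicBox n, (modulus r e p f t / ENNReal.ofReal (∏ i ∈ e, t i ^ a i)) ^ θ.toReal *
        ENNReal.ofReal (∏ i ∈ e, (t i)⁻¹) := by
    intro n
    calc _ = ∫⁻ _ in dyadicBox n, weightedDiff r a p f e n ^ θ.toReal *
          2 ^ (∑ i ∈ e, (n i : ℝ)) := by
          rw [setLIntegral_const, volume_dyadicBox, mul_assoc, ← two_rpow_add]
          have : ∑ i ∈ e, (n i : ℝ) + -∑ i, ((n i : ℝ) + 1) = -(d : ℝ) + -∑ i ∈ eᶜ, (n i : ℝ) := by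
            rw [Finset.sum_add_distrib, ← Finset.sum_add_sum_compl e]; simp; ring
          rw [this, two_rpow_add]; ring
      _ ≤ _ := by
          refine setLIntegral_mono' (measurableSet_dyadicBox n) fun t ht => ?_
          have hpos : ∀ i, 0 < t i := fun i => lt_trans (by positivity) (ht i trivial).1
          refine mul_le_mul' (ENNReal.rpow_le_rpow
            (weightedDiff_le_of_mem_box r ha p f e n t ht) hΘ.le) ?_
          rw [ENNReal.ofReal_prod_of_nonneg fun i _ => (inv_pos.2 (hpos i)).le, two_rpow_sum]
          refine Finset.prod_le_prod' fun i _ => ?_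
          rw [ENNReal.rpow_natCast, ← ENNReal.ofReal_ofNat, ← ENNReal.ofReal_pow (by norm_num)]
          refine ENNReal.ofReal_le_ofReal ?_
          have h1 := (ht i trivial).2
          rw [one_div_pow, one_div] at h1
          rw [← inv_inv ((2 : ℝ) ^ n i)]
          exact (inv_le_inv₀ (by positivity) (hpos i)).2 h1
  have hsum := ENNReal.tsum_le_tsum hbox
  rw [ENNReal.tsum_mul_left, ← lintegral_iUnion measurableSet_dyadicBox dyadicBox_disjoint] at hsum
  have h1 := (hsum.trans (lintegral_mono_set (Set.iUnion_subset dyadicBox_subset_cube))).trans hint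
  calc _ = 2 ^ (d : ℝ) * ((2 : ℝ≥0∞) ^ (-(d : ℝ)) * ∑' n : Fin d → ℕ,
        weightedDiff r a p f e n ^ θ.toReal * 2 ^ (-∑ i ∈ eᶜ, (n i : ℝ))) := by
        rw [← mul_assoc, ← two_rpow_add, add_neg_cancel, ENNReal.rpow_zero, one_mul]
    _ ≤ 2 ^ (d : ℝ) * 1 := by gcongr
    _ = _ := mul_one _

open Classical in
/-- `weightedDiff`, restricted to multi-indices bounded by `N` outside of `e`. -/
def cutDiff {d : ℕ} (r : ℕ) (a : Fin d → ℝ) (p : ℝ≥0∞) (f : (Fin d → ℝ) → ℝ) (N : ℕ)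
    (e : Finset (Fin d)) (n : Fin d → ℕ) : ℝ≥0∞ :=
  if ∀ i ∉ e, n i ≤ N then weightedDiff r a p f e n else 0

/-- Bounding the indices outside `e` by `N` makes the loss in those directions a constant. What
remains is the passage from `ℓ_θ` to `ℓ_∞`, and to `ℓ_1` when `θ ≤ 1`. -/
lemma cutDiff_bounds {d : ℕ} (r : ℕ) {a : Fin d → ℝ} (ha : ∀ i, 0 < a i) (p : ℝ≥0∞)
    {θ : ℝ≥0∞} (hθ0 : θ ≠ 0) (N : ℕ) : ∃ B : ℝ≥0∞, B ≠ ∞ ∧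
      ∀ f : (Fin d → ℝ) → ℝ, besovNorm r a p θ f ≤ 1 → ∀ e : Finset (Fin d),
        (∀ n, cutDiff r a p f N e n ≤ B) ∧ (θ ≤ 1 → ∑' n, cutDiff r a p f N e n ≤ B) := by
  have hsemi : ∀ f : (Fin d → ℝ) → ℝ, besovNorm r a p θ f ≤ 1 → ∀ e : Finset (Fin d),
      besovSeminorm r a p θ e f ≤ 1 := fun f hf e =>
    (Finset.single_le_sum (fun _ _ => zero_le) (Finset.mem_univ e)).trans hf
  by_cases hθ : θ = ∞
  · subst hθ
    refine ⟨1, by simp, fun f hf e => ⟨fun n => ?_, fun h => by simp at h⟩⟩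
    unfold cutDiff
    split_ifs
    · exact weightedDiff_le_one_of_top r ha p f e (hsemi f hf e) n
    · exact zero_le
  have hΘ : 0 < θ.toReal := ENNReal.toReal_pos hθ0 hθ
  set Θ := θ.toReal with hΘdef
  set C : ℝ≥0∞ := 2 ^ (d * N + d : ℝ) with hC
  have hCtop : C ≠ ∞ := two_rpow_ne_top _
  have hCz : C ≠ 0 := two_rpow_ne_zero _
  have hsum : ∀ f : (Fin d → ℝ) → ℝ, besovNorm r a p θ f ≤ 1 → ∀ e : Finset (Fin d),
      ∑' n, cutDiff r a p f N e n ^ Θ ≤ C := by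
    intro f hf e
    calc _ ≤ ∑' n : Fin d → ℕ, 2 ^ (d * N : ℝ) *
          (weightedDiff r a p f e n ^ Θ * 2 ^ (-∑ i ∈ eᶜ, (n i : ℝ))) := by
          refine ENNReal.tsum_le_tsum fun n => ?_
          unfold cutDiff
          split_ifs with hn
          · rw [mul_left_comm, ← two_rpow_add]
            refine le_mul_of_one_le_right (zero_le) ?_
            rw [← ENNReal.rpow_zero (x := 2)]
            refine two_rpow_le_two_rpow ?_
            have : ∑ i ∈ eᶜ, (n i : ℝ) ≤ d * N := by
              calc _ ≤ ∑ i ∈ eᶜ, (N : ℝ) := Finset.sum_le_sum fun i hi => by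
                    exact_mod_cast hn i (Finset.mem_compl.1 hi)
                _ = (eᶜ.card : ℝ) * N := by rw [Finset.sum_const, nsmul_eq_mul]
                _ ≤ d * N := by
                    refine mul_le_mul_of_nonneg_right ?_ (Nat.cast_nonneg _)
                    have := Finset.card_le_univ eᶜ
                    rw [Fintype.card_fin] at this
                    exact_mod_cast this
            linarith
          · rw [ENNReal.zero_rpow_of_pos hΘ]; exact zero_le
      _ ≤ 2 ^ (d * N : ℝ) * 2 ^ (d : ℝ) := by
          rw [ENNReal.tsum_mul_left]
          gcongr
          exact tsum_weightedDiff_le r ha p hθ0 hθ f e (hsemi f hf e)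
      _ = C := by rw [← two_rpow_add]
  set B := C ^ (1 / Θ) with hB
  have hBtop : B ≠ ∞ := ENNReal.rpow_ne_top_of_nonneg (one_div_pos.2 hΘ).le hCtop
  have hBz : B ≠ 0 := by
    rw [hB, ne_eq, ENNReal.rpow_eq_zero_iff]
    push Not
    exact ⟨fun h => absurd h hCz, fun h => absurd h hCtop⟩
  have hbd : ∀ f : (Fin d → ℝ) → ℝ, besovNorm r a p θ f ≤ 1 → ∀ e : Finset (Fin d),
      ∀ n, cutDiff r a p f N e n ≤ B := by
    intro f hf e n
    have h1 := (ENNReal.le_tsum n).trans (hsum f hf e)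
    have h2 := ENNReal.rpow_le_rpow h1 (one_div_pos.2 hΘ).le
    rwa [← ENNReal.rpow_mul, mul_one_div_cancel hΘ.ne', ENNReal.rpow_one] at h2
  refine ⟨B, hBtop, fun f hf e => ⟨hbd f hf e, fun hθ1 => ?_⟩⟩
  have hΘ1 : Θ ≤ 1 := by
    rw [hΘdef, ← ENNReal.toReal_one]
    exact ENNReal.toReal_mono (by simp) hθ1
  have hB1 : B ^ Θ = C := by
    rw [hB, ← ENNReal.rpow_mul, one_div_mul_cancel hΘ.ne', ENNReal.rpow_one]
  -- `ℓ_θ ⊆ ℓ_1`: after division by the bound `B` all terms are at most one, and lowering the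
  -- exponent from `1` to `Θ` only increases them.
  calc ∑' n, cutDiff r a p f N e n ≤ ∑' n, B * C⁻¹ * cutDiff r a p f N e n ^ Θ := by
        refine ENNReal.tsum_le_tsum fun n => ?_
        set x := cutDiff r a p f N e n
        have h1 : x / B ≤ 1 := ENNReal.div_le_of_le_mul (by rw [one_mul]; exact hbd f hf e n)
        have h2 : x / B ≤ (x / B) ^ Θ := by
          simpa using ENNReal.rpow_le_rpow_of_exponent_ge h1 hΘ1
        rw [ENNReal.div_rpow_of_nonneg _ _ hΘ.le, hB1] at h2
        calc x = B * (x / B) := (ENNReal.mul_div_cancel hBz hBtop).symm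
          _ ≤ B * (x ^ Θ / C) := by gcongr
          _ = _ := by rw [div_eq_mul_inv]; ring
    _ ≤ B * C⁻¹ * C := by
        rw [ENNReal.tsum_mul_left]
        gcongr
        exact hsum f hf e
    _ = B := by rw [mul_assoc, ENNReal.inv_mul_cancel hCz hCtop, mul_one]

/-- Bounds of the functionals `∫ q_k` on the unit ball of the Besov space, for `p < ∞`. -/
lemma levelFun_bounds_of_ne_top {r μ : ℕ} {lam : ℤ → ℝ} (hQ : IsQuasiInterpolation r μ lam)
    (hr : 0 < r) {d : ℕ} {a : Fin d → ℝ} {a₀ : ℝ} {p' p θ : ℝ≥0∞} (hp' : p' ≠ 0)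
    (hp'top : p' ≠ ∞) (ha₀ : p'⁻¹.toReal < a₀) (ha : ∀ i, a₀ ≤ a i) (hθ : θ ≠ 0)
    (hpp : ∀ f : (Fin d → ℝ) → ℝ, ContinuousOn f (cube d) → ∀ e m,
      diffNorm r p' f e m ≤ diffNorm r p f e m) :
    ∃ B : ℝ≥0∞, B ≠ ∞ ∧ ∀ f ∈ besovBall (d := d) r a p θ,
      (∀ k : Fin d → ℕ, ‖tens f (fun i => levelFun r μ lam (k i))‖ₑ ≤
        B * 2 ^ (-(∑ i, a i * (k i : ℝ) - max (p'⁻¹.toReal - 1) 0 * msum k))) ∧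
      (θ ≤ 1 → ∑' k : Fin d → ℕ, 2 ^ (∑ i, a i * (k i : ℝ) - max (p'⁻¹.toReal - 1) 0 * msum k) *
        ‖tens f (fun i => levelFun r μ lam (k i))‖ₑ ≤ B) := by
  classical
  have hapos : ∀ i, 0 < a i := fun i =>
    lt_of_le_of_lt ENNReal.toReal_nonneg (ha₀.trans_le (ha i))
  obtain ⟨k₀, k₁, hk₀, hmain⟩ := enorm_tens_levelFun_le hQ hr d
  -- The midpoint leaves room on both sides: `β > 1/p'` for the averaging estimate, `β < a₀` for the
  -- convergence over `j`.
  set β := (p'⁻¹.toReal + a₀) / 2 with hβ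
  obtain ⟨K, hK, hmain⟩ := hmain p' hp' hp'top β (by rw [hβ]; linarith)
  set g := max (p'⁻¹.toReal - 1) 0 with hg
  set δ := a₀ - β with hδ
  have hδpos : 0 < δ := by rw [hδ, hβ]; linarith
  -- Where no difference is taken, `k i < k₁` and `j i = 0`, so the index `nn k j i` stays below
  -- `N`.
  set N := k₀ + k₁ with hN
  obtain ⟨B, hB, hcut⟩ := cutDiff_bounds (θ := θ) r hapos p hθ N
  set E : ℝ≥0∞ := ((Fintype.card (Finset (Fin d)) : ℕ) : ℝ≥0∞) with hE
  set L : ℝ≥0∞ := 2 ^ (N * ∑ i, a i) with hL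
  -- Summing over all `e` removes the dependence of the set of directions on `k` and `j`.
  let U : ((Fin d → ℝ) → ℝ) → (Fin d → ℕ) → ℝ≥0∞ := fun f n =>
    L * ∑ e : Finset (Fin d), cutDiff r a p f N e n
  set S := ∑' j : Fin d → ℕ, (2 : ℝ≥0∞) ^ (-(δ * msum j)) with hS
  have hStop : S ≠ ∞ := tsum_msum_ne_top hδpos
  have hU1 : ∀ f ∈ besovBall (d := d) r a p θ, ∀ n, U f n ≤ L * (E * B) := by
    intro f hf n
    simp only [U]
    gcongr
    refine (Finset.sum_le_card_nsmul _ _ B fun e _ => (hcut f hf.2 e).1 n).trans ?_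
    rw [nsmul_eq_mul, Finset.card_univ]
  have hU2 : ∀ f ∈ besovBall (d := d) r a p θ, θ ≤ 1 → ∑' n, U f n ≤ L * (E * B) := by
    intro f hf h1
    simp only [U]
    rw [ENNReal.tsum_mul_left]
    gcongr
    rw [Summable.tsum_finsetSum fun _ _ => ENNReal.summable]
    refine (Finset.sum_le_card_nsmul _ _ B fun e _ => (hcut f hf.2 e).2 h1).trans ?_
    rw [nsmul_eq_mul, Finset.card_univ]
  -- The step `2 ^ (-(k + k₀ + j))` is the step `2 ^ (-n - 1)` of `weightedDiff` for this `n`; this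
  -- is where `1 ≤ k₀` is needed.
  let nn : (Fin d → ℕ) → (Fin d → ℕ) → Fin d → ℕ := fun k j i => k i + (k₀ - 1) + j i
  have hdiff : ∀ f ∈ besovBall (d := d) r a p θ, ∀ k j : Fin d → ℕ,
      diffNorm r p' f (diffDirs k₁ k j) (fun i => k i + k₀ + j i) ≤
        2 ^ (-∑ i, a i * (k i : ℝ)) * 2 ^ (-∑ i, a i * (j i : ℝ)) * U f (nn k j) := by
    intro f hf k j
    set e := diffDirs k₁ k j with he
    have hout : ∀ i ∉ e, nn k j i ≤ N := by
      intro i hi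
      simp only [he, diffDirs, Finset.mem_filter, Finset.mem_univ, true_and, not_or, not_le,
        not_lt] at hi
      simp only [nn]
      omega
    have hnn : (fun i => k i + k₀ + j i) = fun i => nn k j i + 1 := by
      funext i; simp only [nn]; omega
    refine (hpp f hf.1 _ _).trans ?_
    rw [hnn]
    have h1 : weightedDiff r a p f e (nn k j) ≤
        ∑ e : Finset (Fin d), cutDiff r a p f N e (nn k j) := by
      have := Finset.single_le_sum (f := fun e => cutDiff r a p f N e (nn k j))
        (fun _ _ => zero_le) (Finset.mem_univ e)
      rwa [cutDiff, if_pos hout] at this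
    have h2 : (1 : ℝ≥0∞) ≤ 2 ^ (-∑ i, a i * (k i : ℝ)) * 2 ^ (-∑ i, a i * (j i : ℝ)) * L *
        2 ^ (∑ i ∈ e, a i * (nn k j i : ℝ)) := by
      rw [hL, ← two_rpow_add, ← two_rpow_add, ← two_rpow_add, ← ENNReal.rpow_zero (x := 2)]
      refine two_rpow_le_two_rpow ?_
      have h3 : ∑ i, a i * (nn k j i : ℝ) ≤ ∑ i ∈ e, a i * (nn k j i : ℝ) + N * ∑ i, a i := by
        rw [← Finset.sum_add_sum_compl e]
        gcongr
        calc ∑ i ∈ eᶜ, a i * (nn k j i : ℝ) ≤ ∑ i ∈ eᶜ, a i * N := by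
              refine Finset.sum_le_sum fun i hi => mul_le_mul_of_nonneg_left ?_ (hapos i).le
              exact_mod_cast hout i (Finset.mem_compl.1 hi)
          _ ≤ ∑ i, a i * N := Finset.sum_le_sum_of_subset_of_nonneg (Finset.subset_univ _)
              fun i _ _ => mul_nonneg (hapos i).le (Nat.cast_nonneg _)
          _ = N * ∑ i, a i := by rw [← Finset.sum_mul, mul_comm]
      have h4 : ∑ i, a i * (k i : ℝ) + ∑ i, a i * (j i : ℝ) ≤ ∑ i, a i * (nn k j i : ℝ) := by
        rw [← Finset.sum_add_distrib]
        refine Finset.sum_le_sum fun i _ => ?_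
        rw [← mul_add]
        refine mul_le_mul_of_nonneg_left ?_ (hapos i).le
        simp only [nn]; push_cast
        have : (0 : ℝ) ≤ ((k₀ - 1 : ℕ) : ℝ) := Nat.cast_nonneg _
        linarith
      linarith
    calc diffNorm r p f e (fun i => nn k j i + 1) ≤ diffNorm r p f e (fun i => nn k j i + 1) *
          (2 ^ (-∑ i, a i * (k i : ℝ)) * 2 ^ (-∑ i, a i * (j i : ℝ)) * L *
          2 ^ (∑ i ∈ e, a i * (nn k j i : ℝ))) := le_mul_of_one_le_right (zero_le) h2
      _ = 2 ^ (-∑ i, a i * (k i : ℝ)) * 2 ^ (-∑ i, a i * (j i : ℝ)) *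
          (L * weightedDiff r a p f e (nn k j)) := by unfold weightedDiff; ring
      _ ≤ _ := by simp only [U]; gcongr
  have hkey : ∀ f ∈ besovBall (d := d) r a p θ, ∀ k : Fin d → ℕ,
      ‖tens f (fun i => levelFun r μ lam (k i))‖ₑ ≤
        K * 2 ^ (-(∑ i, a i * (k i : ℝ) - g * msum k)) *
          ∑' j : Fin d → ℕ, 2 ^ (-(δ * msum j)) * U f (nn k j) := by
    intro f hf k
    refine (hmain f hf.1 k).trans ?_
    calc _ ≤ K * 2 ^ (g * msum k) * ∑' j : Fin d → ℕ, 2 ^ (-∑ i, a i * (k i : ℝ)) *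
          (2 ^ (-(δ * msum j)) * U f (nn k j)) := by
          refine mul_le_mul_right (ENNReal.tsum_le_tsum fun j => ?_) _
          refine (mul_le_mul_right (hdiff f hf k j) _).trans ?_
          calc _ = 2 ^ (-∑ i, a i * (k i : ℝ)) * (2 ^ (β * msum j) *
                2 ^ (-∑ i, a i * (j i : ℝ)) * U f (nn k j)) := by ring
            _ ≤ _ := by
                gcongr
                rw [← two_rpow_add]
                refine two_rpow_le_two_rpow ?_
                have : a₀ * msum j ≤ ∑ i, a i * (j i : ℝ) := by
                  rw [msum, Finset.mul_sum]
                  exact Finset.sum_le_sum fun i _ =>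
                    mul_le_mul_of_nonneg_right (ha i) (Nat.cast_nonneg _)
                rw [hδ, sub_mul]; linarith
      _ = _ := by
          rw [ENNReal.tsum_mul_left, neg_sub, sub_eq_add_neg, two_rpow_add]; ring
  refine ⟨K * (S * (L * (E * B))), ?_, fun f hf => ⟨fun k => ?_, fun h1 => ?_⟩⟩
  · refine ENNReal.mul_ne_top hK (ENNReal.mul_ne_top hStop (ENNReal.mul_ne_top
      (two_rpow_ne_top _) (ENNReal.mul_ne_top (by simp [hE]) hB)))
  · refine (hkey f hf k).trans ?_
    calc _ ≤ K * 2 ^ (-(∑ i, a i * (k i : ℝ) - g * msum k)) *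
          ∑' j : Fin d → ℕ, 2 ^ (-(δ * msum j)) * (L * (E * B)) := by
          gcongr with j
          exact hU1 f hf _
      _ = _ := by rw [ENNReal.tsum_mul_right]; ring
  · calc _ ≤ ∑' k : Fin d → ℕ, K * ∑' j : Fin d → ℕ, 2 ^ (-(δ * msum j)) * U f (nn k j) := by
          refine ENNReal.tsum_le_tsum fun k => ?_
          refine (mul_le_mul_right (hkey f hf k) _).trans (le_of_eq ?_)
          rw [← mul_assoc, mul_left_comm, ← two_rpow_add, add_neg_cancel, ENNReal.rpow_zero,
            mul_one]
      _ = K * ∑' j : Fin d → ℕ, 2 ^ (-(δ * msum j)) * ∑' k, U f (nn k j) := by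
          rw [ENNReal.tsum_mul_left, ENNReal.tsum_comm]
          simp only [ENNReal.tsum_mul_left]
      _ ≤ K * ∑' j : Fin d → ℕ, 2 ^ (-(δ * msum j)) * (L * (E * B)) := by
          gcongr with j
          -- For fixed `j` the map `k ↦ nn k j` is a translation, so the sum over `k` is part of the
          -- full sum of `U f`.
          refine (ENNReal.tsum_comp_le_tsum_of_injective (f := fun k => nn k j)
            (fun k k' h => ?_) (U f)).trans (hU2 f hf h1)
          funext i
          have := congrFun h i
          simp only [nn] at this
          omega
      _ = _ := by rw [ENNReal.tsum_mul_right]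

lemma diffNorm_mono_top {d : ℕ} (r : ℕ) (p : ℝ≥0∞) {f : (Fin d → ℝ) → ℝ}
    (hf : ContinuousOn f (cube d)) (e : Finset (Fin d)) (m : Fin d → ℕ) :
    diffNorm r p f e m ≤ diffNorm r ∞ f e m := by
  obtain ⟨f', hf', hff⟩ := exists_continuous_extension hf
  rw [diffNorm_congr r p hff, diffNorm_congr r ∞ hff]
  refine (eLpNorm_le_eLpNorm_mul_rpow_measure_univ le_top
    (continuous_mixedDiff r e _ hf').aestronglyMeasurable).trans ?_
  refine mul_le_of_le_one_right (zero_le) ?_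
  refine ENNReal.rpow_le_one ?_ (by simp)
  rw [Measure.restrict_apply_univ, ← volume_cube d]
  exact measure_mono fun x hx => hx.1

/-- Bounds of the functionals `∫ q_k` on the unit ball of the Besov space. -/
theorem levelFun_bounds {r μ : ℕ} {lam : ℤ → ℝ} (hQ : IsQuasiInterpolation r μ lam)
    (hr : 0 < r) {d : ℕ} {a : Fin d → ℝ} {a₀ : ℝ} {p θ : ℝ≥0∞} (hp : p ≠ 0)
    (ha₀ : p⁻¹.toReal < a₀) (ha : ∀ i, a₀ ≤ a i) (hθ : θ ≠ 0) :
    ∃ B : ℝ≥0∞, B ≠ ∞ ∧ ∀ f ∈ besovBall (d := d) r a p θ,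
      (∀ k : Fin d → ℕ, ‖tens f (fun i => levelFun r μ lam (k i))‖ₑ ≤
        B * 2 ^ (-(∑ i, a i * (k i : ℝ) - max (p⁻¹.toReal - 1) 0 * msum k))) ∧
      (θ ≤ 1 → ∑' k : Fin d → ℕ, 2 ^ (∑ i, a i * (k i : ℝ) - max (p⁻¹.toReal - 1) 0 * msum k) *
        ‖tens f (fun i => levelFun r μ lam (k i))‖ₑ ≤ B) := by
  by_cases hptop : p = ∞
  · subst hptop
    simp only [ENNReal.inv_top, ENNReal.toReal_zero] at ha₀
    -- For `p = ∞` a finite exponent `n + 1` with `1 / (n + 1) < a₀` does: the cube has measure one,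
    -- so its quasi-norms are smaller, and being at least `1` it also has `(1/p' - 1)_+ = 0`.
    obtain ⟨n, hn⟩ := exists_nat_one_div_lt ha₀
    have h1 : ((n + 1 : ℕ) : ℝ≥0∞)⁻¹.toReal = 1 / ((n : ℝ) + 1) := by
      rw [ENNReal.toReal_inv, ENNReal.toReal_natCast]; push_cast; rw [one_div]
    have h2 := levelFun_bounds_of_ne_top (θ := θ) (a := a) (p := ∞) hQ hr
      (p' := ((n + 1 : ℕ) : ℝ≥0∞)) (by simp) (by simp) (by rw [h1]; exact hn) ha hθ
      fun f hf e m => diffNorm_mono_top r _ hf e m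
    have h3 : 1 / ((n : ℝ) + 1) ≤ 1 := by
      rw [div_le_one (by positivity)]
      linarith [(Nat.cast_nonneg n : (0 : ℝ) ≤ n)]
    rw [h1, max_eq_right (by linarith)] at h2
    simpa using h2
  · exact levelFun_bounds_of_ne_top hQ hr hp hptop ha₀ ha hθ fun _ _ _ _ => le_rfl

/-! ### The sampling operators and the cubature formulas they generate -/

/-- The multi-indices `s` with `s_i ≤ 2 ^ k_i`. -/
def sampleIndex {d : ℕ} (k : Fin d → ℕ) : Finset (Fin d → ℕ) :=
  Fintype.piFinset fun i => Finset.range (2 ^ k i + 1)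

lemma mem_sampleIndex {d : ℕ} {k s : Fin d → ℕ} : s ∈ sampleIndex k ↔ ∀ i, s i ≤ 2 ^ k i := by
  simp [sampleIndex]

lemma mixedLevelOp_eq {d : ℕ} (r μ : ℕ) (lam : ℤ → ℝ) (k : Fin d → ℕ) (f : (Fin d → ℝ) → ℝ)
    (x : Fin d → ℝ) : mixedLevelOp r μ lam k f x =
      ∑ s ∈ sampleIndex k, (∏ i, levelCoef r μ lam (k i) (s i) (x i)) * f (gridPoint k s) := by
  rw [mixedLevelOp, tensorOp_eq_tens _ f x (fun i => ∑ s ∈ Finset.range (2 ^ k i + 1),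
    levelCoef r μ lam (k i) s (x i) • Finsupp.single ((s : ℝ) / 2 ^ k i) 1) ?_, tens_rep]
  · rfl
  · intro i g
    rw [linearCombination_rep, levelOp_eq]

lemma gridPoint_injective {d : ℕ} (k : Fin d → ℕ) : Function.Injective (gridPoint k) := by
  intro s s' h
  funext i
  have h1 := congrFun h i
  simp only [gridPoint] at h1
  rw [div_left_inj' (by positivity)] at h1
  exact_mod_cast h1

lemma sampleFun_eq {d : ℕ} (r μ : ℕ) (lam : ℤ → ℝ) (k s : Fin d → ℕ) (hs : s ∈ sampleIndex k)
    (x : Fin d → ℝ) :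
    sampleFun r μ lam k s x = ∏ i, levelCoef r μ lam (k i) (s i) (x i) := by
  rw [sampleFun, mixedLevelOp_eq, Finset.sum_eq_single s]
  · simp
  · intro s' _ hne
    rw [Set.indicator_of_notMem, mul_zero]
    exact fun h => hne (gridPoint_injective k h)
  · exact fun h => absurd hs h

lemma sampleFun_eq_zero {d : ℕ} (r μ : ℕ) (lam : ℤ → ℝ) (k s : Fin d → ℕ)
    (hs : s ∉ sampleIndex k) (x : Fin d → ℝ) : sampleFun r μ lam k s x = 0 := by
  rw [sampleFun, mixedLevelOp_eq]
  refine Finset.sum_eq_zero fun s' hs' => ?_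
  rw [Set.indicator_of_notMem, mul_zero]
  exact fun h => hs (gridPoint_injective k h ▸ hs')

lemma measurable_prod_levelCoef {d : ℕ} (r μ : ℕ) (lam : ℤ → ℝ) (k s : Fin d → ℕ) :
    Measurable fun x : Fin d → ℝ => ∏ i, levelCoef r μ lam (k i) (s i) (x i) :=
  Finset.measurable_prod _ fun i _ =>
    (measurable_levelCoef r μ lam (k i) (s i)).comp (measurable_pi_apply i)

lemma integrableOn_sampleFun {d : ℕ} (r μ : ℕ) (lam : ℤ → ℝ) (k s : Fin d → ℕ) :
    IntegrableOn (sampleFun r μ lam k s) (cube d) := by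
  by_cases hs : s ∈ sampleIndex k
  · obtain ⟨C, hC0, hC⟩ := abs_levelCoef_le r μ lam
    have e : sampleFun r μ lam k s = fun x => ∏ i, levelCoef r μ lam (k i) (s i) (x i) :=
      funext (sampleFun_eq r μ lam k s hs)
    rw [e]
    refine Measure.integrableOn_of_bounded (M := C ^ d) (by rw [volume_cube]; simp)
      (measurable_prod_levelCoef r μ lam k s).aestronglyMeasurable
      (Filter.Eventually.of_forall fun x => ?_)
    rw [Real.norm_eq_abs, Finset.abs_prod]
    refine (Finset.prod_le_prod (fun _ _ => abs_nonneg _) fun i _ => hC _ _ _).trans ?_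
    simp
  · have e : sampleFun r μ lam k s = fun _ => 0 := funext (sampleFun_eq_zero r μ lam k s hs)
    rw [e]
    exact integrableOn_zero

lemma volume_restrict_cube (d : ℕ) : (volume : Measure (Fin d → ℝ)).restrict (cube d) =
    Measure.pi fun _ => (volume : Measure ℝ).restrict (Set.Icc 0 1) := by
  rw [← Measure.restrict_pi_pi, ← volume_pi, cube, ← Set.pi_univ_Icc]
  rfl

lemma cubeIntegral_prod {d : ℕ} (F : Fin d → ℝ → ℝ) :
    cubeIntegral (fun x : Fin d → ℝ => ∏ i, F i (x i)) = ∏ i, ∫ y in (0 : ℝ)..1, F i y := by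
  rw [cubeIntegral, volume_restrict_cube, integral_fintype_prod_eq_prod]
  refine Finset.prod_congr rfl fun i _ => ?_
  rw [intervalIntegral.integral_of_le zero_le_one, integral_Icc_eq_integral_Ioc]

lemma cubeIntegral_sampleFun {d : ℕ} (r μ : ℕ) (lam : ℤ → ℝ) (k s : Fin d → ℕ)
    (hs : s ∈ sampleIndex k) :
    cubeIntegral (sampleFun r μ lam k s) = ∏ i, levelWeight r μ lam (k i) (s i) := by
  have e : sampleFun r μ lam k s = fun x => ∏ i, levelCoef r μ lam (k i) (s i) (x i) :=
    funext (sampleFun_eq r μ lam k s hs)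
  rw [e, cubeIntegral_prod]
  rfl

/-- `gridIndex Δ` as a finite set, for finite `Δ`. -/
def gridIndexFinset {d : ℕ} {Δ : Set (Fin d → ℕ)} (hΔ : Δ.Finite) :
    Finset ((Fin d → ℕ) × (Fin d → ℕ)) :=
  (hΔ.toFinset ×ˢ hΔ.toFinset.biUnion sampleIndex).filter fun q => q.2 ∈ sampleIndex q.1

lemma mem_gridIndexFinset {d : ℕ} {Δ : Set (Fin d → ℕ)} (hΔ : Δ.Finite)
    (q : (Fin d → ℕ) × (Fin d → ℕ)) :
    q ∈ gridIndexFinset hΔ ↔ q.1 ∈ hΔ.toFinset ∧ q.2 ∈ sampleIndex q.1 := by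
  simp only [gridIndexFinset, Finset.mem_filter, Finset.mem_product, Finset.mem_biUnion]
  constructor
  · rintro ⟨⟨h1, _⟩, h2⟩; exact ⟨h1, h2⟩
  · rintro ⟨h1, h2⟩; exact ⟨⟨h1, q.1, h1, h2⟩, h2⟩

lemma coe_gridIndexFinset {d : ℕ} {Δ : Set (Fin d → ℕ)} (hΔ : Δ.Finite) :
    (gridIndexFinset hΔ : Set ((Fin d → ℕ) × (Fin d → ℕ))) = gridIndex Δ := by
  ext q
  rw [Finset.mem_coe, mem_gridIndexFinset, mem_sampleIndex, Set.Finite.mem_toFinset]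
  rfl

lemma finsum_gridIndex {d : ℕ} {Δ : Set (Fin d → ℕ)} (hΔ : Δ.Finite)
    (F : (Fin d → ℕ) × (Fin d → ℕ) → ℝ) :
    ∑ᶠ ks ∈ gridIndex Δ, F ks = ∑ k ∈ hΔ.toFinset, ∑ s ∈ sampleIndex k, F (k, s) := by
  rw [← coe_gridIndexFinset hΔ, finsum_mem_coe_finset,
    Finset.sum_finset_product _ _ _ (mem_gridIndexFinset hΔ)]

lemma samplingOp_eq {d : ℕ} (r μ : ℕ) (lam : ℤ → ℝ) {Δ : Set (Fin d → ℕ)} (hΔ : Δ.Finite)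
    (f : (Fin d → ℝ) → ℝ) (x : Fin d → ℝ) :
    samplingOp r μ lam Δ f x = ∑ᶠ ks ∈ gridIndex Δ,
      f (gridPoint ks.1 ks.2) * sampleFun r μ lam ks.1 ks.2 x := by
  rw [finsum_gridIndex hΔ, samplingOp, finsum_mem_eq_finite_toFinset_sum _ hΔ]
  refine Finset.sum_congr rfl fun k _ => ?_
  rw [mixedLevelOp_eq]
  refine Finset.sum_congr rfl fun s hs => ?_
  rw [sampleFun_eq r μ lam k s hs, mul_comm]

lemma tens_levelFun {d : ℕ} (r μ : ℕ) (lam : ℤ → ℝ) (k : Fin d → ℕ) (f : (Fin d → ℝ) → ℝ) :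
    tens f (fun i => levelFun r μ lam (k i)) =
      ∑ s ∈ sampleIndex k, (∏ i, levelWeight r μ lam (k i) (s i)) * f (gridPoint k s) := by
  simp only [levelFun]
  rw [tens_rep]
  rfl

/-- The weights factorize by Fubini, so the formula is the sum of the functionals `∫ q_k`, each a
tensor product of univariate ones. -/
lemma gridCubature_eq {d : ℕ} (r μ : ℕ) (lam : ℤ → ℝ) {Δ : Set (Fin d → ℕ)} (hΔ : Δ.Finite)
    (f : (Fin d → ℝ) → ℝ) : gridCubature r μ lam Δ f =
      ∑ k ∈ hΔ.toFinset, tens f (fun i => levelFun r μ lam (k i)) := by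
  rw [gridCubature, finsum_gridIndex hΔ]
  refine Finset.sum_congr rfl fun k _ => ?_
  rw [tens_levelFun]
  refine Finset.sum_congr rfl fun s hs => ?_
  rw [cubeIntegral_sampleFun r μ lam k s hs]

/-! ### Convergence of the full tensor product operators -/

/-- The tensor product of the operators `Q_m`, applied to `f`. -/
def tensorQuasi {d : ℕ} (r μ : ℕ) (lam : ℤ → ℝ) (m : ℕ) (f : (Fin d → ℝ) → ℝ)
    (x : Fin d → ℝ) : ℝ :=
  ∑ s ∈ sampleIndex (fun _ : Fin d => m), (∏ i, quasiCoef r μ lam m (s i) (x i)) *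
    f (gridPoint (fun _ => m) s)

lemma intervalIntegrable_quasiCoef (r μ : ℕ) (lam : ℤ → ℝ) (k s : ℕ) (u v : ℝ) :
    IntervalIntegrable (quasiCoef r μ lam k s) volume u v := by
  obtain ⟨C, _, hC⟩ := abs_quasiCoef_le r μ lam
  refine (intervalIntegrable_const (c := C)).mono_fun
    (measurable_quasiCoef r μ lam k s).aestronglyMeasurable ?_
  exact Filter.Eventually.of_forall fun x => by
    simpa using (hC k s x).trans (le_abs_self C)

/-- Telescoping under the integral. -/
lemma sum_levelFun (r μ : ℕ) (lam : ℤ → ℝ) (m : ℕ) :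
    ∑ k ∈ Finset.range (m + 1), levelFun r μ lam k =
      ∑ s ∈ Finset.range (2 ^ m + 1), (∫ x in (0 : ℝ)..1, quasiCoef r μ lam m s x) •
        Finsupp.single ((s : ℝ) / 2 ^ m) 1 := by
  refine functional_ext fun g => ?_
  rw [map_sum, linearCombination_rep]
  simp only [levelFun, linearCombination_rep, levelWeight, ← intervalIntegral.integral_mul_const]
  rw [← intervalIntegral.integral_finsetSum
    fun s _ => (intervalIntegrable_quasiCoef r μ lam m s _ _).mul_const _]
  simp only [← quasiInterp_eq]
  simp only [← sum_levelOp]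
  rw [intervalIntegral.integral_finsetSum]
  · refine Finset.sum_congr rfl fun k _ => ?_
    simp only [levelOp_eq]
    rw [intervalIntegral.integral_finsetSum
      fun s _ => (intervalIntegrable_levelCoef r μ lam k s _ _).mul_const _]
  · intro k _
    have e : levelOp r μ lam k g = fun x => ∑ i ∈ Finset.range (2 ^ k + 1),
        levelCoef r μ lam k i x * g ((i : ℝ) / 2 ^ k) := funext (levelOp_eq r μ lam k g)
    rw [e]
    have h := IntervalIntegrable.sum (μ := volume) (a := 0) (b := 1) (Finset.range (2 ^ k + 1))
      (f := fun i x => levelCoef r μ lam k i x * g ((i : ℝ) / 2 ^ k)) fun s _ =>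
        (intervalIntegrable_levelCoef r μ lam k s _ _).mul_const _
    rw [show (∑ i ∈ Finset.range (2 ^ k + 1), fun x => levelCoef r μ lam k i x *
      g ((i : ℝ) / 2 ^ k)) = fun x => ∑ i ∈ Finset.range (2 ^ k + 1),
        levelCoef r μ lam k i x * g ((i : ℝ) / 2 ^ k) by
          funext x; simp only [Finset.sum_apply]] at h
    exact h

lemma integrableOn_prod_quasiCoef {d : ℕ} (r μ : ℕ) (lam : ℤ → ℝ) (m : ℕ) (s : Fin d → ℕ) :
    IntegrableOn (fun x : Fin d → ℝ => ∏ i, quasiCoef r μ lam m (s i) (x i)) (cube d) := by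
  obtain ⟨C, hC0, hC⟩ := abs_quasiCoef_le r μ lam
  refine Measure.integrableOn_of_bounded (M := C ^ d) (by rw [volume_cube]; simp)
    (Finset.measurable_prod _ fun i _ => (measurable_quasiCoef r μ lam m (s i)).comp
      (measurable_pi_apply i)).aestronglyMeasurable (Filter.Eventually.of_forall fun x => ?_)
  rw [Real.norm_eq_abs, Finset.abs_prod]
  refine (Finset.prod_le_prod (fun _ _ => abs_nonneg _) fun i _ => hC _ _ _).trans ?_
  simp

lemma cubeIntegral_tensorQuasi {d : ℕ} (r μ : ℕ) (lam : ℤ → ℝ) (m : ℕ) (f : (Fin d → ℝ) → ℝ) :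
    cubeIntegral (tensorQuasi r μ lam m f) =
      tens f (fun _ => ∑ k ∈ Finset.range (m + 1), levelFun r μ lam k) := by
  simp only [sum_levelFun]
  rw [tens_rep, cubeIntegral]
  simp only [tensorQuasi]
  rw [integral_finsetSum _ fun s _ => (integrableOn_prod_quasiCoef r μ lam m s).mul_const _]
  refine Finset.sum_congr rfl fun s _ => ?_
  rw [integral_mul_const, ← cubeIntegral_prod]
  rfl

/-- The Lebesgue functions of `Q_m` are bounded uniformly in `m`: the coefficients are bounded and
only boundedly many are nonzero at a point. -/
lemma exists_sum_abs_quasiCoef_le (r μ : ℕ) (lam : ℤ → ℝ) : ∃ A : ℝ, 0 ≤ A ∧ ∀ (m : ℕ) (x : ℝ),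
    ∑ s ∈ Finset.range (2 ^ m + 1), |quasiCoef r μ lam m s x| ≤ A := by
  obtain ⟨C, hC0, hC⟩ := abs_quasiCoef_le r μ lam
  refine ⟨(2 * (3 * r + 2 * μ + 1 : ℕ) + 1) * C, by positivity, fun m x => ?_⟩
  refine sum_abs_le_of_window (2 ^ m + 1) 1 (3 * r + 2 * μ + 1) le_rfl ⌊2 ^ m * x⌋
    (fun s => quasiCoef r μ lam m s x) C hC0 (fun s _ => hC m s x) fun s hs hne => ?_
  have h1 := abs_le.1 (quasiCoef_support r μ lam m s
    (Nat.lt_succ_iff.1 (Finset.mem_range.1 hs)) x hne)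
  have h2 := Int.floor_le ((2 : ℝ) ^ m * x)
  have h3 := Int.lt_floor_add_one ((2 : ℝ) ^ m * x)
  rw [abs_le]
  have h4 : -((3 * r + 2 * μ + 1 : ℕ) : ℝ) ≤ (⌊(2 : ℝ) ^ m * x⌋ : ℝ) - s := by push_cast; linarith
  have h5 : (⌊(2 : ℝ) ^ m * x⌋ : ℝ) - s ≤ ((3 * r + 2 * μ + 1 : ℕ) : ℝ) := by push_cast; linarith
  constructor
  · have : -((3 * r + 2 * μ + 1 : ℕ) : ℤ) ≤ ⌊(2 : ℝ) ^ m * x⌋ - s := by exact_mod_cast h4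
    push_cast at this ⊢; linarith
  · have : ⌊(2 : ℝ) ^ m * x⌋ - s ≤ ((3 * r + 2 * μ + 1 : ℕ) : ℤ) := by exact_mod_cast h5
    push_cast at this ⊢; linarith

lemma gridPoint_mem_cube {d : ℕ} {k s : Fin d → ℕ} (hs : s ∈ sampleIndex k) :
    gridPoint k s ∈ cube d := by
  rw [mem_sampleIndex] at hs
  refine ⟨fun i => by simp only [Pi.zero_apply, gridPoint]; positivity, fun i => ?_⟩
  simp only [gridPoint, Pi.one_apply]
  rw [div_le_one (by positivity)]
  exact_mod_cast hs i

/-- The coefficients sum to one, are bounded in `ℓ_1`, and involve only nodes at distance `O(2 ^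
(-m))` from `x`; uniform continuity does the rest. The half-open box is the range where they are
known to sum to one. -/
lemma tensorQuasi_sub_le {r μ : ℕ} {lam : ℤ → ℝ} (hQ : IsQuasiInterpolation r μ lam) (hr : 0 < r)
    {d : ℕ} {f : (Fin d → ℝ) → ℝ} (hf : ContinuousOn f (cube d)) {ε : ℝ} (hε : 0 < ε) :
    ∃ M : ℕ, ∀ m ≥ M, ∀ x ∈ unitBox d, |tensorQuasi r μ lam m f x - f x| ≤ ε := by
  obtain ⟨A, hA0, hA⟩ := exists_sum_abs_quasiCoef_le r μ lam
  have huc := (isCompact_Icc (a := (0 : Fin d → ℝ)) (b := 1)).uniformContinuousOn_of_continuous hf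
  rw [Metric.uniformContinuousOn_iff] at huc
  obtain ⟨δ, hδ, huc⟩ := huc (ε / (A ^ d + 1)) (by positivity)
  obtain ⟨M, hM⟩ := exists_pow_lt_of_lt_one (y := (1 / 2 : ℝ))
    (show (0 : ℝ) < δ / (3 * r + 2 * μ + 1) by positivity) (by norm_num)
  refine ⟨M, fun m hm x hx => ?_⟩
  have hxc : x ∈ cube d := ⟨fun i => (hx i trivial).1, fun i => (hx i trivial).2.le⟩
  have hone : f x = ∑ s ∈ sampleIndex (fun _ : Fin d => m),
      (∏ i, quasiCoef r μ lam m (s i) (x i)) * f x := by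
    rw [← Finset.sum_mul, sampleIndex,
      ← Finset.prod_univ_sum (fun _ : Fin d => Finset.range (2 ^ m + 1))
        (fun i s => quasiCoef r μ lam m s (x i)),
      Finset.prod_eq_one fun i _ => sum_quasiCoef hQ hr m (x i) (hx i trivial).1 (hx i trivial).2,
      one_mul]
  rw [hone, tensorQuasi, ← Finset.sum_sub_distrib]
  refine (Finset.abs_sum_le_sum_abs _ _).trans ?_
  calc _ ≤ ∑ s ∈ sampleIndex (fun _ : Fin d => m),
        (∏ i, |quasiCoef r μ lam m (s i) (x i)|) * (ε / (A ^ d + 1)) := by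
        refine Finset.sum_le_sum fun s hs => ?_
        rw [← mul_sub, abs_mul, Finset.abs_prod]
        by_cases hz : ∏ i, |quasiCoef r μ lam m (s i) (x i)| = 0
        · rw [hz, zero_mul, zero_mul]
        refine mul_le_mul_of_nonneg_left ?_ (Finset.prod_nonneg fun _ _ => abs_nonneg _)
        replace hz := Finset.prod_ne_zero_iff.1 hz
        have hd : dist (gridPoint (fun _ => m) s) x < δ := by
          rw [dist_pi_lt_iff hδ]
          intro i
          have h1 := quasiCoef_support r μ lam m (s i) ((mem_sampleIndex.1 hs) i) (x i)
            (abs_ne_zero.1 (hz i (Finset.mem_univ i)))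
          have h2 : (0 : ℝ) < 2 ^ m := by positivity
          rw [Real.dist_eq, gridPoint, abs_sub_comm,
            show x i - (s i : ℝ) / 2 ^ m = (2 ^ m * x i - s i) / 2 ^ m by field_simp, abs_div,
            abs_of_pos h2, div_lt_iff₀ h2]
          have h3 : (1 / 2 : ℝ) ^ m < δ / (3 * r + 2 * μ + 1) :=
            (pow_le_pow_of_le_one (by norm_num) (by norm_num) hm).trans_lt hM
          rw [lt_div_iff₀ (by positivity), one_div_pow, one_div_mul_eq_div, div_lt_iff₀ h2] at h3
          linarith
        have := huc _ (gridPoint_mem_cube hs) x hxc hd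
        rw [Real.dist_eq] at this
        exact this.le
    _ = (∏ i, ∑ s ∈ Finset.range (2 ^ m + 1), |quasiCoef r μ lam m s (x i)|) *
        (ε / (A ^ d + 1)) := by
        rw [← Finset.sum_mul, sampleIndex,
          ← Finset.prod_univ_sum (fun _ : Fin d => Finset.range (2 ^ m + 1))
            (fun i s => |quasiCoef r μ lam m s (x i)|)]
    _ ≤ A ^ d * (ε / (A ^ d + 1)) := by
        refine mul_le_mul_of_nonneg_right ?_ (by positivity)
        refine (Finset.prod_le_prod (fun i _ => Finset.sum_nonneg fun _ _ => abs_nonneg _)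
          fun i _ => hA m (x i)).trans ?_
        simp
    _ ≤ ε := by
        rw [mul_div_assoc', div_le_iff₀ (by positivity)]
        nlinarith [pow_nonneg hA0 d]

lemma unitBox_ae_eq_cube (d : ℕ) : unitBox d =ᵐ[volume] cube d := by
  have := Measure.univ_pi_Ico_ae_eq_Icc (μ := fun _ : Fin d => (volume : Measure ℝ))
    (f := fun _ => 0) (g := fun _ => 1)
  rw [← volume_pi] at this
  exact this

/-- Summed over a box of levels, the tensor products of differences collapse to the tensor product
of the operators `Q_m`. -/
lemma tendsto_cubeIntegral {r μ : ℕ} {lam : ℤ → ℝ} (hQ : IsQuasiInterpolation r μ lam)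
    (hr : 0 < r) {d : ℕ} {f : (Fin d → ℝ) → ℝ} (hf : ContinuousOn f (cube d)) :
    Filter.Tendsto (fun m => ∑ k ∈ Fintype.piFinset (fun _ : Fin d => Finset.range (m + 1)),
      tens f (fun i => levelFun r μ lam (k i))) Filter.atTop (nhds (cubeIntegral f)) := by
  classical
  have e : ∀ m, ∑ k ∈ Fintype.piFinset (fun _ : Fin d => Finset.range (m + 1)),
      tens f (fun i => levelFun r μ lam (k i)) = cubeIntegral (tensorQuasi r μ lam m f) := by
    intro m
    rw [cubeIntegral_tensorQuasi,
      (tens f).map_sum_finset (fun _ k => levelFun r μ lam k) (fun _ => Finset.range (m + 1))]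
  simp only [e]
  rw [Metric.tendsto_atTop]
  intro ε hε
  obtain ⟨M, hM⟩ := tensorQuasi_sub_le hQ hr hf (half_pos hε)
  refine ⟨M, fun m hm => ?_⟩
  have hi1 : IntegrableOn (tensorQuasi r μ lam m f) (cube d) := by
    unfold tensorQuasi
    exact integrable_finsetSum _ fun s _ => (integrableOn_prod_quasiCoef r μ lam m s).mul_const _
  have hi2 : IntegrableOn f (cube d) := hf.integrableOn_compact isCompact_Icc
  rw [Real.dist_eq, cubeIntegral, cubeIntegral, ← integral_sub hi1 hi2,
    ← setIntegral_congr_set (unitBox_ae_eq_cube d)]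
  have := norm_setIntegral_le_of_norm_le_const (μ := volume) (s := unitBox d)
    (f := fun x => tensorQuasi r μ lam m f x - f x) (C := ε / 2)
    (by rw [volume_unitBox]; simp) (fun x hx => hM m hm x hx)
  rw [measureReal_def, volume_unitBox, ENNReal.toReal_one, mul_one] at this
  exact this.trans_lt (half_lt_self hε)

open Classical in
/-- The error of the cubature formula is bounded by the sum over the missing levels. -/
lemma enorm_cubature_error_le {r μ : ℕ} {lam : ℤ → ℝ} (hQ : IsQuasiInterpolation r μ lam)
    (hr : 0 < r) {d : ℕ} {f : (Fin d → ℝ) → ℝ} (hf : ContinuousOn f (cube d))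
    {Δ : Set (Fin d → ℕ)} (hΔ : Δ.Finite) :
    ENNReal.ofReal |cubeIntegral f - gridCubature r μ lam Δ f| ≤
      ∑' k : Fin d → ℕ, if k ∈ Δ then 0 else ‖tens f (fun i => levelFun r μ lam (k i))‖ₑ := by
  rw [← Real.norm_eq_abs, ofReal_norm]
  have hlim := (tendsto_cubeIntegral hQ hr hf).sub_const (gridCubature r μ lam Δ f)
  refine le_of_tendsto ((continuous_enorm.tendsto _).comp hlim) ?_
  obtain ⟨N, hN⟩ : ∃ N : ℕ, ∀ k ∈ hΔ.toFinset, ∀ i, k i ≤ N := by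
    refine ⟨hΔ.toFinset.sup fun k => Finset.univ.sup k, fun k hk i => ?_⟩
    exact (Finset.le_sup (f := k) (Finset.mem_univ i)).trans
      (Finset.le_sup (f := fun k : Fin d → ℕ => Finset.univ.sup k) hk)
  filter_upwards [Filter.eventually_ge_atTop N] with m hm
  have hsub : hΔ.toFinset ⊆ Fintype.piFinset (fun _ : Fin d => Finset.range (m + 1)) := by
    intro k hk
    rw [Fintype.mem_piFinset]
    intro i
    rw [Finset.mem_range]
    have := hN k hk i
    omega
  simp only [Function.comp]
  rw [gridCubature_eq r μ lam hΔ, ← Finset.sum_sdiff hsub, add_sub_cancel_right]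
  refine (enorm_sum_le _ _).trans ?_
  refine le_trans (Finset.sum_le_sum fun k hk => ?_) (ENNReal.sum_le_tsum _)
  rw [Finset.mem_sdiff, Set.Finite.mem_toFinset] at hk
  rw [if_neg hk.2]

/-! ### Sums over half spaces -/

open Classical in
lemma tsum_two_rpow_tail_le {c : ℝ} (hc : 0 < c) (Y : ℝ) :
    ∑' n : ℕ, (if c * n ≤ Y then 0 else (2 : ℝ≥0∞) ^ (-(c * n))) ≤
      (∑' n : ℕ, (2 : ℝ≥0∞) ^ (-c * n)) * 2 ^ (-Y) := by
  set N := ⌈Y / c⌉₊ with hN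
  have hNY : Y ≤ c * N := by
    have := Nat.le_ceil (Y / c)
    rw [div_le_iff₀ hc] at this
    rw [mul_comm]; exact this
  rw [← ENNReal.summable.sum_add_tsum_nat_add' (k := N) (f := fun n : ℕ =>
    if c * n ≤ Y then 0 else (2 : ℝ≥0∞) ^ (-(c * n)))]
  rw [Finset.sum_eq_zero, zero_add, ← ENNReal.tsum_mul_right]
  · refine ENNReal.tsum_le_tsum fun m => ?_
    split_ifs
    · exact zero_le
    · rw [← two_rpow_add]
      refine two_rpow_le_two_rpow ?_
      push_cast
      nlinarith
  · intro n hn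
    rw [Finset.mem_range, hN, Nat.lt_ceil, lt_div_iff₀ hc] at hn
    rw [if_pos (by linarith)]

open Classical in
lemma tsum_two_rpow_head_le {c : ℝ} (hc : 0 < c) (X : ℝ) :
    ∑' n : ℕ, (if c * n ≤ X then (2 : ℝ≥0∞) ^ (n : ℝ) else 0) ≤ 2 * 2 ^ (X / c) := by
  rcases lt_or_ge X 0 with hX | hX
  · rw [ENNReal.tsum_eq_zero.2]
    · exact zero_le
    · intro n
      rw [if_neg]
      have : 0 ≤ c * n := by positivity
      linarith
  · set N := ⌊X / c⌋₊ with hN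
    have hNX : (N : ℝ) ≤ X / c := Nat.floor_le (by positivity)
    rw [tsum_eq_sum (s := Finset.range (N + 1))]
    · calc _ ≤ ∑ n ∈ Finset.range (N + 1), (2 : ℝ≥0∞) ^ n := by
            refine Finset.sum_le_sum fun n _ => ?_
            split_ifs
            · rw [ENNReal.rpow_natCast]
            · exact zero_le
        _ ≤ 2 * 2 ^ N := by
            have h : ∑ n ∈ Finset.range (N + 1), 2 ^ n ≤ 2 * 2 ^ N := by
              have h1 := Nat.geomSum_eq (m := 2) le_rfl (N + 1)
              rw [h1, pow_succ]; omega
            exact_mod_cast h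
        _ ≤ _ := by
            gcongr
            rw [← ENNReal.rpow_natCast]
            exact two_rpow_le_two_rpow hNX
    · intro n hn
      rw [Finset.mem_range, not_lt] at hn
      rw [if_neg]
      have h1 : (N : ℝ) + 1 ≤ n := by exact_mod_cast hn
      have h2 := Nat.lt_floor_add_one (X / c)
      have h3 : X / c < n := h2.trans_le h1
      rw [div_lt_iff₀ hc] at h3
      linarith

lemma tsum_fin_cons {d : ℕ} (F : (Fin (d + 1) → ℕ) → ℝ≥0∞) :
    ∑' k, F k = ∑' k : Fin d → ℕ, ∑' n : ℕ, F (Fin.cons n k) := by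
  rw [← (Fin.consEquiv fun _ => ℕ).tsum_eq, ENNReal.tsum_prod', ENNReal.tsum_comm]
  rfl

/-- The levels `k` with `(c, k) ≤ ξ`. -/
def levels {d : ℕ} (c : Fin d → ℝ) (ξ : ℝ) : Set (Fin d → ℕ) := {k | ∑ i, c i * (k i : ℝ) ≤ ξ}

lemma mem_levels {d : ℕ} {c : Fin d → ℝ} {ξ : ℝ} {k : Fin d → ℕ} :
    k ∈ levels c ξ ↔ ∑ i, c i * (k i : ℝ) ≤ ξ := Iff.rfl

open Classical in
-- The sum over the first index is geometric and governed by its largest term. It leaves the weight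
-- with exponents `c i / c 0 - 1`, summable because `c 0` is the strict minimum; equality would
-- bring logarithms.
lemma tsum_levels_le {d : ℕ} [NeZero d] {c : Fin d → ℝ} (hc : 0 < c 0)
    (hc' : ∀ i, i ≠ 0 → c 0 < c i) : ∃ C : ℝ≥0∞, C ≠ ∞ ∧ ∀ ξ : ℝ,
      ∑' k : Fin d → ℕ, (if k ∈ levels c ξ then (2 : ℝ≥0∞) ^ msum k else 0) ≤
        C * 2 ^ (ξ / c 0) := by
  obtain ⟨m, rfl⟩ := Nat.exists_eq_succ_of_ne_zero (NeZero.ne d)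
  refine ⟨2 * ∑' k : Fin m → ℕ, (2 : ℝ≥0∞) ^ (-∑ i, (c (Fin.succ i) / c 0 - 1) * k i),
    ENNReal.mul_ne_top (by norm_num) (tsum_weight_ne_top fun i => ?_), fun ξ => ?_⟩
  · rw [sub_pos, one_lt_div hc]
    exact hc' _ (Fin.succ_ne_zero i)
  rw [tsum_fin_cons, mul_right_comm, ← ENNReal.tsum_mul_left]
  refine ENNReal.tsum_le_tsum fun k => ?_
  have h1 : ∀ n : ℕ, (if (Fin.cons n k : Fin (m + 1) → ℕ) ∈ levels c ξ then
      (2 : ℝ≥0∞) ^ msum (Fin.cons n k : Fin (m + 1) → ℕ) else 0) =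
      2 ^ msum k * (if c 0 * n ≤ ξ - ∑ i, c (Fin.succ i) * (k i : ℝ) then
        (2 : ℝ≥0∞) ^ (n : ℝ) else 0) := by
    intro n
    rw [mem_levels, mul_ite, mul_zero, ← two_rpow_add]
    simp only [msum, Fin.sum_univ_succ, Fin.cons_zero, Fin.cons_succ]
    rw [add_comm (n : ℝ)]
    refine if_congr ?_ rfl rfl
    rw [le_sub_iff_add_le]
  simp only [h1]
  rw [ENNReal.tsum_mul_left]
  calc _ ≤ (2 : ℝ≥0∞) ^ msum k * (2 * 2 ^ ((ξ - ∑ i, c (Fin.succ i) * (k i : ℝ)) / c 0)) := by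
        gcongr
        exact tsum_two_rpow_head_le hc _
    _ = 2 * (2 ^ (msum k + (ξ - ∑ i, c (Fin.succ i) * (k i : ℝ)) / c 0)) := by
        rw [two_rpow_add]; ring
    _ = 2 * 2 ^ (ξ / c 0 + -∑ i, (c (Fin.succ i) / c 0 - 1) * (k i : ℝ)) := by
        congr 2
        simp only [sub_mul, one_mul, Finset.sum_sub_distrib, msum, sub_div, Finset.sum_div,
          div_mul_eq_mul_div]
        ring
    _ = _ := by rw [two_rpow_add]; ring

open Classical in
-- Used for `θ > 1`, where only individual bounds are available. The decay exceeds the slopes by `ε`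
-- in all variables but the first, so after the geometric sum over the first index a summable factor
-- `2 ^ (-ε k i)` remains in each other variable.
lemma tsum_compl_levels_le {d : ℕ} [NeZero d] {c : Fin d → ℝ} (hc : 0 < c 0) {ε : ℝ}
    (hε : 0 < ε) : ∃ C : ℝ≥0∞, C ≠ ∞ ∧ ∀ ξ : ℝ,
      ∑' k : Fin d → ℕ, (if k ∈ levels c ξ then 0 else
        (2 : ℝ≥0∞) ^ (-(∑ i, (if i = 0 then c i else c i + ε) * (k i : ℝ)))) ≤
        C * 2 ^ (-ξ) := by
  obtain ⟨m, rfl⟩ := Nat.exists_eq_succ_of_ne_zero (NeZero.ne d)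
  refine ⟨(∑' n : ℕ, (2 : ℝ≥0∞) ^ (-c 0 * n)) *
    ∑' k : Fin m → ℕ, (2 : ℝ≥0∞) ^ (-∑ i, ε * k i),
    ENNReal.mul_ne_top (tsum_two_rpow_ne_top hc) (tsum_weight_ne_top fun i => hε), fun ξ => ?_⟩
  rw [tsum_fin_cons, mul_right_comm, ← ENNReal.tsum_mul_left]
  refine ENNReal.tsum_le_tsum fun k => ?_
  have h1 : ∀ n : ℕ, (if (Fin.cons n k : Fin (m + 1) → ℕ) ∈ levels c ξ then 0 else
      (2 : ℝ≥0∞) ^ (-(∑ i, (if i = 0 then c i else c i + ε) *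
        ((Fin.cons n k : Fin (m + 1) → ℕ) i : ℝ)))) =
      2 ^ (-∑ i, (c (Fin.succ i) + ε) * (k i : ℝ)) *
        (if c 0 * n ≤ ξ - ∑ i, c (Fin.succ i) * (k i : ℝ) then 0 else
        (2 : ℝ≥0∞) ^ (-(c 0 * n))) := by
    intro n
    rw [mem_levels, mul_ite, mul_zero, ← two_rpow_add]
    simp only [Fin.sum_univ_succ, Fin.cons_zero, Fin.cons_succ, if_true, Fin.succ_ne_zero, if_false]
    rw [← neg_add, add_comm (c 0 * (n : ℝ)) (∑ i, (c (Fin.succ i) + ε) * (k i : ℝ))]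
    refine if_congr ?_ rfl rfl
    rw [le_sub_iff_add_le]
  simp only [h1]
  rw [ENNReal.tsum_mul_left]
  calc _ ≤ 2 ^ (-∑ i, (c (Fin.succ i) + ε) * (k i : ℝ)) *
        ((∑' n : ℕ, (2 : ℝ≥0∞) ^ (-c 0 * n)) *
          2 ^ (-(ξ - ∑ i, c (Fin.succ i) * (k i : ℝ)))) := by
        gcongr
        exact tsum_two_rpow_tail_le hc _
    _ = (∑' n : ℕ, (2 : ℝ≥0∞) ^ (-c 0 * n)) *
        2 ^ (-∑ i, (c (Fin.succ i) + ε) * (k i : ℝ) +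
          -(ξ - ∑ i, c (Fin.succ i) * (k i : ℝ))) := by
        rw [two_rpow_add]; ring
    _ = (∑' n : ℕ, (2 : ℝ≥0∞) ^ (-c 0 * n)) * 2 ^ (-ξ + -∑ i, ε * (k i : ℝ)) := by
        congr 2
        simp only [add_mul, Finset.sum_add_distrib]
        ring
    _ = _ := by rw [two_rpow_add]; ring

/-! ### Sparse grids -/

lemma finite_levels {d : ℕ} {c : Fin d → ℝ} (hc : ∀ i, 0 < c i) (ξ : ℝ) :
    (levels c ξ).Finite := by
  refine (Set.finite_Iic (fun i => ⌊ξ / c i⌋₊)).subset fun k hk i => ?_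
  refine Nat.le_floor ?_
  rw [le_div_iff₀ (hc i), mul_comm]
  exact (Finset.single_le_sum (f := fun i => c i * (k i : ℝ))
    (fun j _ => mul_nonneg (hc j).le (Nat.cast_nonneg _)) (Finset.mem_univ i)).trans hk

lemma levels_mono {d : ℕ} (c : Fin d → ℝ) {ξ η : ℝ} (h : ξ ≤ η) : levels c ξ ⊆ levels c η :=
  fun _ hk => le_trans (mem_levels.1 hk) h

open Classical in
/-- The grid as a finite set. -/
def gridFinset {d : ℕ} {Δ : Set (Fin d → ℕ)} (hΔ : Δ.Finite) : Finset (Fin d → ℝ) :=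
  (gridIndexFinset hΔ).image fun ks => gridPoint ks.1 ks.2

lemma coe_gridFinset {d : ℕ} {Δ : Set (Fin d → ℕ)} (hΔ : Δ.Finite) :
    (gridFinset hΔ : Set (Fin d → ℝ)) = grid Δ := by
  rw [gridFinset, Finset.coe_image, coe_gridIndexFinset]
  rfl

lemma grid_mono {d : ℕ} {Δ Δ' : Set (Fin d → ℕ)} (h : Δ ⊆ Δ') : grid Δ ⊆ grid Δ' :=
  Set.image_mono fun _ hks => ⟨h hks.1, hks.2⟩

lemma card_sampleIndex {d : ℕ} (k : Fin d → ℕ) :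
    (sampleIndex k).card = ∏ i, (2 ^ k i + 1) := by
  simp [sampleIndex]

lemma card_gridFinset_le {d : ℕ} {Δ : Set (Fin d → ℕ)} (hΔ : Δ.Finite) :
    (gridFinset hΔ).card ≤ ∑ k ∈ hΔ.toFinset, ∏ i, (2 ^ k i + 1) := by
  classical
  refine Finset.card_image_le.trans ?_
  rw [Finset.card_eq_sum_ones, Finset.sum_finset_product _ _ _ (mem_gridIndexFinset hΔ)]
  simp [card_sampleIndex]

lemma prod_le_encard_grid {d : ℕ} {Δ : Set (Fin d → ℕ)} {k : Fin d → ℕ} (hk : k ∈ Δ) :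
    ((∏ i, (2 ^ k i + 1) : ℕ) : ℕ∞) ≤ (grid Δ).encard := by
  rw [← card_sampleIndex, ← Set.encard_coe_eq_coe_finsetCard,
    ← (gridPoint_injective k).encard_image]
  refine Set.encard_le_encard ?_
  rintro _ ⟨s, hs, rfl⟩
  exact ⟨(k, s), ⟨hk, mem_sampleIndex.1 hs⟩, rfl⟩

lemma two_pow_le_encard_grid {d : ℕ} {Δ : Set (Fin d → ℕ)} {k : Fin d → ℕ} (hk : k ∈ Δ)
    (i : Fin d) : ((2 ^ k i : ℕ) : ℕ∞) ≤ (grid Δ).encard := by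
  refine le_trans ?_ (prod_le_encard_grid hk)
  rw [Nat.cast_le]
  refine (Nat.le_succ _).trans ?_
  exact Finset.single_le_prod' (f := fun i => 2 ^ k i + 1) (fun j _ => Nat.succ_le_succ zero_le)
    (Finset.mem_univ i)

lemma levels_single_mem {d : ℕ} [NeZero d] {c : Fin d → ℝ} {ξ : ℝ} {N : ℕ} :
    (Pi.single 0 N : Fin d → ℕ) ∈ levels c ξ ↔ c 0 * N ≤ ξ := by
  rw [mem_levels, Finset.sum_eq_single 0]
  · simp
  · intro i _ hi
    simp [Pi.single_eq_of_ne hi]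
  · simp

lemma sum_levels_le {d : ℕ} [NeZero d] {c : Fin d → ℝ} (hc : ∀ i, 0 < c i)
    (hc' : ∀ i, i ≠ 0 → c 0 < c i) : ∃ K : ℝ≥0∞, K ≠ ∞ ∧ ∀ ξ : ℝ,
      ((gridFinset (finite_levels hc ξ)).card : ℝ≥0∞) ≤ K * 2 ^ (ξ / c 0) := by
  classical
  obtain ⟨C, hC, h⟩ := tsum_levels_le (hc 0) hc'
  refine ⟨2 ^ d * C, ENNReal.mul_ne_top (by simp) hC, fun ξ => ?_⟩
  rw [mul_assoc]
  refine le_trans (Nat.cast_le.2 (card_gridFinset_le _)) ?_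
  refine le_trans ?_ (mul_le_mul_right (h ξ) _)
  refine le_trans ?_ (mul_le_mul_right (ENNReal.sum_le_tsum (finite_levels hc ξ).toFinset) _)
  rw [Finset.mul_sum]
  push_cast
  refine Finset.sum_le_sum fun k hk => ?_
  rw [if_pos ((finite_levels hc ξ).mem_toFinset.1 hk), msum, two_rpow_sum]
  calc _ ≤ ∏ i, (2 * (2 : ℝ≥0∞) ^ (k i : ℝ)) := by
        refine Finset.prod_le_prod' fun i _ => ?_
        rw [ENNReal.rpow_natCast, two_mul]
        gcongr
        exact one_le_pow₀ (by norm_num)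
    _ = _ := by rw [Finset.prod_mul_distrib]; simp

lemma encard_grid {d : ℕ} {Δ : Set (Fin d → ℕ)} (hΔ : Δ.Finite) :
    (grid Δ).encard = (gridFinset hΔ).card := by
  rw [← coe_gridFinset hΔ, Set.encard_coe_eq_coe_finsetCard]

lemma encard_grid_levels_zero {d : ℕ} {c : Fin d → ℝ} (hc : ∀ i, 0 < c i) :
    (grid (levels c 0)).encard ≤ (2 ^ d : ℕ) := by
  have h : levels c 0 = {0} := by
    ext k
    rw [mem_levels, Set.mem_singleton_iff]
    constructor
    · intro hk
      have hz := (Finset.sum_eq_zero_iff_of_nonneg (fun j _ => mul_nonneg (hc j).le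
        (Nat.cast_nonneg (k j)))).1 (le_antisymm hk (Finset.sum_nonneg fun j _ =>
          mul_nonneg (hc j).le (Nat.cast_nonneg (k j))))
      funext i
      have := hz i (Finset.mem_univ i)
      simpa [(hc i).ne'] using this
    · rintro rfl
      simp
  rw [h, encard_grid (Set.finite_singleton 0), Nat.cast_le]
  refine (card_gridFinset_le _).trans ?_
  rw [Set.Finite.toFinset_singleton, Finset.sum_singleton]
  simp

/-- If the grid for `η` has at most `n` points, the level `(⌊η / c 0⌋, 0, ..., 0)` forces `η ≤ c 0 *
n`. Hence only finitely many values of the linear form compete and a maximal one exists; the bound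
`2 ^ d ≤ n` makes `0` a competitor. -/
lemma exists_isLargestParam {d : ℕ} [NeZero d] {c : Fin d → ℝ} (hc : ∀ i, 0 < c i) {n : ℕ}
    (hn : 2 ^ d ≤ n) : ∃ ξ, IsLargestParam (levels c) n ξ := by
  set v : (Fin d → ℕ) → ℝ := fun k => ∑ i, c i * (k i : ℝ) with hv
  set S : Set ℝ := {x | x ∈ v '' levels c (c 0 * n) ∧ (grid (levels c x)).encard ≤ n} with hS
  have hfin : S.Finite := ((finite_levels hc _).image v).subset fun x hx => hx.1
  have h0 : (0 : ℝ) ∈ S := by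
    refine ⟨⟨0, ?_, by simp [hv]⟩, (encard_grid_levels_zero hc).trans (by exact_mod_cast hn)⟩
    rw [mem_levels]
    simp only [Pi.zero_apply, Nat.cast_zero, mul_zero, Finset.sum_const_zero]
    exact mul_nonneg (hc 0).le (Nat.cast_nonneg n)
  obtain ⟨ξ, hξS, hξ⟩ := hfin.exists_maximal ⟨0, h0⟩
  have hmax : ∀ x ∈ S, x ≤ ξ := fun x hx => (le_total x ξ).elim id (hξ hx)
  refine ⟨ξ, hmax 0 h0, hξS.2, fun η hη hηn k hk => ?_⟩
  refine hmax (v k) ⟨⟨k, ?_, rfl⟩, ?_⟩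
  · refine (mem_levels.1 hk).trans ?_
    have hN : (Pi.single 0 ⌊η / c 0⌋₊ : Fin d → ℕ) ∈ levels c η := by
      rw [levels_single_mem, mul_comm, ← le_div_iff₀ (hc 0)]
      exact Nat.floor_le (div_nonneg hη (hc 0).le)
    have h1 := (two_pow_le_encard_grid hN 0).trans hηn
    rw [Pi.single_eq_same, Nat.cast_le] at h1
    have h2 : ⌊η / c 0⌋₊ + 1 ≤ n := (Nat.lt_two_pow_self).trans_le h1
    have h3 := (Nat.lt_floor_add_one (η / c 0)).le
    rw [div_le_iff₀ (hc 0), mul_comm] at h3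
    refine h3.trans ?_
    refine mul_le_mul_of_nonneg_left ?_ (hc 0).le
    exact_mod_cast h2
  · exact (Set.encard_le_encard (grid_mono (levels_mono c (mem_levels.1 hk)))).trans hηn

/-- Raising the parameter by `c 0` admits a new level on the first axis, so by maximality the
enlarged grid must exceed `n` points. Thus the count is sharp up to a constant factor. -/
lemma IsLargestParam.lt_encard {d : ℕ} [NeZero d] {c : Fin d → ℝ} (hc : ∀ i, 0 < c i) {n : ℕ}
    {ξ : ℝ} (h : IsLargestParam (levels c) n ξ) :
    (n : ℕ∞) < (grid (levels c (ξ + c 0))).encard := by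
  by_contra hlt
  rw [not_lt] at hlt
  have h1 := h.2.2 (ξ + c 0) (add_nonneg h.1 (hc 0).le) hlt
  have h2 : (Pi.single 0 (⌊ξ / c 0⌋₊ + 1) : Fin d → ℕ) ∈ levels c (ξ + c 0) := by
    rw [levels_single_mem]
    have := Nat.floor_le (div_nonneg h.1 (hc 0).le)
    rw [le_div_iff₀ (hc 0)] at this
    push_cast
    linarith
  have h3 := levels_single_mem.1 (h1 h2)
  have h4 := Nat.lt_floor_add_one (ξ / c 0)
  rw [div_lt_iff₀ (hc 0)] at h4
  push_cast at h3
  linarith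

/-- For a largest parameter `ξ`, the accuracy `2 ^ (-ξ)` is of the order `n ^ (-c_0)`. -/
lemma exists_two_rpow_neg_le {d : ℕ} [NeZero d] {c : Fin d → ℝ} (hc : ∀ i, 0 < c i)
    (hc' : ∀ i, i ≠ 0 → c 0 < c i) : ∃ K : ℝ≥0∞, K ≠ ∞ ∧ ∀ (n : ℕ) (ξ : ℝ), 1 ≤ n →
      IsLargestParam (levels c) n ξ → (2 : ℝ≥0∞) ^ (-ξ) ≤ K * (n : ℝ≥0∞) ^ (-c 0) := by
  obtain ⟨K, hK, h⟩ := sum_levels_le hc hc'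
  have hK' : K * 2 ≠ ∞ := ENNReal.mul_ne_top hK (by norm_num)
  refine ⟨(K * 2) ^ c 0, ENNReal.rpow_ne_top_of_nonneg (hc 0).le hK', fun n ξ hn hξ => ?_⟩
  have h1 := hξ.lt_encard hc
  rw [encard_grid (finite_levels hc _), Nat.cast_lt] at h1
  have h2 : (n : ℝ≥0∞) ≤ (K * 2) * 2 ^ (ξ / c 0) := by
    refine (Nat.cast_le.2 h1.le).trans ((h _).trans_eq ?_)
    rw [add_div, div_self (hc 0).ne', two_rpow_add, ENNReal.rpow_one]
    ring
  have h3 := ENNReal.rpow_le_rpow h2 (hc 0).le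
  rw [ENNReal.mul_rpow_of_nonneg _ _ (hc 0).le, ← ENNReal.rpow_mul,
    div_mul_cancel₀ _ (hc 0).ne'] at h3
  have hn0 : (n : ℝ≥0∞) ^ c 0 ≠ 0 := by
    rw [Ne, ENNReal.rpow_eq_zero_iff]
    have : (n : ℝ≥0∞) ≠ 0 := by exact_mod_cast (by omega : n ≠ 0)
    simp [this]
  have hnt : (n : ℝ≥0∞) ^ c 0 ≠ ∞ :=
    ENNReal.rpow_ne_top_of_nonneg (hc 0).le (ENNReal.natCast_ne_top n)
  rw [ENNReal.rpow_neg, ENNReal.rpow_neg, ← div_eq_mul_inv,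
    ENNReal.le_div_iff_mul_le (.inl hn0) (.inl hnt),
    mul_comm, ← div_eq_mul_inv]
  exact ENNReal.div_le_of_le_mul h3

/-! ### Cubature errors -/

/-- A cubature formula on at most `n` grid points competes in the definition of the optimal
error. -/
lemma optimalCubature_le {d : ℕ} (r μ : ℕ) (lam : ℤ → ℝ) {Δ : Set (Fin d → ℕ)} (hΔ : Δ.Finite)
    {n : ℕ} (hn : (grid Δ).encard ≤ n) (W : Set ((Fin d → ℝ) → ℝ)) :
    optimalCubature n W ≤ integrationError W (gridCubature r μ lam Δ) := by
  classical
  rw [encard_grid hΔ, Nat.cast_le] at hn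
  set G := gridFinset hΔ with hG
  -- A point may occur at several levels; its weights are added up, so that the nodes are counted
  -- without multiplicity.
  set w : G → ℝ := fun x => ∑ ks ∈ gridIndexFinset hΔ with gridPoint ks.1 ks.2 = x,
    cubeIntegral (sampleFun r μ lam ks.1 ks.2) with hw
  set e : G → Fin n := fun x => Fin.castLE hn (G.equivFin x) with he
  have hinj : Function.Injective e := (Fin.castLE_injective hn).comp G.equivFin.injective
  -- Unused indices of `Fin n` get weight `0` at the origin, which lies in the cube.
  have hkey : gridCubature r μ lam Δ = fun f : (Fin d → ℝ) → ℝ => ∑ j : Fin n,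
      Function.extend e w 0 j * f (Function.extend e Subtype.val 0 j) := by
    funext f
    rw [← Fintype.sum_of_injective e hinj (fun x : G => w x * f x)]
    · rw [gridCubature, ← coe_gridIndexFinset hΔ, finsum_mem_coe_finset,
        ← Finset.sum_fiberwise_of_maps_to (t := G) (g := fun ks => gridPoint ks.1 ks.2)
          (fun ks hks => Finset.mem_image_of_mem _ hks), ← Finset.sum_coe_sort G]
      refine Finset.sum_congr rfl fun x _ => ?_
      rw [hw, Finset.sum_mul]
      refine Finset.sum_congr rfl fun ks hks => ?_
      rw [(Finset.mem_filter.1 hks).2]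
    · intro j hj
      rw [Function.extend_apply' _ _ _ hj]
      simp
    · intro x
      rw [hinj.extend_apply, hinj.extend_apply]
  rw [hkey]
  refine iInf₂_le_of_le (Function.extend e Subtype.val 0) (fun j => ?_) (iInf_le _ _)
  by_cases hj : ∃ x, e x = j
  · obtain ⟨x, rfl⟩ := hj
    rw [hinj.extend_apply]
    obtain ⟨ks, hks, hx⟩ := Finset.mem_image.1 x.2
    rw [← hx]
    exact gridPoint_mem_cube ((mem_gridIndexFinset hΔ ks).1 hks).2
  · rw [Function.extend_apply' _ _ _ hj]
    exact ⟨le_rfl, zero_le_one⟩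

lemma inA_one_iff (p θ : ℝ≥0∞) : InA p θ 1 ↔ θ ≤ 1 := by
  unfold InA
  constructor
  · rintro (⟨_, h⟩ | ⟨_, _, h⟩ | ⟨_, _, h⟩)
    · simpa using h
    · exact h
    · exact h
  · intro h
    rcases le_or_gt 1 p with hp | hp
    · exact .inl ⟨hp, by simpa using h⟩
    · exact .inr (.inl ⟨hp, ENNReal.one_lt_top, h⟩)

lemma gap_one (p : ℝ≥0∞) : gap p 1 = max (p⁻¹.toReal - 1) 0 := by simp [gap]

open Classical in
/-- The coefficients of the linear form that defines `levelSet`. -/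
def levelSlope {d : ℕ} [NeZero d] (a : Fin d → ℝ) (p θ : ℝ≥0∞) (ε : ℝ) (i : Fin d) : ℝ :=
  (if θ ≤ 1 ∨ i = 0 then a i else a i - ε) - max (p⁻¹.toReal - 1) 0

lemma levelSet_eq {d : ℕ} [NeZero d] (a : Fin d → ℝ) (p θ : ℝ≥0∞) (ε : ℝ) :
    levelSet a p θ 1 ε = levels (levelSlope a p θ ε) := by
  funext ξ
  ext k
  rw [mem_levels, levelSet]
  by_cases hθ : θ ≤ 1
  · simp [inA_one_iff, hθ, levelSlope, gap_one, sub_mul, Finset.mul_sum]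
  · simp [inA_one_iff, hθ, levelSlope, gap_one, sub_mul, Finset.mul_sum]

open Classical in
-- For `θ ≤ 1` the weight in the summability bound exceeds `2 ^ ξ` at every missing level, so no
-- geometric series is needed and the slopes may be `a` itself. For `θ > 1` the individual bounds
-- are summed by `tsum_compl_levels_le`. The constant `B + B * C` covers both cases.
lemma exists_cubature_error_le {r μ : ℕ} {lam : ℤ → ℝ} (hQ : IsQuasiInterpolation r μ lam)
    (hr : 0 < r) {d : ℕ} [NeZero d] {a : Fin d → ℝ} {p θ : ℝ≥0∞} (hp : p ≠ 0) (hθ : θ ≠ 0)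
    (ha : p⁻¹.toReal < a 0) (ha' : ∀ i, a 0 ≤ a i) {ε : ℝ} (hε : 0 < ε)
    (hc : ∀ i, 0 < levelSlope a p θ ε i) : ∃ B : ℝ≥0∞, B ≠ ∞ ∧ ∀ ξ : ℝ,
      integrationError (besovBall r a p θ) (gridCubature r μ lam (levels (levelSlope a p θ ε) ξ)) ≤
        B * 2 ^ (-ξ) := by
  obtain ⟨B, hB, hbd⟩ := levelFun_bounds hQ hr hp ha ha' hθ
  obtain ⟨C, hC, hS⟩ := tsum_compl_levels_le (c := levelSlope a p θ ε) (hc 0) hε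
  set g := max (p⁻¹.toReal - 1) 0 with hg
  refine ⟨B + B * C, ENNReal.add_ne_top.2 ⟨hB, ENNReal.mul_ne_top hB hC⟩, fun ξ => ?_⟩
  refine iSup₂_le fun f hf => ?_
  refine (enorm_cubature_error_le hQ hr hf.1 (finite_levels hc ξ)).trans ?_
  obtain ⟨h1, h2⟩ := hbd f hf
  rw [add_mul]
  by_cases hθ1 : θ ≤ 1
  · refine le_trans ?_ (le_add_right (mul_le_mul_left (h2 hθ1) _))
    rw [← ENNReal.tsum_mul_right]
    refine ENNReal.tsum_le_tsum fun k => ?_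
    split_ifs with hk
    · exact zero_le
    · rw [mul_right_comm, ← two_rpow_add]
      refine le_mul_of_one_le_left zero_le ?_
      rw [← ENNReal.rpow_zero (x := 2)]
      refine two_rpow_le_two_rpow ?_
      rw [mem_levels, not_le] at hk
      simp only [levelSlope, hθ1, true_or, if_true, sub_mul, Finset.sum_sub_distrib,
        ← Finset.mul_sum] at hk
      simp only [msum]
      linarith
  · rw [mul_assoc]
    refine le_trans ?_ (le_add_left (mul_le_mul_right (hS ξ) _))
    rw [← ENNReal.tsum_mul_left]
    refine ENNReal.tsum_le_tsum fun k => ?_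
    split_ifs with hk
    · exact zero_le
    · refine (h1 k).trans_eq ?_
      congr 3
      rw [msum, Finset.mul_sum, ← Finset.sum_sub_distrib]
      refine Finset.sum_congr rfl fun i _ => ?_
      by_cases hi : i = 0
      · simp only [levelSlope, hi, or_true, if_true]; ring
      · simp only [levelSlope, hi, hθ1, or_false, if_false]; ring

/-! ### Differences of smooth functions -/

/-- The mean value inequality converts one difference into one derivative and a factor `|s|`. The
induction runs over the whole sequence of derivatives, since `fwdDiff s` commutes with
differentiation. -/
lemma abs_fwdDiff_iter_le_of_deriv {s C : ℝ} : ∀ (r : ℕ) (D : ℕ → ℝ → ℝ),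
    (∀ i x, HasDerivAt (D i) (D (i + 1) x) x) → (∀ x, |D r x| ≤ C) →
      ∀ x, |(fwdDiff s)^[r] (D 0) x| ≤ C * |s| ^ r
  | 0, D, _, hC, x => by simpa using hC x
  | r + 1, D, hD, hC, x => by
    have h1 : ∀ i y, HasDerivAt (fwdDiff s (D i)) (fwdDiff s (D (i + 1)) y) y := fun i y =>
      ((hD i (y + s)).comp_add_const y s).sub (hD i y)
    have h2 : ∀ y, |fwdDiff s (D r) y| ≤ C * |s| := by
      intro y
      have := Convex.norm_image_sub_le_of_norm_hasDerivWithin_le (s := Set.univ) (C := C)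
        (fun z _ => (hD r z).hasDerivWithinAt) (fun z _ => hC z) convex_univ
        (Set.mem_univ y) (Set.mem_univ (y + s))
      simpa [Real.norm_eq_abs, fwdDiff] using this
    have := abs_fwdDiff_iter_le_of_deriv (s := s) r (fun i => fwdDiff s (D i)) h1 h2 x
    rw [Function.iterate_succ_apply]
    calc _ ≤ C * |s| * |s| ^ r := this
      _ = _ := by ring

lemma abs_fwdDiff_iter_le {s C : ℝ} : ∀ (r : ℕ) (u : ℝ → ℝ), (∀ x, |u x| ≤ C) →
    ∀ x, |(fwdDiff s)^[r] u x| ≤ 2 ^ r * C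
  | 0, u, hC, x => by simpa using hC x
  | r + 1, u, hC, x => by
    have h : ∀ y, |fwdDiff s u y| ≤ 2 * C := fun y => by
      have := abs_sub (u (y + s)) (u y)
      have h1 := hC (y + s)
      have h2 := hC y
      simp only [fwdDiff]
      linarith
    have := abs_fwdDiff_iter_le (s := s) r _ h x
    rw [Function.iterate_succ_apply, pow_succ, mul_assoc]
    exact this

lemma diffOp_comp_mul (r : ℕ) (s N : ℝ) (u : ℝ → ℝ) (x : ℝ) :
    diffOp r s (fun y => u (N * y)) x = diffOp r (N * s) u (N * x) := by
  simp only [diffOp]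
  refine Finset.sum_congr rfl fun j _ => ?_
  rw [show N * (x + j * s) = N * x + j * (N * s) by ring]

/-! ### Sums of disjoint bumps -/

/-- A smooth bump supported in `(0, 1)`. -/
def bump : ContDiffBump (1 / 2 : ℝ) := ⟨1 / 8, 1 / 4, by norm_num, by norm_num⟩

lemma tsupport_iteratedDeriv_bump (i : ℕ) :
    tsupport (iteratedDeriv i bump) ⊆ Set.Icc (1 / 4) (3 / 4) := by
  induction i with
  | zero =>
    rw [iteratedDeriv_zero, bump.tsupport_eq, Real.closedBall_eq_Icc]
    refine Set.Icc_subset_Icc ?_ ?_ <;> norm_num [bump]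
  | succ i ih =>
    rw [iteratedDeriv_succ]
    exact (closure_minimal support_deriv_subset (isClosed_tsupport _)).trans ih

lemma iteratedDeriv_bump_eq_zero (i : ℕ) {y : ℝ} (hy : y ∉ Set.Ioo (0 : ℝ) 1) :
    iteratedDeriv i bump y = 0 := by
  refine image_eq_zero_of_notMem_tsupport fun h => hy ?_
  have := tsupport_iteratedDeriv_bump i h
  exact ⟨by linarith [this.1], by linarith [this.2]⟩

lemma continuous_iteratedDeriv_bump (i : ℕ) : Continuous (iteratedDeriv i bump) :=
  (bump.contDiff (n := i)).continuous_iteratedDeriv i le_rfl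

lemma exists_abs_iteratedDeriv_bump_le (i : ℕ) : ∃ C, ∀ y, |iteratedDeriv i bump y| ≤ C :=
  (continuous_iteratedDeriv_bump i).bounded_above_of_compact_support
    (isCompact_Icc.of_isClosed_subset (isClosed_tsupport _) (tsupport_iteratedDeriv_bump i))

lemma hasDerivAt_iteratedDeriv_bump (i : ℕ) (y : ℝ) :
    HasDerivAt (iteratedDeriv i bump) (iteratedDeriv (i + 1) bump y) y := by
  rw [iteratedDeriv_succ]
  refine DifferentiableAt.hasDerivAt ?_
  exact ((bump.contDiff (n := i + 1)).differentiable_iteratedDeriv i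
    (by exact_mod_cast Nat.lt_succ_self i)) y

/-- At `y` only the translate with index `⌊y⌋₊` can be nonzero, so the bound does not depend on the
number of translates. -/
lemma abs_sum_shift_le (F : Finset ℕ) {ψ : ℝ → ℝ} {C : ℝ} (hC : ∀ y, |ψ y| ≤ C)
    (hψ : ∀ y, y ∉ Set.Ioo (0 : ℝ) 1 → ψ y = 0) (y : ℝ) : |∑ l ∈ F, ψ (y - l)| ≤ C := by
  have hC0 : 0 ≤ C := (abs_nonneg _).trans (hC 0)
  have h : ∀ l : ℕ, l ≠ ⌊y⌋₊ → ψ (y - l) = 0 := by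
    intro l hl
    refine hψ _ fun hy => hl ?_
    have hl0 : (0 : ℝ) ≤ l := Nat.cast_nonneg l
    exact ((Nat.floor_eq_iff (by linarith [hy.1])).2 ⟨by linarith [hy.1], by linarith [hy.2]⟩).symm
  by_cases hF : ⌊y⌋₊ ∈ F
  · rw [Finset.sum_eq_single_of_mem _ hF fun l _ hl => h l hl]
    exact hC _
  · rw [Finset.sum_eq_zero fun l hl => h l fun e => hF (e ▸ hl)]
    simpa using hC0

/-- The sum of the translates of the bump to the intervals `(l, l + 1)`, `l ∈ F`, rescaled by the
factor `N`. -/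
def bumpSum (F : Finset ℕ) (N : ℝ) (x : ℝ) : ℝ := ∑ l ∈ F, bump (N * x - l)

lemma continuous_bumpSum (F : Finset ℕ) (N : ℝ) : Continuous (bumpSum F N) := by
  unfold bumpSum
  exact continuous_finsetSum _ fun l _ => bump.continuous.comp (by fun_prop)

lemma bump_eq_zero {y : ℝ} (hy : y ∉ Set.Ioo (0 : ℝ) 1) : bump y = 0 := by
  simpa using iteratedDeriv_bump_eq_zero 0 hy

lemma abs_bump_le_one (y : ℝ) : |bump y| ≤ 1 := by
  rw [abs_of_nonneg bump.nonneg]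
  exact bump.le_one

lemma abs_bumpSum_le (F : Finset ℕ) (N x : ℝ) : |bumpSum F N x| ≤ 1 :=
  abs_sum_shift_le F abs_bump_le_one (fun _ => bump_eq_zero) _

/-- The two entries of the minimum come from the sup norm and from the `r`-th derivative;
disjointness of the translates makes both uniform in `F`. -/
lemma exists_abs_diffOp_bumpSum_le (r : ℕ) : ∃ C : ℝ, 1 ≤ C ∧ ∀ (F : Finset ℕ) (N s x : ℝ),
    |diffOp r s (bumpSum F N) x| ≤ C * min 1 (|N * s| ^ r) := by
  obtain ⟨C, hC⟩ := exists_abs_iteratedDeriv_bump_le r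
  refine ⟨max C (2 ^ r), (one_le_pow₀ one_le_two).trans (le_max_right _ _), fun F N s x => ?_⟩
  set u : ℝ → ℝ := fun y => ∑ l ∈ F, bump (y - l) with hu
  have e : bumpSum F N = fun y => u (N * y) := rfl
  rw [e, diffOp_comp_mul, diffOp_eq_fwdDiff, mul_min_of_nonneg _ _ (by positivity)]
  refine le_min ?_ ?_
  · refine (abs_fwdDiff_iter_le (C := 1) r u (fun y => ?_) _).trans ?_
    · exact abs_sum_shift_le F abs_bump_le_one (fun _ => bump_eq_zero) y
    · simp
  · refine (abs_fwdDiff_iter_le_of_deriv (C := C) r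
      (fun i y => ∑ l ∈ F, iteratedDeriv i bump (y - l)) (fun i y => ?_) (fun y => ?_) _).trans ?_
    · exact HasDerivAt.fun_sum fun l _ =>
        (hasDerivAt_iteratedDeriv_bump i (y - l)).comp_sub_const y l
    · exact abs_sum_shift_le F hC (fun _ => iteratedDeriv_bump_eq_zero r) y
    · exact mul_le_mul_of_nonneg_right (le_max_left _ _) (by positivity)

lemma integral_bump_pos : 0 < ∫ y in (0 : ℝ)..1, bump y := by
  refine intervalIntegral.integral_pos zero_lt_one bump.continuous.continuousOn
    (fun x _ => bump.nonneg) ⟨1 / 2, ⟨by norm_num, by norm_num⟩, ?_⟩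
  exact bump.pos_of_mem_ball (Metric.mem_ball_self bump.rOut_pos)

lemma integral_bumpSum {F : Finset ℕ} {N : ℕ} (hN : 0 < N) (hF : ∀ l ∈ F, l < N) :
    ∫ x in (0 : ℝ)..1, bumpSum F N x = F.card / N * ∫ y in (0 : ℝ)..1, bump y := by
  have hN' : (0 : ℝ) < N := by exact_mod_cast hN
  have hi : ∀ l ∈ F, IntervalIntegrable (fun x : ℝ => bump (N * x - l)) volume 0 1 := fun l _ =>
    (bump.continuous.comp (by fun_prop : Continuous fun x : ℝ => N * x - l)).intervalIntegrable _ _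
  unfold bumpSum
  rw [intervalIntegral.integral_finsetSum hi]
  have h : ∀ l ∈ F, ∫ x in (0 : ℝ)..1, bump (N * x - l) =
      (N : ℝ)⁻¹ * ∫ y in (0 : ℝ)..1, bump y := by
    intro l hl
    rw [intervalIntegral.integral_comp_mul_sub _ hN'.ne', smul_eq_mul]
    congr 1
    have hlN : (l : ℝ) + 1 ≤ N := by exact_mod_cast hF l hl
    have hii : ∀ a b, IntervalIntegrable bump volume a b := fun a b =>
      bump.continuous.intervalIntegrable a b
    rw [← intervalIntegral.integral_add_adjacent_intervals (hii _ 0) (hii 0 _),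
      ← intervalIntegral.integral_add_adjacent_intervals (hii 0 1) (hii 1 _)]
    have h1 : ∫ x in ((N : ℝ) * 0 - l)..0, bump x = 0 := by
      refine intervalIntegral.integral_zero_ae (Filter.Eventually.of_forall fun x hx => ?_)
      rw [Set.uIoc_of_le (by simp)] at hx
      exact bump_eq_zero fun h => absurd h.1 (not_lt.2 hx.2)
    have h2 : ∫ x in (1 : ℝ)..((N : ℝ) * 1 - l), bump x = 0 := by
      refine intervalIntegral.integral_zero_ae (Filter.Eventually.of_forall fun x hx => ?_)
      rw [Set.uIoc_of_le (by linarith)] at hx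
      exact bump_eq_zero fun h => absurd h.2 (not_lt.2 hx.1.le)
    rw [h1, h2]
    ring
  rw [Finset.sum_congr rfl h, Finset.sum_const, nsmul_eq_mul]
  ring

/-! ### Functions of the first variable -/

lemma measurePreserving_eval_cube {d : ℕ} (i : Fin d) :
    MeasurePreserving (Function.eval i) ((volume : Measure (Fin d → ℝ)).restrict (cube d))
      ((volume : Measure ℝ).restrict (Set.Icc 0 1)) := by
  rw [volume_restrict_cube]
  have : IsProbabilityMeasure ((volume : Measure ℝ).restrict (Set.Icc 0 1)) := ⟨by simp⟩
  exact measurePreserving_eval _ i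

lemma cubeIntegral_comp_eval {d : ℕ} (i : Fin d) {g : ℝ → ℝ} (hg : Continuous g) :
    cubeIntegral (fun x : Fin d → ℝ => g (x i)) = ∫ y in (0 : ℝ)..1, g y := by
  rw [intervalIntegral.integral_of_le zero_le_one, ← integral_Icc_eq_integral_Ioc,
    ← (measurePreserving_eval_cube i).map_eq, integral_map (measurable_pi_apply i).aemeasurable
      hg.aestronglyMeasurable]
  rfl

lemma diffOp_const {r : ℕ} (hr : 0 < r) (h x c : ℝ) : diffOp r h (fun _ => c) x = 0 := by
  have := diffOp_polynomial (r := r) (P := Polynomial.C c)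
    (Polynomial.degree_C_le.trans_lt (by exact_mod_cast hr)) h x
  simpa using this

/-- A difference in a direction other than `i` sees a constant and gives zero. Consequently only `e
= ∅` and `e = {i}` contribute to the Besov norm of a function of `x i`. -/
lemma mixedDiff_comp_eval {d : ℕ} {r : ℕ} (hr : 0 < r) (i : Fin d) (e : Finset (Fin d))
    (h x : Fin d → ℝ) (g : ℝ → ℝ) : mixedDiff r e h (fun y => g (y i)) x =
      ∏ j, if j = i then (if i ∈ e then diffOp r (h i) g (x i) else g (x i))
        else if j ∈ e then 0 else 1 := by
  rw [mixedDiff_eq_sum]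
  have e1 : ∀ q : Fin d → ℕ, (∏ j, if j ∈ e then (-1 : ℝ) ^ (r - q j) * (r.choose (q j) : ℝ)
      else 1) * g (x i + q i * h i) = ∏ j, (if j ∈ e then (-1 : ℝ) ^ (r - q j) *
        (r.choose (q j) : ℝ) else 1) * (if j = i then g (x i + q j * h i) else 1) := by
    intro q
    rw [Finset.prod_mul_distrib]
    congr 1
    rw [Finset.prod_ite_eq' Finset.univ i (fun j => g (x i + q j * h i)),
      if_pos (Finset.mem_univ i)]
  simp only [e1]
  rw [← Finset.prod_univ_sum (fun j => if j ∈ e then Finset.range (r + 1) else {0})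
    (fun j q => (if j ∈ e then (-1 : ℝ) ^ (r - q) * (r.choose q : ℝ) else 1) *
      (if j = i then g (x i + q * h i) else 1))]
  refine Finset.prod_congr rfl fun j _ => ?_
  by_cases hj : j = i
  · subst hj
    by_cases hje : j ∈ e
    · simp only [hje, if_true, diffOp]
    · simp [hje]
  · by_cases hje : j ∈ e
    · have := diffOp_const hr 0 0 1
      simpa [hj, hje, diffOp] using this
    · simp [hj, hje]

lemma continuous_diffOp (r : ℕ) (h : ℝ) {g : ℝ → ℝ} (hg : Continuous g) :
    Continuous (diffOp r h g) := by
  unfold diffOp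
  fun_prop

lemma eLpNorm_comp_eval_le {d : ℕ} (i : Fin d) {u : ℝ → ℝ} (hu : Continuous u) (p : ℝ≥0∞)
    {D : Set (Fin d → ℝ)} (hD : D ⊆ cube d) :
    eLpNorm (fun x : Fin d → ℝ => u (x i)) p (volume.restrict D) ≤
      eLpNorm u p (volume.restrict (Set.Icc 0 1)) := by
  refine (eLpNorm_mono_measure _ (Measure.restrict_mono hD le_rfl)).trans_eq ?_
  exact eLpNorm_comp_measurePreserving hu.aestronglyMeasurable (measurePreserving_eval_cube i)

lemma diffDomain_subset_cube {d : ℕ} (r : ℕ) (e : Finset (Fin d)) (h : Fin d → ℝ) :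
    diffDomain r e h ⊆ cube d := fun _ hx => hx.1

lemma modulus_comp_eval_empty {d : ℕ} {r : ℕ} (hr : 0 < r) (i : Fin d) (p : ℝ≥0∞) {g : ℝ → ℝ}
    (hg : Continuous g) (t : Fin d → ℝ) :
    modulus r ∅ p (fun x => g (x i)) t ≤ eLpNorm g p (volume.restrict (Set.Icc 0 1)) := by
  refine iSup₂_le fun h _ => ?_
  have : mixedDiff r ∅ h (fun x => g (x i)) = fun x => g (x i) := by
    funext x
    rw [mixedDiff_comp_eval hr]
    simp
  rw [this]
  exact eLpNorm_comp_eval_le i hg p (diffDomain_subset_cube _ _ _)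

lemma modulus_comp_eval_singleton {d : ℕ} {r : ℕ} (hr : 0 < r) (i : Fin d) (p : ℝ≥0∞)
    {g : ℝ → ℝ} (hg : Continuous g) {M : ℝ≥0∞} {N : ℝ} (hN : 0 ≤ N)
    (hM : ∀ s, eLpNorm (diffOp r s g) p (volume.restrict (Set.Icc 0 1)) ≤
      M * ENNReal.ofReal (min 1 (|N * s| ^ r))) (t : Fin d → ℝ) :
    modulus r {i} p (fun x => g (x i)) t ≤ M * ENNReal.ofReal (min 1 ((N * t i) ^ r)) := by
  refine iSup₂_le fun h hh => ?_
  have : mixedDiff r {i} h (fun x => g (x i)) = fun x => diffOp r (h i) g (x i) := by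
    funext x
    rw [mixedDiff_comp_eval hr]
    simp +contextual
  rw [this]
  refine (eLpNorm_comp_eval_le i (continuous_diffOp r _ hg) p
    (diffDomain_subset_cube _ _ _)).trans ((hM _).trans ?_)
  have := hh i (Finset.mem_singleton_self i)
  rw [abs_mul, abs_of_nonneg hN]
  gcongr

lemma modulus_comp_eval_of_mem {d : ℕ} {r : ℕ} (hr : 0 < r) {i j : Fin d} (p : ℝ≥0∞)
    {g : ℝ → ℝ} {e : Finset (Fin d)} (hj : j ∈ e) (hji : j ≠ i) (t : Fin d → ℝ) :
    modulus r e p (fun x => g (x i)) t = 0 := by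
  refine le_antisymm (iSup₂_le fun h _ => ?_) zero_le
  have : mixedDiff r e h (fun x => g (x i)) = fun _ => 0 := by
    funext x
    rw [mixedDiff_comp_eval hr]
    refine Finset.prod_eq_zero (Finset.mem_univ j) ?_
    simp [hj, hji]
  rw [this]
  exact (eLpNorm_zero' (ε := ℝ)).le

/-! ### The Besov norm of a function of one variable -/

/-- The weight `min(1, x ^ r) x ^ (-a)`. -/
def besovWeight (r : ℕ) (a x : ℝ) : ℝ := min 1 (x ^ r) / x ^ a

lemma measurable_besovWeight (r : ℕ) (a : ℝ) : Measurable (besovWeight r a) := by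
  unfold besovWeight
  fun_prop

lemma besovWeight_nonneg {r : ℕ} {a x : ℝ} (hx : 0 ≤ x) : 0 ≤ besovWeight r a x := by
  unfold besovWeight
  positivity

lemma besovWeight_le_one {r : ℕ} {a : ℝ} (ha : 0 < a) (har : a < r) {x : ℝ} (hx : 0 < x) :
    besovWeight r a x ≤ 1 := by
  unfold besovWeight
  rw [div_le_one (Real.rpow_pos_of_pos hx a)]
  rcases le_total x 1 with h | h
  · refine (min_le_right _ _).trans ?_
    rw [← Real.rpow_natCast]
    exact Real.rpow_le_rpow_of_exponent_ge hx h har.le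
  · exact (min_le_left _ _).trans (Real.one_le_rpow h ha.le)

lemma min_div_rpow_eq {r : ℕ} {a N y : ℝ} (hN : 0 < N) (hy : 0 < y) :
    min 1 ((N * y) ^ r) / y ^ a = N ^ a * besovWeight r a (N * y) := by
  unfold besovWeight
  rw [Real.mul_rpow hN.le hy.le]
  have h1 := (Real.rpow_pos_of_pos hN a).ne'
  have h2 := (Real.rpow_pos_of_pos hy a).ne'
  field_simp

/-- Near `0` the integrand is at most `x ^ ((r - a) q - 1)`, near infinity at most `x ^ (-a q - 1)`;
the conditions `a < r` and `0 < a` make these integrable. -/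
lemma lintegral_besovWeight_ne_top {r : ℕ} {a : ℝ} (ha : 0 < a) (har : a < r) {q : ℝ}
    (hq : 0 < q) :
    ∫⁻ x in Set.Ioi (0 : ℝ), ENNReal.ofReal (besovWeight r a x) ^ q * ENNReal.ofReal x⁻¹ ≠ ∞ := by
  rw [← Set.Ioc_union_Ioi_eq_Ioi zero_le_one]
  refine ne_top_of_le_ne_top ?_ (lintegral_union_le _ _ _)
  refine ENNReal.add_ne_top.2 ⟨?_, ?_⟩
  · have hi : IntegrableOn (fun x : ℝ => x ^ ((r - a) * q - 1)) (Set.Ioc 0 1) := by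
      rw [← intervalIntegrable_iff_integrableOn_Ioc_of_le zero_le_one]
      exact intervalIntegral.intervalIntegrable_rpow' (by nlinarith)
    refine ne_top_of_le_ne_top hi.lintegral_lt_top.ne ?_
    refine setLIntegral_mono' measurableSet_Ioc fun x hx => ?_
    have hw := besovWeight_nonneg (r := r) (a := a) hx.1.le
    rw [ENNReal.ofReal_rpow_of_nonneg hw hq.le, ← ENNReal.ofReal_mul (by positivity)]
    refine ENNReal.ofReal_le_ofReal ?_
    rw [Real.rpow_sub hx.1, Real.rpow_one, div_eq_mul_inv, Real.rpow_mul hx.1.le]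
    have := hx.1.le
    gcongr
    unfold besovWeight
    rw [Real.rpow_sub hx.1, Real.rpow_natCast]
    gcongr
    exact min_le_right _ _
  · have hi : IntegrableOn (fun x : ℝ => x ^ (-a * q - 1)) (Set.Ioi 1) :=
      integrableOn_Ioi_rpow_of_lt (by nlinarith) zero_lt_one
    refine ne_top_of_le_ne_top hi.lintegral_lt_top.ne ?_
    refine setLIntegral_mono' measurableSet_Ioi fun x hx => ?_
    have hx0 : (0 : ℝ) < x := zero_lt_one.trans hx
    have hw := besovWeight_nonneg (r := r) (a := a) hx0.le
    rw [ENNReal.ofReal_rpow_of_nonneg hw hq.le, ← ENNReal.ofReal_mul (by positivity)]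
    refine ENNReal.ofReal_le_ofReal ?_
    rw [Real.rpow_sub hx0, Real.rpow_one, div_eq_mul_inv, Real.rpow_mul hx0.le]
    gcongr
    unfold besovWeight
    rw [Real.rpow_neg hx0.le, ← one_div]
    gcongr
    exact min_le_left _ _

lemma lintegral_comp_mul_left {N : ℝ} (hN : 0 < N) {Ψ : ℝ → ℝ≥0∞} (hΨ : Measurable Ψ) :
    ∫⁻ y, ENNReal.ofReal N * Ψ (N * y) = ∫⁻ x, Ψ x := by
  have h : ∫⁻ y, Ψ (N * y) = ENNReal.ofReal N⁻¹ * ∫⁻ x, Ψ x := by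
    rw [← lintegral_map hΨ (measurable_const_mul N), Real.map_volume_mul_left hN.ne',
      lintegral_smul_measure, abs_of_pos (inv_pos.2 hN), smul_eq_mul]
  rw [lintegral_const_mul _ (show Measurable fun y => Ψ (N * y) from
    hΨ.comp (measurable_const_mul N)), h, ← mul_assoc,
    ← ENNReal.ofReal_mul hN.le, mul_inv_cancel₀ hN.ne', ENNReal.ofReal_one, one_mul]

/-- The substitution `x = N * t i` leaves `dt / t` invariant and pulls out `N ^ a i`; the remaining
integral, taken over the whole half-line, no longer depends on `N`. -/
lemma exists_besovSeminorm_singleton_le {d : ℕ} {r : ℕ} (hr : 0 < r) (i : Fin d) {a : Fin d → ℝ}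
    (ha : 0 < a i) (har : a i < r) {θ : ℝ≥0∞} (hθ : θ ≠ 0) :
    ∃ K : ℝ≥0∞, K ≠ ∞ ∧ ∀ (p : ℝ≥0∞) (g : ℝ → ℝ) (M : ℝ≥0∞) (N : ℝ), 0 < N → Continuous g →
      (∀ s, eLpNorm (diffOp r s g) p (volume.restrict (Set.Icc 0 1)) ≤
        M * ENNReal.ofReal (min 1 (|N * s| ^ r))) →
      besovSeminorm r a p θ {i} (fun x => g (x i)) ≤ K * (M * ENNReal.ofReal (N ^ a i)) := by
  by_cases hθt : θ = ∞
  · refine ⟨1, ENNReal.one_ne_top, fun p g M N hN hg hM => ?_⟩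
    rw [besovSeminorm, if_pos hθt, one_mul]
    refine iSup₂_le fun t ht => ?_
    have h1 := modulus_comp_eval_singleton hr i p hg hN.le hM t
    rw [Finset.prod_singleton]
    refine ENNReal.div_le_of_le_mul (h1.trans ?_)
    rw [mul_assoc]
    gcongr
    have ht0 : 0 ≤ t i := ht.1 i
    rw [← ENNReal.ofReal_mul (by positivity)]
    refine ENNReal.ofReal_le_ofReal ?_
    rcases ht0.eq_or_lt with h0 | h0
    · rw [← h0, mul_zero, zero_pow hr.ne', Real.zero_rpow ha.ne']
      simp
    · rw [← div_le_iff₀ (Real.rpow_pos_of_pos h0 _), min_div_rpow_eq hN h0]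
      exact mul_le_of_le_one_right (Real.rpow_nonneg hN.le _)
        (besovWeight_le_one ha har (mul_pos hN h0))
  · set q := θ.toReal with hq
    have hq0 : 0 < q := ENNReal.toReal_pos hθ hθt
    set F : ℝ → ℝ≥0∞ := fun x =>
      ENNReal.ofReal (besovWeight r (a i) x) ^ q * ENNReal.ofReal x⁻¹ with hF
    have hFm : Measurable F :=
      ((measurable_besovWeight r (a i)).ennreal_ofReal.pow_const q).mul
        measurable_inv.ennreal_ofReal
    set I := ∫⁻ x in Set.Ioi (0 : ℝ), F x with hI
    refine ⟨I ^ (1 / q), ENNReal.rpow_ne_top_of_nonneg (by positivity)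
      (lintegral_besovWeight_ne_top ha har hq0), fun p g M N hN hg hM => ?_⟩
    rw [besovSeminorm, if_neg hθt, ← hq]
    have hkey : ∫⁻ t in cube d, (modulus r {i} p (fun x => g (x i)) t /
        ENNReal.ofReal (∏ j ∈ {i}, t j ^ a j)) ^ q * ENNReal.ofReal (∏ j ∈ {i}, (t j)⁻¹) ≤
        (M * ENNReal.ofReal (N ^ a i)) ^ q * I := by
      set Ψ : ℝ → ℝ≥0∞ := (Set.Ioi (0 : ℝ)).indicator F with hΨ
      have hΨm : Measurable Ψ := hFm.indicator measurableSet_Ioi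
      set H : ℝ → ℝ≥0∞ := fun y =>
        (M * ENNReal.ofReal (N ^ a i)) ^ q * (ENNReal.ofReal N * Ψ (N * y)) with hH
      have hHm : Measurable H :=
        ((hΨm.comp (measurable_const_mul N)).const_mul _).const_mul _
      calc _ ≤ ∫⁻ t in cube d, H (t i) := by
            refine setLIntegral_mono' (measurableSet_cube d) fun t ht => ?_
            have ht0 : 0 ≤ t i := ht.1 i
            have h1 := modulus_comp_eval_singleton hr i p hg hN.le hM t
            rw [Finset.prod_singleton, Finset.prod_singleton]
            rcases ht0.eq_or_lt with h0 | h0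
            · have : modulus r {i} p (fun x => g (x i)) t = 0 := by
                refine le_antisymm (h1.trans ?_) zero_le
                rw [← h0, mul_zero, zero_pow hr.ne']
                simp
              rw [this, ENNReal.zero_div, ENNReal.zero_rpow_of_pos hq0, zero_mul]
              exact zero_le
            · have hNy : 0 < N * t i := mul_pos hN h0
              have h2 : modulus r {i} p (fun x => g (x i)) t / ENNReal.ofReal (t i ^ a i) ≤
                  M * ENNReal.ofReal (N ^ a i) *
                    ENNReal.ofReal (besovWeight r (a i) (N * t i)) := by
                refine (ENNReal.div_le_div_right h1 _).trans ?_
                rw [mul_div_assoc, mul_assoc, ← ENNReal.ofReal_div_of_pos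
                  (Real.rpow_pos_of_pos h0 _), min_div_rpow_eq hN h0,
                  ENNReal.ofReal_mul (Real.rpow_nonneg hN.le _)]
              simp only [hH, hΨ, Set.indicator_of_mem (show N * t i ∈ Set.Ioi (0 : ℝ) from hNy), hF]
              calc _ ≤ (M * ENNReal.ofReal (N ^ a i) *
                    ENNReal.ofReal (besovWeight r (a i) (N * t i))) ^ q *
                      ENNReal.ofReal (t i)⁻¹ := by gcongr
                _ = (M * ENNReal.ofReal (N ^ a i)) ^ q *
                    (ENNReal.ofReal (besovWeight r (a i) (N * t i)) ^ q *
                      (ENNReal.ofReal N * ENNReal.ofReal (N * t i)⁻¹)) := by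
                    rw [ENNReal.mul_rpow_of_nonneg _ _ hq0.le, mul_assoc,
                      ← ENNReal.ofReal_mul hN.le, mul_inv, mul_inv_cancel_left₀ hN.ne']
                _ ≤ _ := by
                    refine le_of_eq ?_
                    ring
        _ = ∫⁻ y in Set.Icc (0 : ℝ) 1, H y :=
            (measurePreserving_eval_cube i).lintegral_comp hHm
        _ ≤ ∫⁻ y, H y := setLIntegral_le_lintegral _ _
        _ = _ := by
            simp only [hH]
            rw [lintegral_const_mul _ (show Measurable fun y => ENNReal.ofReal N * Ψ (N * y) from
                (hΨm.comp (measurable_const_mul N)).const_mul _),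
              lintegral_comp_mul_left hN hΨm, hΨ, lintegral_indicator measurableSet_Ioi]
    refine (ENNReal.rpow_le_rpow hkey (by positivity)).trans_eq ?_
    rw [ENNReal.mul_rpow_of_nonneg _ _ (by positivity), ← ENNReal.rpow_mul,
      mul_one_div_cancel hq0.ne', ENNReal.rpow_one, mul_comm]

lemma besovSeminorm_empty_le {d : ℕ} {r : ℕ} (hr : 0 < r) (i : Fin d) (a : Fin d → ℝ)
    (p : ℝ≥0∞) {θ : ℝ≥0∞} (hθ : θ ≠ 0) {g : ℝ → ℝ} (hg : Continuous g) :
    besovSeminorm r a p θ ∅ (fun x => g (x i)) ≤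
      eLpNorm g p (volume.restrict (Set.Icc 0 1)) := by
  have h1 := modulus_comp_eval_empty hr i p hg
  rw [besovSeminorm]
  split_ifs with hθt
  · refine iSup₂_le fun t _ => ?_
    simpa using h1 t
  · have hq0 : 0 < θ.toReal := ENNReal.toReal_pos hθ hθt
    simp only [Finset.prod_empty, ENNReal.ofReal_one, div_one, mul_one]
    calc _ ≤ (∫⁻ _ in cube d, (eLpNorm g p (volume.restrict (Set.Icc 0 1))) ^ θ.toReal) ^
          (1 / θ.toReal) := by
          gcongr with t
          exact h1 t
      _ = _ := by
          rw [setLIntegral_const, volume_cube, mul_one, ← ENNReal.rpow_mul,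
            mul_one_div_cancel hq0.ne', ENNReal.rpow_one]

lemma besovSeminorm_eq_zero {d : ℕ} {r : ℕ} (hr : 0 < r) {i j : Fin d} (a : Fin d → ℝ)
    (p : ℝ≥0∞) {θ : ℝ≥0∞} (hθ : θ ≠ 0) (g : ℝ → ℝ) {e : Finset (Fin d)} (hj : j ∈ e)
    (hji : j ≠ i) : besovSeminorm r a p θ e (fun x => g (x i)) = 0 := by
  have h1 := modulus_comp_eval_of_mem hr p (g := g) hj hji
  rw [besovSeminorm]
  split_ifs with hθt
  · simp [h1]
  · have hq0 : 0 < θ.toReal := ENNReal.toReal_pos hθ hθt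
    simp [h1, hq0]

lemma exists_besovNorm_comp_eval_le {d : ℕ} {r : ℕ} (hr : 0 < r) (i : Fin d) {a : Fin d → ℝ}
    (ha : 0 < a i) (har : a i < r) {θ : ℝ≥0∞} (hθ : θ ≠ 0) :
    ∃ K : ℝ≥0∞, K ≠ ∞ ∧ ∀ (p : ℝ≥0∞) (g : ℝ → ℝ) (M : ℝ≥0∞) (N : ℝ), 1 ≤ N → Continuous g →
      eLpNorm g p (volume.restrict (Set.Icc 0 1)) ≤ M →
      (∀ s, eLpNorm (diffOp r s g) p (volume.restrict (Set.Icc 0 1)) ≤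
        M * ENNReal.ofReal (min 1 (|N * s| ^ r))) →
      besovNorm r a p θ (fun x => g (x i)) ≤ K * (M * ENNReal.ofReal (N ^ a i)) := by
  obtain ⟨K, hK, h⟩ := exists_besovSeminorm_singleton_le hr i ha har hθ
  refine ⟨∑ _e : Finset (Fin d), (1 + K), ?_, fun p g M N hN hg hM0 hM => ?_⟩
  · exact ENNReal.sum_ne_top.2 fun _ _ => ENNReal.add_ne_top.2 ⟨ENNReal.one_ne_top, hK⟩
  rw [besovNorm, Finset.sum_mul]
  refine Finset.sum_le_sum fun e _ => ?_
  by_cases he : ∃ j ∈ e, j ≠ i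
  · obtain ⟨j, hj, hji⟩ := he
    rw [besovSeminorm_eq_zero hr a p hθ g hj hji]
    exact zero_le
  · push Not at he
    rw [add_mul, one_mul]
    rcases Finset.subset_singleton_iff.1 (fun j hj => Finset.mem_singleton.2 (he j hj)) with
      rfl | rfl
    · refine le_add_right ?_
      refine ((besovSeminorm_empty_le hr i a p hθ hg).trans hM0).trans ?_
      refine le_mul_of_one_le_right zero_le ?_
      rw [ENNReal.one_le_ofReal]
      exact Real.one_le_rpow hN ha.le
    · exact le_add_left (h p g M N (by linarith) hg hM)

/-! ### Lower bound for the optimal cubature error -/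

lemma eLpNorm_Icc_le_of_abs_le {u : ℝ → ℝ} {S : ℝ} (hS : ∀ x, |u x| ≤ S) (p : ℝ≥0∞) :
    eLpNorm u p (volume.restrict (Set.Icc 0 1)) ≤ ENNReal.ofReal S := by
  refine (eLpNorm_le_of_ae_bound (Filter.Eventually.of_forall hS)).trans_eq ?_
  simp

/-- For `p = ∞` the exponent `p.toReal⁻¹` is `0`, so the formula stays correct and no case
distinction is needed. -/
lemma eLpNorm_Icc_le_of_support_subset {u : ℝ → ℝ} {S V : ℝ} (hS : ∀ x, |u x| ≤ S) {E : Set ℝ}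
    (hE : Function.support u ⊆ E) (hV : volume E ≤ ENNReal.ofReal V) (p : ℝ≥0∞) :
    eLpNorm u p (volume.restrict (Set.Icc 0 1)) ≤
      ENNReal.ofReal V ^ p.toReal⁻¹ * ENNReal.ofReal S := by
  refine (eLpNorm_mono_measure _ Measure.restrict_le_self).trans ?_
  rw [← eLpNorm_restrict_eq_of_support_subset hE]
  refine (eLpNorm_le_of_ae_bound (Filter.Eventually.of_forall hS)).trans ?_
  rw [Measure.restrict_apply_univ]
  gcongr

lemma support_bumpSum_subset (l : ℕ) {N : ℝ} (hN : 0 < N) :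
    Function.support (bumpSum {l} N) ⊆ Set.Ioo (l / N) ((l + 1) / N) := by
  intro x hx
  rw [Function.mem_support, bumpSum, Finset.sum_singleton] at hx
  have h : N * x - l ∈ Set.Ioo (0 : ℝ) 1 := by
    by_contra h
    exact hx (bump_eq_zero h)
  rw [Set.mem_Ioo, div_lt_iff₀ hN, lt_div_iff₀ hN]
  constructor <;> linarith [h.1, h.2]

lemma support_diffOp_subset (r : ℕ) (s : ℝ) {g : ℝ → ℝ} {E : Set ℝ}
    (hE : Function.support g ⊆ E) :
    Function.support (diffOp r s g) ⊆ ⋃ j ∈ Finset.range (r + 1), (fun x => x + j * s) ⁻¹' E := by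
  intro x hx
  rw [Function.mem_support, diffOp] at hx
  obtain ⟨j, hj, hne⟩ := Finset.exists_ne_zero_of_sum_ne_zero hx
  rw [Set.mem_iUnion₂]
  exact ⟨j, hj, hE (right_ne_zero_of_mul hne)⟩

lemma volume_iUnion_preimage_add_le (r : ℕ) (s : ℝ) (E : Set ℝ) :
    volume (⋃ j ∈ Finset.range (r + 1), (fun x => x + j * s) ⁻¹' E) ≤ (r + 1 : ℕ) * volume E := by
  refine (measure_biUnion_finset_le _ _).trans ?_
  simp only [measure_preimage_add_right]
  simp

lemma diffOp_const_mul (r : ℕ) (s A : ℝ) (g : ℝ → ℝ) :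
    diffOp r s (fun x => A * g x) = fun x => A * diffOp r s g x := by
  funext x
  simp only [diffOp, Finset.mul_sum]
  refine Finset.sum_congr rfl fun j _ => ?_
  ring

/-- A single bump is supported on length `1 / N` and its differences on at most `(r + 1) / N`, so
all `L_p` quasi-norms gain `N ^ (-1/p)`. The factor `r + 1` is paid by `σ`. -/
lemma exists_besovNorm_bumpSum_le {d : ℕ} {r : ℕ} (hr : 0 < r) (i : Fin d) {a : Fin d → ℝ}
    (ha : 0 < a i) (har : a i < r) {p θ : ℝ≥0∞} (hθ : θ ≠ 0) :
    ∃ K : ℝ, 0 < K ∧ ∀ A N : ℝ, 0 ≤ A → 1 ≤ N →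
      (∀ F : Finset ℕ, besovNorm r a p θ (fun x => A * bumpSum F N (x i)) ≤
        ENNReal.ofReal (K * A * N ^ a i)) ∧
      ∀ l : ℕ, besovNorm r a p θ (fun x => A * bumpSum {l} N (x i)) ≤
        ENNReal.ofReal (K * A * N ^ (a i - p.toReal⁻¹)) := by
  obtain ⟨K, hK, hbes⟩ := exists_besovNorm_comp_eval_le hr i ha har hθ
  obtain ⟨C, hC, hdiff⟩ := exists_abs_diffOp_bumpSum_le r
  set σ : ℝ := ((r : ℝ) + 1) ^ p.toReal⁻¹ with hσ
  have hσ1 : 1 ≤ σ := Real.one_le_rpow (by linarith [Nat.cast_nonneg (α := ℝ) r]) (by positivity)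
  have hC0 : 0 < C := by linarith
  have hσ0 : 0 < σ := by linarith
  refine ⟨(K.toReal + 1) * C * σ, by positivity, fun A N hA hN => ?_⟩
  have hN0 : 0 < N := by linarith
  have hKK : K ≤ ENNReal.ofReal (K.toReal + 1) := by
    rw [← ENNReal.ofReal_toReal hK]
    exact ENNReal.ofReal_le_ofReal (by rw [ENNReal.toReal_ofReal ENNReal.toReal_nonneg]; linarith)
  have hcont : ∀ F, Continuous fun x => A * bumpSum F N x := fun F =>
    continuous_const.mul (continuous_bumpSum F N)
  have hb0 : ∀ F x, |A * bumpSum F N x| ≤ A * C := by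
    intro F x
    rw [abs_mul, abs_of_nonneg hA]
    exact mul_le_mul_of_nonneg_left ((abs_bumpSum_le F N x).trans hC) hA
  have hb1 : ∀ F s x, |diffOp r s (fun x => A * bumpSum F N x) x| ≤
      A * C * min 1 (|N * s| ^ r) := by
    intro F s x
    rw [diffOp_const_mul, abs_mul, abs_of_nonneg hA, mul_assoc]
    exact mul_le_mul_of_nonneg_left (hdiff F N s x) hA
  have hAC : 0 ≤ A * C := by positivity
  refine ⟨fun F => ?_, fun l => ?_⟩
  · refine (hbes p (fun x => A * bumpSum F N x) (ENNReal.ofReal (A * C)) N hN (hcont F)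
      (eLpNorm_Icc_le_of_abs_le (hb0 F) p) fun s => ?_).trans ?_
    · rw [← ENNReal.ofReal_mul hAC]
      exact eLpNorm_Icc_le_of_abs_le (hb1 F s) p
    · refine (mul_le_mul_left hKK _).trans ?_
      rw [← ENNReal.ofReal_mul hAC, ← ENNReal.ofReal_mul (by positivity)]
      refine ENNReal.ofReal_le_ofReal ?_
      calc _ = (K.toReal + 1) * C * A * N ^ a i * 1 := by ring
        _ ≤ (K.toReal + 1) * C * A * N ^ a i * σ := by gcongr
        _ = _ := by ring
  · have hvol : ((r + 1 : ℕ) : ℝ≥0∞) * volume (Set.Ioo (l / N) ((l + 1) / N)) ≤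
        ENNReal.ofReal ((r + 1) / N) := by
      rw [Real.volume_Ioo, ← ENNReal.ofReal_natCast, ← ENNReal.ofReal_mul (by positivity)]
      refine ENNReal.ofReal_le_ofReal (le_of_eq ?_)
      push_cast
      field_simp
      ring
    have hsupp : Function.support (fun x => A * bumpSum {l} N x) ⊆
        Set.Ioo (l / N) ((l + 1) / N) :=
      (Function.support_mul_subset_right _ _).trans (support_bumpSum_subset l hN0)
    have hV : ENNReal.ofReal ((r + 1) / N) ^ p.toReal⁻¹ =
        ENNReal.ofReal (σ * N ^ (-p.toReal⁻¹)) := by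
      rw [ENNReal.ofReal_rpow_of_nonneg (by positivity) (by positivity),
        Real.div_rpow (by positivity) hN0.le, Real.rpow_neg hN0.le, div_eq_mul_inv]
    refine (hbes p (fun x => A * bumpSum {l} N x)
      (ENNReal.ofReal (σ * N ^ (-p.toReal⁻¹)) * ENNReal.ofReal (A * C)) N hN (hcont {l})
      ?_ fun s => ?_).trans ?_
    · rw [← hV]
      refine eLpNorm_Icc_le_of_support_subset (hb0 {l}) hsupp (le_trans ?_ hvol) p
      refine le_mul_of_one_le_left zero_le ?_
      exact_mod_cast Nat.succ_le_succ (Nat.zero_le r)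
    · rw [← hV, mul_assoc, ← ENNReal.ofReal_mul hAC]
      exact eLpNorm_Icc_le_of_support_subset (hb1 {l} s) (support_diffOp_subset r s hsupp)
        ((volume_iUnion_preimage_add_le r s _).trans hvol) p
    · refine (mul_le_mul_left hKK _).trans ?_
      rw [← ENNReal.ofReal_mul (by positivity), ← ENNReal.ofReal_mul (by positivity),
        ← ENNReal.ofReal_mul (by positivity)]
      refine ENNReal.ofReal_le_ofReal (le_of_eq ?_)
      rw [Real.rpow_sub hN0, Real.rpow_neg hN0.le]
      ring

/-- Among `2 n` translates of the bump at least `n` vanish at `n` given points. -/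
lemma exists_vanishing_bumps (n : ℕ) (N : ℝ) (y : Fin n → ℝ) : ∃ F : Finset ℕ, n ≤ F.card ∧
    (∀ l ∈ F, l < 2 * n) ∧ ∀ l ∈ F, ∀ j, bump (N * y j - l) = 0 := by
  classical
  -- A node `y j` can be seen only by the translate with index `⌊N * y j⌋₊`, so `n` nodes spoil at
  -- most `n` of them.
  refine ⟨Finset.range (2 * n) \ Finset.univ.image fun j => ⌊N * y j⌋₊, ?_, ?_, ?_⟩
  · have h1 := Finset.le_card_sdiff (Finset.univ.image fun j : Fin n => ⌊N * y j⌋₊)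
      (Finset.range (2 * n))
    have h2 : (Finset.univ.image fun j : Fin n => ⌊N * y j⌋₊).card ≤ n :=
      Finset.card_image_le.trans (by simp)
    rw [Finset.card_range] at h1
    omega
  · intro l hl
    exact Finset.mem_range.1 (Finset.mem_sdiff.1 hl).1
  · intro l hl j
    refine bump_eq_zero fun h => (Finset.mem_sdiff.1 hl).2
      (Finset.mem_image.2 ⟨j, Finset.mem_univ j, ?_⟩)
    have hl0 : (0 : ℝ) ≤ l := Nat.cast_nonneg l
    exact (Nat.floor_eq_iff (by linarith [h.1])).2 ⟨by linarith [h.1], by linarith [h.2]⟩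

/-- With `N = 2 n`: for `p ≥ 1` all surviving bumps are used, with amplitude of order `N ^ (-a i)`,
and they fill a fixed proportion of the interval. For `p < 1` one bump with amplitude of order `N ^
(-a i + 1/p)` is used; its integral carries the further factor `1 / N`. -/
lemma exists_fooling_function {d : ℕ} {r : ℕ} (hr : 0 < r) (i : Fin d) {a : Fin d → ℝ}
    (ha : 0 < a i) (har : a i < r) {p θ : ℝ≥0∞} (hp : p ≠ 0) (hθ : θ ≠ 0) :
    ∃ c : ℝ, 0 < c ∧ ∀ n : ℕ, 1 ≤ n → ∀ X : Fin n → Fin d → ℝ,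
      ∃ f ∈ besovBall r a p θ, (∀ j, f (X j) = 0) ∧
        c * (n : ℝ) ^ (-a i + max (p⁻¹.toReal - 1) 0) ≤ cubeIntegral f := by
  obtain ⟨K, hK, hbes⟩ := exists_besovNorm_bumpSum_le hr i ha har (p := p) hθ
  set κ := ∫ y in (0 : ℝ)..1, bump y with hκ
  have hκ0 : 0 < κ := integral_bump_pos
  set E : ℝ := -a i + max (p⁻¹.toReal - 1) 0 with hE
  have hpinv : p⁻¹.toReal = p.toReal⁻¹ := ENNReal.toReal_inv p
  refine ⟨K⁻¹ * 2 ^ E * κ / 2, by positivity, fun n hn X => ?_⟩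
  have hn0 : (0 : ℝ) < n := by exact_mod_cast hn
  set N : ℝ := ((2 * n : ℕ) : ℝ) with hN
  have hN' : N = 2 * n := by rw [hN]; push_cast; ring
  have hN1 : 1 ≤ N := by rw [hN]; exact_mod_cast (by omega : 1 ≤ 2 * n)
  have hN0 : 0 < N := by linarith
  have hNE : N ^ E = 2 ^ E * (n : ℝ) ^ E := by rw [hN', Real.mul_rpow (by norm_num) hn0.le]
  obtain ⟨F, hFn, hF, hF0⟩ := exists_vanishing_bumps n N fun j => X j i
  have hint : ∀ (A : ℝ) (G : Finset ℕ), G ⊆ F →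
      cubeIntegral (fun x : Fin d → ℝ => A * bumpSum G N (x i)) = A * (G.card / N * κ) := by
    intro A G hG
    rw [cubeIntegral_comp_eval i (g := fun y => A * bumpSum G N y)
      (continuous_const.mul (continuous_bumpSum G N)), intervalIntegral.integral_const_mul, hN,
      integral_bumpSum (by omega) fun l hl => hF l (hG hl)]
  have hvan : ∀ (A : ℝ) (G : Finset ℕ), G ⊆ F → ∀ j, A * bumpSum G N (X j i) = 0 := by
    intro A G hG j
    rw [bumpSum, Finset.sum_eq_zero fun l hl => hF0 l (hG hl) j, mul_zero]
  have hcont : ∀ (A : ℝ) (G : Finset ℕ),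
      ContinuousOn (fun x : Fin d → ℝ => A * bumpSum G N (x i)) (cube d) := fun A G =>
    (continuous_const.mul ((continuous_bumpSum G N).comp (continuous_apply i))).continuousOn
  rcases le_or_gt 1 p with h1p | hp1
  · have hE' : E = -a i := by
      have : p⁻¹.toReal ≤ 1 := by
        rw [← ENNReal.toReal_one]
        exact ENNReal.toReal_mono ENNReal.one_ne_top (ENNReal.inv_le_one.2 h1p)
      rw [hE, max_eq_right (by linarith), add_zero]
    have hA : 0 ≤ K⁻¹ * N ^ E := by positivity
    refine ⟨fun x => K⁻¹ * N ^ E * bumpSum F N (x i), ⟨hcont _ _, ?_⟩,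
      hvan _ F subset_rfl, ?_⟩
    · refine ((hbes _ N hA hN1).1 F).trans_eq ?_
      rw [mul_inv_cancel_left₀ hK.ne', hE', ← Real.rpow_add hN0, neg_add_cancel, Real.rpow_zero,
        ENNReal.ofReal_one]
    · rw [hint _ F subset_rfl, hNE]
      have h2 : (1 : ℝ) / 2 ≤ F.card / N := by
        rw [hN', div_le_div_iff₀ (by norm_num) (by positivity)]
        have : (n : ℝ) ≤ F.card := by exact_mod_cast hFn
        linarith
      calc _ = K⁻¹ * (2 ^ E * (n : ℝ) ^ E) * (1 / 2 * κ) := by ring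
        _ ≤ _ := by gcongr
  · have hpt : p ≠ ∞ := (hp1.trans ENNReal.one_lt_top).ne
    have h1 : 1 ≤ p.toReal⁻¹ := by
      rw [one_le_inv₀ (ENNReal.toReal_pos hp hpt), ← ENNReal.toReal_one]
      exact ENNReal.toReal_mono ENNReal.one_ne_top hp1.le
    have hE' : E + 1 = -(a i - p.toReal⁻¹) := by
      rw [hE, hpinv, max_eq_left (by linarith)]
      ring
    obtain ⟨l, hl⟩ := Finset.card_pos.1 (by omega : 0 < F.card)
    have hlF : {l} ⊆ F := Finset.singleton_subset_iff.2 hl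
    have hA : 0 ≤ K⁻¹ * N ^ (E + 1) := by positivity
    refine ⟨fun x => K⁻¹ * N ^ (E + 1) * bumpSum {l} N (x i), ⟨hcont _ _, ?_⟩,
      hvan _ {l} hlF, ?_⟩
    · refine ((hbes _ N hA hN1).2 l).trans_eq ?_
      rw [mul_inv_cancel_left₀ hK.ne', hE', ← Real.rpow_add hN0, neg_add_cancel, Real.rpow_zero,
        ENNReal.ofReal_one]
    · rw [hint _ {l} hlF, Finset.card_singleton, Real.rpow_add hN0, Real.rpow_one, hNE]
      have : 0 ≤ K⁻¹ * 2 ^ E * κ * (n : ℝ) ^ E := by positivity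
      have e : K⁻¹ * (2 ^ E * (n : ℝ) ^ E * N) * (((1 : ℕ) : ℝ) / N * κ) =
          K⁻¹ * 2 ^ E * κ * (n : ℝ) ^ E := by
        push_cast
        field_simp
      rw [e]
      linarith

lemma exists_le_optimalCubature {d : ℕ} {r : ℕ} (hr : 0 < r) (i : Fin d) {a : Fin d → ℝ}
    (ha : 0 < a i) (har : a i < r) {p θ : ℝ≥0∞} (hp : p ≠ 0) (hθ : θ ≠ 0) :
    ∃ c : ℝ, 0 < c ∧ ∀ n : ℕ, 1 ≤ n →
      ENNReal.ofReal (c * (n : ℝ) ^ (-a i + max (p⁻¹.toReal - 1) 0)) ≤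
        optimalCubature n (besovBall r a p θ) := by
  obtain ⟨c, hc, h⟩ := exists_fooling_function hr i ha har hp hθ
  refine ⟨c, hc, fun n hn => le_iInf fun X => le_iInf fun _ => le_iInf fun L => ?_⟩
  obtain ⟨f, hf, hf0, hfi⟩ := h n hn X
  refine le_iSup₂_of_le f hf (ENNReal.ofReal_le_ofReal ?_)
  simp only [hf0, mul_zero, Finset.sum_const_zero, sub_zero]
  exact hfi.trans (le_abs_self _)

/-! ### Upper bounds -/

lemma levelSlope_zero {d : ℕ} [NeZero d] (a : Fin d → ℝ) (p θ : ℝ≥0∞) (ε : ℝ) :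
    levelSlope a p θ ε 0 = a 0 - max (p⁻¹.toReal - 1) 0 := by
  simp [levelSlope]

lemma levelSlope_zero_lt {d : ℕ} [NeZero d] {a : Fin d → ℝ} (p θ : ℝ≥0∞) {ε : ℝ}
    (ha₂ : ∀ i, i ≠ 0 → a 0 < a i) (hεa : ∀ i, i ≠ 0 → ε < a i - a 0) (i : Fin d) (hi : i ≠ 0) :
    levelSlope a p θ ε 0 < levelSlope a p θ ε i := by
  rw [levelSlope_zero, levelSlope]
  have h1 := ha₂ i hi
  have h2 := hεa i hi
  split_ifs <;> linarith

lemma levelSlope_pos {d : ℕ} [NeZero d] {a : Fin d → ℝ} {p : ℝ≥0∞} (θ : ℝ≥0∞) {ε : ℝ}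
    (ha₁ : p⁻¹.toReal < a 0) (ha₂ : ∀ i, i ≠ 0 → a 0 < a i)
    (hεa : ∀ i, i ≠ 0 → ε < a i - a 0) (i : Fin d) : 0 < levelSlope a p θ ε i := by
  have h0 : 0 < levelSlope a p θ ε 0 := by
    rw [levelSlope_zero, sub_pos, max_lt_iff]
    have : 0 ≤ p⁻¹.toReal := ENNReal.toReal_nonneg
    constructor <;> linarith
  by_cases hi : i = 0
  · rw [hi]; exact h0
  · exact h0.trans (levelSlope_zero_lt p θ ha₂ hεa i hi)

lemma levels_eq_empty {d : ℕ} {c : Fin d → ℝ} (hc : ∀ i, 0 < c i) {ξ : ℝ} (hξ : ξ < 0) :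
    levels c ξ = ∅ := by
  refine Set.eq_empty_of_forall_notMem fun k hk => ?_
  have : 0 ≤ ∑ i, c i * (k i : ℝ) :=
    Finset.sum_nonneg fun i _ => mul_nonneg (hc i).le (Nat.cast_nonneg _)
  linarith [mem_levels.1 hk]

lemma le_ofReal_toReal_add_one_mul {B : ℝ≥0∞} (hB : B ≠ ∞) {n : ℕ} (hn : 1 ≤ n) (s : ℝ) :
    B * (n : ℝ≥0∞) ^ s ≤ ENNReal.ofReal ((B.toReal + 1) * (n : ℝ) ^ s) := by
  have hn0 : (0 : ℝ) < n := by exact_mod_cast hn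
  rw [ENNReal.ofReal_mul (by positivity), ← ENNReal.ofReal_rpow_of_pos hn0, ENNReal.ofReal_natCast]
  gcongr
  rw [ENNReal.le_ofReal_iff_toReal_le hB (by positivity)]
  linarith

lemma exists_gridCubature_error_le {d : ℕ} [NeZero d] {p θ : ℝ≥0∞} (hp : p ≠ 0) (hθ : θ ≠ 0)
    {r : ℕ} (hr : 0 < r) {a : Fin d → ℝ} (ha₁ : p⁻¹.toReal < a 0)
    (ha₂ : ∀ i, i ≠ 0 → a 0 < a i) {μ : ℕ} {lam : ℤ → ℝ} (hQ : IsQuasiInterpolation r μ lam)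
    {ε : ℝ} (hε : 0 < ε) (hεa : ∀ i, i ≠ 0 → ε < a i - a 0) :
    ∃ C : ℝ, 0 < C ∧
      (∀ (n : ℕ) (ξ : ℝ), 1 ≤ n → IsLargestParam (levels (levelSlope a p θ ε)) n ξ →
        integrationError (besovBall r a p θ)
            (gridCubature r μ lam (levels (levelSlope a p θ ε) ξ)) ≤
          ENNReal.ofReal (C * (n : ℝ) ^ (-a 0 + max (p⁻¹.toReal - 1) 0))) ∧
      ∀ n : ℕ, 1 ≤ n → optimalCubature n (besovBall r a p θ) ≤
        ENNReal.ofReal (C * (n : ℝ) ^ (-a 0 + max (p⁻¹.toReal - 1) 0)) := by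
  set c := levelSlope a p θ ε with hcdef
  have hc : ∀ i, 0 < c i := levelSlope_pos θ ha₁ ha₂ hεa
  have hc' : ∀ i, i ≠ 0 → c 0 < c i := levelSlope_zero_lt p θ ha₂ hεa
  have ha' : ∀ i, a 0 ≤ a i := fun i => by
    by_cases hi : i = 0
    · rw [hi]
    · exact (ha₂ i hi).le
  obtain ⟨B, hB, herr⟩ := exists_cubature_error_le (ε := ε) hQ hr hp hθ ha₁ ha' hε hc
  obtain ⟨K, hK, hξ⟩ := exists_two_rpow_neg_le hc hc'
  have hs : -a 0 + max (p⁻¹.toReal - 1) 0 = -c 0 := by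
    rw [hcdef, levelSlope_zero]; ring
  rw [hs]
  -- The first summand serves largest parameters, the second the finitely many `n < 2 ^ d`.
  set T : ℝ≥0∞ := B * K + B * 2 * ((2 ^ d : ℕ) : ℝ≥0∞) ^ c 0 with hT
  have hTt : T ≠ ∞ := by
    refine ENNReal.add_ne_top.2 ⟨ENNReal.mul_ne_top hB hK, ENNReal.mul_ne_top
      (ENNReal.mul_ne_top hB (by norm_num)) ?_⟩
    exact ENNReal.rpow_ne_top_of_nonneg (hc 0).le (ENNReal.natCast_ne_top _)
  have h1 : ∀ (n : ℕ) (ξ : ℝ), 1 ≤ n → IsLargestParam (levels c) n ξ →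
      integrationError (besovBall r a p θ) (gridCubature r μ lam (levels c ξ)) ≤
        ENNReal.ofReal ((T.toReal + 1) * (n : ℝ) ^ (-c 0)) := by
    intro n ξ hn hlp
    refine ((herr ξ).trans ?_).trans (le_ofReal_toReal_add_one_mul hTt hn _)
    refine (mul_le_mul_right (hξ n ξ hn hlp) _).trans ?_
    rw [← mul_assoc]
    exact mul_le_mul_left (le_add_right le_rfl) _
  refine ⟨T.toReal + 1, by positivity, h1, fun n hn => ?_⟩
  rcases le_or_gt (2 ^ d) n with hnd | hnd
  · obtain ⟨ξ, hlp⟩ := exists_isLargestParam hc hnd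
    exact (optimalCubature_le r μ lam (finite_levels hc ξ) hlp.2.1 _).trans (h1 n ξ hn hlp)
  -- For `n < 2 ^ d` a largest parameter need not exist. The parameter `-1` gives the zero formula,
  -- whose error is at most `2 * B`; the factor `(2 ^ d) ^ c 0` in `T` compensates for `n ^ (-c 0)`.
  · have hempty : levels c (-1) = ∅ := levels_eq_empty hc (by norm_num)
    have hgrid : (grid (levels c (-1))).encard ≤ n := by
      rw [hempty]
      simp [grid, gridIndex]
    refine (optimalCubature_le r μ lam (finite_levels hc (-1)) hgrid _).trans ?_
    refine ((herr (-1)).trans ?_).trans (le_ofReal_toReal_add_one_mul hTt hn _)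
    rw [neg_neg, ENNReal.rpow_one]
    have hn0 : (n : ℝ≥0∞) ^ c 0 ≠ 0 := by
      rw [Ne, ENNReal.rpow_eq_zero_iff]
      have : (n : ℝ≥0∞) ≠ 0 := by exact_mod_cast (by omega : n ≠ 0)
      simp [this]
    have hnt : (n : ℝ≥0∞) ^ c 0 ≠ ∞ :=
      ENNReal.rpow_ne_top_of_nonneg (hc 0).le (ENNReal.natCast_ne_top n)
    rw [ENNReal.rpow_neg, ← div_eq_mul_inv, ENNReal.le_div_iff_mul_le (.inl hn0) (.inl hnt)]
    refine le_trans ?_ (le_add_left le_rfl)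
    gcongr
    exact (hc 0).le

end SparseGrid

end

/-! ### The theorem: the fooling functions, the error bound and the grid identities combined. -/

theorem mainTheorem6 {d : ℕ} [NeZero d] (p θ : ℝ≥0∞) (hp : p ≠ 0) (hθ : θ ≠ 0)
    (r : ℕ) (a : Fin d → ℝ)
    (ha₁ : p⁻¹.toReal < a 0) (ha₂ : ∀ i, i ≠ 0 → a 0 < a i) (ha_mono : Monotone a)
    (har : ∀ i, a i < r)
    (μ : ℕ) (lam : ℤ → ℝ) (hQ : SparseGrid.IsQuasiInterpolation r μ lam)
    (ε : ℝ) (hε : 0 < ε) (hεa : ∀ i, i ≠ 0 → ε < a i - a 0) :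
    ∃ c C : ℝ, 0 < c ∧ 0 < C ∧
      (∀ n : ℕ, 1 ≤ n →
        ENNReal.ofReal (c * (n : ℝ) ^ (-a 0 + max (p⁻¹.toReal - 1) 0)) ≤
            SparseGrid.optimalCubature n (SparseGrid.besovBall r a p θ) ∧
          SparseGrid.optimalCubature n (SparseGrid.besovBall r a p θ) ≤
            ENNReal.ofReal (C * (n : ℝ) ^ (-a 0 + max (p⁻¹.toReal - 1) 0))) ∧
      (∀ n : ℕ, 2 ^ d ≤ n →
        (∃ ξ : ℝ, SparseGrid.IsLargestParam (SparseGrid.levelSet a p θ 1 ε) n ξ) ∧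
        ∀ ξ : ℝ, SparseGrid.IsLargestParam (SparseGrid.levelSet a p θ 1 ε) n ξ →
          (SparseGrid.levelSet a p θ 1 ε ξ).Finite ∧
          (∀ k s : Fin d → ℕ,
            IntegrableOn (SparseGrid.sampleFun r μ lam k s) (SparseGrid.cube d)) ∧
          (∀ f : (Fin d → ℝ) → ℝ, ∀ x ∈ SparseGrid.cube d,
            SparseGrid.samplingOp r μ lam (SparseGrid.levelSet a p θ 1 ε ξ) f x =
              ∑ᶠ ks ∈ SparseGrid.gridIndex (SparseGrid.levelSet a p θ 1 ε ξ),
                f (SparseGrid.gridPoint ks.1 ks.2) *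
                  SparseGrid.sampleFun r μ lam ks.1 ks.2 x) ∧
          SparseGrid.optimalCubature n (SparseGrid.besovBall r a p θ) ≤
            SparseGrid.integrationError (SparseGrid.besovBall r a p θ)
              (SparseGrid.gridCubature r μ lam (SparseGrid.levelSet a p θ 1 ε ξ)) ∧
          SparseGrid.integrationError (SparseGrid.besovBall r a p θ)
              (SparseGrid.gridCubature r μ lam (SparseGrid.levelSet a p θ 1 ε ξ)) ≤
            ENNReal.ofReal (C * (n : ℝ) ^ (-a 0 + max (p⁻¹.toReal - 1) 0))) := by
  have ha0 : 0 < a 0 := lt_of_le_of_lt ENNReal.toReal_nonneg ha₁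
  have hr : 0 < r := by exact_mod_cast ha0.trans (har 0)
  have hc := SparseGrid.levelSlope_pos θ ha₁ ha₂ hεa
  obtain ⟨c, hc0, hlow⟩ := SparseGrid.exists_le_optimalCubature hr 0 ha0 (har 0) hp hθ
  obtain ⟨C, hC0, herr, hup⟩ :=
    SparseGrid.exists_gridCubature_error_le hp hθ hr ha₁ ha₂ hQ hε hεa
  rw [SparseGrid.levelSet_eq]
  refine ⟨c, C, hc0, hC0, fun n hn => ⟨hlow n hn, hup n hn⟩, fun n hn =>
    ⟨SparseGrid.exists_isLargestParam hc hn, fun ξ hξ => ?_⟩⟩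
  have hfin := SparseGrid.finite_levels hc ξ
  have hn1 : 1 ≤ n := Nat.one_le_two_pow.trans hn
  exact ⟨hfin, SparseGrid.integrableOn_sampleFun r μ lam,
    fun f x _ => SparseGrid.samplingOp_eq r μ lam hfin f x,
    SparseGrid.optimalCubature_le r μ lam hfin hξ.2.1 _, herr n ξ hn1 hξ⟩
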